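/- **Setting.** Let $\mathcal S,\mathcal A$ be finite nonempty sets of sizes $S,A$, let $H\ge 1$ and $K\geq 0$ be integers, and put $T=KH$, $[H]=\{1,\dots,H\}$, $\iota=\log(SAT)$. An episodic MDP $M$ consists of transition laws $\mathbb P_h(\cdot\mid x,a)$ on $\mathcal S$ and rewards $r_h(x,a)\in[0,1]$, for $h\in[H]$, $(x,a)\in\mathcal S\times\mathcal A$. A policy is a family of maps $\pi_h:\mathcal S\to\mathcal A$. $V_h^\pi(x)$ is the expected sum of the rewards of steps $h,\dots,H$ from state $x$ under $\pi$ ($V^\pi_{H+1}=0$), $V_h^*(x)=\max_\pi V_h^\pi(x)$, $Q_h^*(x,a)=r_h(x,a)+\mathbb E_{x'\sim\mathbb P_h(\cdot\mid x,a)}[V_{h+1}^*(x')]$, and $\Delta_h(x,a)=V^*_h(x)-Q_h^*(x,a)$. Let $A^{\rm opt}_{h}(x)=\{a:\Delta_h(x,a)\le 0\}$, $\mathcal A_{\rm mul}=\{(x,a,h):\Delta_h(x,a)=0,\ |A_h^{\rm opt}(x)|>1\}$, and let $\Delta_{\min}$ be the smallest positive gap ($|\mathcal A_{\rm mul}|/\Delta_{\min}:=0$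 if no gap is positive). For $\lambda\ge 0$ the $\lambda$-cost is $$\mathcal C_{M,T,\lambda}=\min\Big\{\sqrt{\lambda\,TSAH^8\iota},\ H^7\iota\Big(\sum_{(x,a,h):\,a\notin A_h^{\rm opt}(x)}\frac1{\Delta_h(x,a)}+\frac{|\mathcal A_{\rm mul}|}{\Delta_{\min}}\Big)\Big\}.$$ In episodes $k=1,\dots,K$ an adversary picks $x_1^k$ (possibly at random, after seeing all earlier episodes), the learner plays a policy $\pi^k$, and a trajectory $(x_h^k,a_h^k)_{h\in[H]}$ with $a_h^k=\pi_h^k(x_h^k)$ and $x_{h+1}^k\sim\mathbb P_h(\cdot\mid x_h^k,a_h^k)$ is observed together with its rewards. The regret is $\sum_{k=1}^K\mathbb E[V_1^*(x_1^k)-V_1^{\pi^k}(x_1^k)]$. **Predictions.** The learner is given predictions $\tilde Q_h:\mathcal S\times\mathcal A\to\mathbb R$, $h\in[H]$. Write $[y]_+=\max\{y,0\}$. $\tilde Q$ is an *$\varepsilon$-approximate distillation* (of $Q^*$) if for all $(x,h)$ some $a$ satisfies $\Delta_h(x,a)+[Q^*_h(x,a)-\tilde Q_h(x,a)]_+\le\varepsilon$.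 The fooling set $\mathcal F(\varepsilon_1,\varepsilon_2)$ consists of all $(x,a,h)$ with $\tilde Q_h(x,a)-Q_h^*(x,a)\ge\Delta_h(x,a)-\varepsilon_1\ge\varepsilon_2-\varepsilon_1$ or $\tilde Q_h(x,a)>V_h^*(x)+\varepsilon_2$. $\tilde Q$ *lacks $\varepsilon'$-fooling optimal actions* if there are no $(x,h)$ with $|A_h^{\rm opt}(x)|>1$ and $a\in A_h^{\rm opt}(x)$ such that $\tilde Q_h(x,a)>V_h^*(x)+\varepsilon'$. **The algorithm QLearningPreds with the DeltaConst subroutine.** It depends on constants $C_0,C_1$ and is given $\mathcal S,\mathcal A,H,K,\tilde Q$ and $\mathcal R\in\mathbb R$. Put $\alpha_n=\frac{H+1}{H+n}$, $\alpha_n^i=\alpha_i\prod_{j=i+1}^n(1-\alpha_j)$ for $1\le i\le n$, $\alpha_n^0=1$ if $n=0$ and $\alpha_n^0=0$ otherwise, $b_n=C_0\sqrt{H^3\iota/n}$, $\beta_n=2\sum_{i=1}^n\alpha_n^ib_i$. Ties in every $\arg\max$ are broken by a fixed arbitrary rule, which selects a maximizer as a function of the set and of the objective. *Initialization*, for all $(x,a,h)$: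 $N_h^1=0$; $\bar R_h^1=\bar Q_h^1=\bar V_h^1=\bar q_h^1=H$; $\underline Q_h^1=\underline V_h^1=\underline q_h^1=0$; $\mathrm{RanQ}_h^1=\mathrm{RanV}_h^1=H$; $\tilde Q_h^1=\tilde Q_h$; $\tilde V_h^1(x)=\max_{a}\tilde Q_h(x,a)$; active sets $A_h^1(x)=\mathcal A$; $G_h^1=\emptyset$; $\hat\Delta^1=0$. All $V$-type functions vanish at step $H+1$. *Episode $k$.* The policy is $$\pi_h^k(x)=\begin{cases}\text{the element of }A_h^k(x)&\text{if }|A_h^k(x)|=1,\\ \arg\max_{a\in A_h^k(x)}\max\{\tilde Q_h^k(x,a),\underline Q_h^k(x,a)\}&\text{else, if }\mathrm{RanV}_h^k(x)\le C_1(1+\tfrac1H)^{4(H+1-h)}\hat\Delta^k,\\ \arg\max_{a\in A_h^k(x)}\{\bar Q_h^k(x,a)-\underline Q_h^k(x,a)\}&\text{otherwise.}\end{cases}$$ After the trajectory has been observed, quantities are updated as follows; all those not mentioned keep their values. 1. For all $h$: $N_h^{k+1}(x_h^k,a_h^k)=N_h^k(x_h^k,a_h^k)+1$. Below, $n=N_h^{k+1}(x_h^k,a_h^k)$.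 2. For each $h$ with $x_h^k\notin G_h^k$, let $h'>h$ be the first later step with $x_{h'}^k\notin G_{h'}^k$ ($h'=H+1$ if there is none) and $\hat r=\sum_{i=h}^{h'-1}r_i(x_i^k,a_i^k)$. At $(x_h^k,a_h^k)$ set $\bar q_h^{k+1}=(1-\alpha_n)\bar q_h^k+\alpha_n(\hat r+\bar V_{h'}^k(x_{h'}^k)+b_n)$, $\underline q_h^{k+1}=(1-\alpha_n)\underline q_h^k+\alpha_n(\hat r+\underline V_{h'}^k(x_{h'}^k)-b_n)$, $\bar Q_h^{k+1}=\min_{k'\le k+1}\bar q_h^{k'}$, $\underline Q_h^{k+1}=\max_{k'\le k+1}\underline q_h^{k'}$. Then set $\bar V_h^{k+1}(x_h^k)=\max_{a\in A_h^k(x_h^k)}\bar Q_h^{k+1}(x_h^k,a)$ and $\underline V_h^{k+1}(x_h^k)=\max_{a\in A_h^k(x_h^k)}\underline Q_h^{k+1}(x_h^k,a)$. 3. For all $(x,h)$: $A_h^{k+1}(x)=\{a\in A_h^k(x):\bar Q_h^{k+1}(x,a)\ge\underline V_h^{k+1}(x)\}$. 4. For each $h$, at $(x_h^k,a_h^k)$: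 $\bar R_h^{k+1}=(1-\alpha_n)\bar R_h^k+\alpha_n(r_h+\tilde V_{h+1}^k(x_{h+1}^k)+b_n)$ and $\tilde Q_h^{k+1}=\min\{\bar R_h^{k+1},\tilde Q_h^k,\bar Q_h^{k+1}\}$; then $\tilde V_h^{k+1}(x_h^k)=\max_{a\in A_h^{k+1}(x_h^k)}\max\{\tilde Q_h^{k+1}(x_h^k,a),\underline Q_h^{k+1}(x_h^k,a)\}$. 5. For all $h$: $G_h^{k+1}=\{x:|A_h^{k+1}(x)|=1\}$. 6. Range functions, for all $(x,a,h)$: with $n=N_h^{k+1}(x,a)$, with $k_1<\dots$ the successive episodes up to $k$ in which $(x,a)$ was visited at step $h$ with $x\notin G_h^{k_i}$, and with $h'(k_i)$ the step $h'$ of item 2 for step $h$ of episode $k_i$, $$\mathrm{RanQ}_h^{k+1}(x,a)=\min\Big\{\mathrm{RanQ}_h^k(x,a),\ \alpha_n^0H+\beta_n+\sum_{i=1}^n\alpha_n^i\,\mathrm{RanV}^{k_i}_{h'(k_i)}(x^{k_i}_{h'(k_i)})\Big\},$$ $$\mathrm{RanV}_h^{k+1}(x)=\min\{\mathrm{RanV}_h^k(x),\mathrm{RanQ}_h^{k+1}(x,a^*)\},\qquad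 a^*=\arg\max_{a\in A_h^{k+1}(x)}\{\bar Q_h^{k+1}(x,a)-\underline Q_h^{k+1}(x,a)\}.$$ 7. $\hat\Delta^{k+1}=\mathcal R/(KH)$. (Degenerate cases are fixed arbitrarily: an undefined summand in item 6, which can occur only if $x$ was visited at step $h$ while it was in $G_h$, is $0$; should an active set ever become empty, the action played there is arbitrary and a maximum over the empty set is $0$.) **Theorem 3.3.** There are absolute constants $C_0>1$, $C_1>0$, $C>0$ such that the following holds for all $S,A,H,K$, every MDP $M$, every adversary, every tie-breaking rule, all predictions $\tilde Q$ and every $\mathcal R\in[SAH^3,\ T/(SA)]$, for QLearningPreds with the DeltaConst subroutine, run with the constants $C_0,C_1$ and with input $\tilde Q,\mathcal R$. 1. If $\mathcal R\ge\mathcal C_{M,T,1}$, then for arbitrary predictions $\tilde Q_h:\mathcal S\times\mathcal A\to\mathbb R$ the regret is at most $C\,\mathcal R$. 2. If $0<\mathcal C_{M,T,1}<\mathcal R$, there is exactly one $\lambda\in(0,1)$ with $\mathcal C_{M,T,\lambda}/\lambda=\mathcal R$. 3. Let $\hat\lambda\in(0,1)$ satisfy $\mathcal C_{M,T,\hat\lambda}/\hat\lambda=\mathcal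 R$, let $\varepsilon>0$ and $\varepsilon'=4\varepsilon(H+1)$. If $\tilde Q$ has values in $[0,H]$, is an $\varepsilon$-approximate distillation and lacks $\varepsilon'$-fooling optimal actions, then the regret is at most $$C\Big(H\,\mathcal C_{M,T,\hat\lambda}+\varepsilon'TH+\min\Big\{\sqrt{H^5T\iota\,|\mathcal F(\tfrac{\varepsilon'}2,\varepsilon')|},\ \sum_{(x,a,h)\in\mathcal F(\varepsilon'/2,\varepsilon')}\frac{H^4\iota}{[\Delta_h(x,a)-\varepsilon'/2]_+}\Big\}\Big),$$ where a summand with zero denominator is $+\infty$. -/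

import Mathlib

namespace QLP

noncomputable section

/-! ## Tabular episodic Markov decision processes

Steps are numbered `0, …, H - 1` (`Fin H`); step `h` here is the step `h + 1` of the usual
one-based numbering. Value functions take a step in `ℕ` and vanish from step `H` on. -/

/-- A finite-horizon episodic MDP with transitions `P` and deterministic rewards `r` in `[0,1]`. -/
structure MDP (S : Type*) (A : Type*) (H : ℕ) where
  /-- `P h x a` is the law of the next state. -/
  P : Fin H → S → A → PMF S
  /-- The reward function. -/
  r : Fin H → S → A → ℝ
  r_mem : ∀ h x a, r h x a ∈ Set.Icc (0 : ℝ) 1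

/-- Deterministic policies. -/
abbrev Policy (S : Type*) (A : Type*) (H : ℕ) := Fin H → S → A

/-- Expectation of a real function under a probability mass function on a finite type. -/
def expect {α : Type*} [Fintype α] (p : PMF α) (f : α → ℝ) : ℝ :=
  ∑ z, (p z).toReal * f z

namespace MDP

variable {S : Type*} {A : Type*} {H : ℕ} [Fintype S]

/-- The expected total reward from step `h` on, from state `x`, under the policy `π`. -/
def V (M : MDP S A H) (π : Policy S A H) (h : ℕ) (x : S) : ℝ :=
  if hh : h < H then
    M.r ⟨h, hh⟩ x (π ⟨h, hh⟩ x) +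
      expect (M.P ⟨h, hh⟩ x (π ⟨h, hh⟩ x)) (fun y => M.V π (h + 1) y)
  else 0
termination_by H - h

/-- The optimal value function, `max_π V_h^π(x)`. -/
def Vstar (M : MDP S A H) (h : ℕ) (x : S) : ℝ := ⨆ π : Policy S A H, M.V π h x

/-- The optimal `Q`-function: take action `a` at step `h`, then continue optimally. -/
def Qstar (M : MDP S A H) (h : Fin H) (x : S) (a : A) : ℝ :=
  M.r h x a + expect (M.P h x a) (fun y => M.Vstar (h + 1) y)

/-- The gap `Δ_h(x,a) = V_h^*(x) - Q_h^*(x,a)`. -/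
def gap (M : MDP S A H) (h : Fin H) (x : S) (a : A) : ℝ := M.Vstar h x - M.Qstar h x a

variable [Fintype A]

/-- The actions with gap at most `ε`. -/
def optActions (M : MDP S A H) (h : Fin H) (ε : ℝ) (x : S) : Finset A :=
  Finset.univ.filter fun a => M.gap h x a ≤ ε

/-- The triples `(x,a,h)` such that `a` is not an optimal action at `(x,h)`. -/
def subopt (M : MDP S A H) : Finset (S × A × Fin H) :=
  Finset.univ.filter fun z => ¬ M.gap z.2.2 z.1 z.2.1 ≤ 0

/-- The triples `(x,a,h)` such that `a` is one of several optimal actions at `(x,h)`. -/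
def multiOpt (M : MDP S A H) : Finset (S × A × Fin H) :=
  Finset.univ.filter fun z =>
    M.gap z.2.2 z.1 z.2.1 = 0 ∧ 1 < (M.optActions z.2.2 0 z.1).card

/-- The minimum positive gap. If no gap is positive this is `0` in Lean, and then
`multiOpt.card / minGap = 0`, the same value as with the convention `min ∅ = ∞`. -/
def minGap (M : MDP S A H) : ℝ :=
  sInf {δ : ℝ | ∃ h x a, 0 < M.gap h x a ∧ δ = M.gap h x a}

end MDP

/-- `ι = log (S A T)`, where `T = K H`. -/
def iota (S : Type*) (A : Type*) [Fintype S] [Fintype A] (H K : ℕ) : ℝ :=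
  Real.log (Fintype.card S * Fintype.card A * (K * H))

section Cost

variable {S : Type*} {A : Type*} {H : ℕ} [Fintype S] [Fintype A]

/-- The `λ`-cost `C_{M,T,λ}` with `T = K H`. -/
def lambdaCost (M : MDP S A H) (K : ℕ) (lam : ℝ) : ℝ :=
  min
    (√(lam * (K * H) * Fintype.card S * Fintype.card A * (H : ℝ) ^ 8 * iota S A H K))
    ((H : ℝ) ^ 7 * iota S A H K *
      ((∑ z ∈ M.subopt, 1 / M.gap z.2.2 z.1 z.2.1) + M.multiOpt.card / M.minGap))

/-- `ε`-approximate distillation of the optimal `Q`-function. -/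
def IsApproxDistillation (M : MDP S A H) (pred : Fin H → S → A → ℝ) (ε : ℝ) : Prop :=
  ∀ (h : Fin H) (x : S), ∃ a : A,
    M.gap h x a + max (M.Qstar h x a - pred h x a) 0 ≤ ε

/-- The set of `(ε₁, ε₂)`-fooling triples `(x,a,h)`. -/
def foolingSet (M : MDP S A H) (pred : Fin H → S → A → ℝ) (ε₁ ε₂ : ℝ) :
    Finset (S × A × Fin H) :=
  Finset.univ.filter fun z =>
    (pred z.2.2 z.1 z.2.1 - M.Qstar z.2.2 z.1 z.2.1 ≥ M.gap z.2.2 z.1 z.2.1 - ε₁ ∧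
      M.gap z.2.2 z.1 z.2.1 - ε₁ ≥ ε₂ - ε₁) ∨
    pred z.2.2 z.1 z.2.1 > M.Vstar z.2.2 z.1 + ε₂

/-- No optimal action, at a place with several optimal actions, is overestimated by more
than `ε`. -/
def LacksFoolingOptimal (M : MDP S A H) (pred : Fin H → S → A → ℝ) (ε : ℝ) : Prop :=
  ¬ ∃ (h : Fin H) (x : S), 1 < (M.optActions h 0 x).card ∧
    ∃ a ∈ M.optActions h 0 x, pred h x a > M.Vstar h x + ε

/-- The last term of the regret bound,
`min {√(H⁵ T ι |F|), ∑_{(x,a,h) ∈ F} H⁴ ι / [Δ_h(x,a) - ε/2]₊}` with `F` the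
`(ε/2, ε)`-fooling set. A summand with `Δ_h(x,a) ≤ ε/2` is infinite, so the minimum is taken in
`[0,∞]`; it is finite because its first entry is. -/
def foolingCost (M : MDP S A H) (K : ℕ) (pred : Fin H → S → A → ℝ) (ε : ℝ) : ℝ :=
  (min
    (ENNReal.ofReal (√((H : ℝ) ^ 5 * (K * H) * iota S A H K *
      (foolingSet M pred (ε / 2) ε).card)))
    (∑ z ∈ foolingSet M pred (ε / 2) ε,
      ENNReal.ofReal ((H : ℝ) ^ 4 * iota S A H K) /
        ENNReal.ofReal (M.gap z.2.2 z.1 z.2.1 - ε / 2))).toReal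

end Cost

/-! ## The algorithm QLearningPreds with the subroutine DeltaConst -/

/-- The learning rate `α_n = (H + 1) / (H + n)`. -/
def alpha (H n : ℕ) : ℝ := ((H : ℝ) + 1) / (H + n)

/-- The weights `α_n^i = α_i ∏_{j=i+1}^n (1 - α_j)` for `i ≥ 1`. -/
def alphaW (H n i : ℕ) : ℝ := alpha H i * ∏ j ∈ Finset.Icc (i + 1) n, (1 - alpha H j)

/-- The weight `α_n^0`, which is `1` for `n = 0` and `0` otherwise. -/
def alphaZero (n : ℕ) : ℝ := if n = 0 then 1 else 0

/-- `argmax s f` is a maximizer of `f` on `s`, whenever `s` is nonempty. Such a function fixes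
how ties are broken. -/
def IsArgmax {A : Type*} (argmax : Finset A → (A → ℝ) → A) : Prop :=
  ∀ (s : Finset A) (f : A → ℝ), s.Nonempty →
    argmax s f ∈ s ∧ ∀ b ∈ s, f b ≤ f (argmax s f)

/-- `max_{b ∈ s} f b`, with the value `0` on the empty set. -/
def maxOver {A : Type*} (s : Finset A) (f : A → ℝ) : ℝ :=
  if hs : s.Nonempty then s.sup' hs f else 0

/-- Everything the learner is given: the number `K` of episodes, the target regret `R`, the
predictions, the numerical constants `C₀`, `C₁` and a tie-breaking rule. -/
structure Input (S : Type*) (A : Type*) (H : ℕ) where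
  K : ℕ
  R : ℝ
  pred : Fin H → S → A → ℝ
  C₀ : ℝ
  C₁ : ℝ
  argmax : Finset A → (A → ℝ) → A

/-- The internal state of the learner at the beginning of an episode `k`. -/
structure State (S : Type*) (A : Type*) (H : ℕ) where
  /-- Number of earlier visits. -/
  N : Fin H → S → A → ℕ
  /-- `R̄`. -/
  Rup : Fin H → S → A → ℝ
  /-- `q̄`, the supplementary upper estimate. -/
  qup : Fin H → S → A → ℝ
  /-- The supplementary lower estimate. -/
  qlo : Fin H → S → A → ℝ
  /-- `Q̄`, the running minimum of `q̄`. -/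
  Qup : Fin H → S → A → ℝ
  /-- The running maximum of the supplementary lower estimate. -/
  Qlo : Fin H → S → A → ℝ
  Vup : Fin H → S → ℝ
  Vlo : Fin H → S → ℝ
  /-- The refined predictions `Q̃`. -/
  Qt : Fin H → S → A → ℝ
  /-- `Ṽ`. -/
  Vt : Fin H → S → ℝ
  /-- The sets of active actions `A_h(x)`. -/
  act : Fin H → S → Finset A
  /-- The sets `G_h` of determined states. -/
  G : Fin H → Finset S
  /-- For each `(h,x,a)` the list of the range `V`-values at the bootstrap states of the first,
  second, … episode in which `(x,a,h)` was visited with `x ∉ G_h`. -/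
  ranTargets : Fin H → S → A → List ℝ
  /-- The range `Q`-function. -/
  ranQ : Fin H → S → A → ℝ
  /-- The range `V`-function. -/
  ranV : Fin H → S → ℝ
  /-- `Δ̂`. -/
  Dhat : ℝ

section Algorithm

variable {S : Type*} {A : Type*} {H : ℕ}

/-- The bonus `b_n = C₀ √(H³ ι / n)`. -/
def bonus [Fintype S] [Fintype A] (I : Input S A H) (n : ℕ) : ℝ :=
  I.C₀ * √((H : ℝ) ^ 3 * iota S A H I.K / n)

/-- The aggregated bonus `β_n = 2 ∑_{i=1}^n α_n^i b_i`, which is `0` for `n = 0`. -/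
def beta [Fintype S] [Fintype A] (I : Input S A H) (n : ℕ) : ℝ :=
  2 * ∑ i ∈ Finset.Icc 1 n, alphaW H n i * bonus I i

/-- `C₁ (1 + 1/H)^{4 (H + 1 - h)} a` in one-based numbering of the step `h`. -/
def scaled (I : Input S A H) (h : Fin H) (a : ℝ) : ℝ :=
  I.C₁ * (1 + 1 / (H : ℝ)) ^ (4 * (H - (h : ℕ))) * a

/-- The state at the beginning of the first episode. -/
def initState [Fintype A] (I : Input S A H) : State S A H where
  N := fun _ _ _ => 0
  Rup := fun _ _ _ => H
  qup := fun _ _ _ => H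
  qlo := fun _ _ _ => 0
  Qup := fun _ _ _ => H
  Qlo := fun _ _ _ => 0
  Vup := fun _ _ => H
  Vlo := fun _ _ => 0
  Qt := I.pred
  Vt := fun h x => maxOver Finset.univ (I.pred h x)
  act := fun _ _ => Finset.univ
  G := fun _ => ∅
  ranTargets := fun _ _ _ => []
  ranQ := fun _ _ _ => H
  ranV := fun _ _ => H
  Dhat := 0

/-- The policy played in an episode that begins in the state `st`. -/
def choosePolicy (I : Input S A H) (st : State S A H) : Policy S A H := fun h x =>
  if (st.act h x).card = 1 then
    I.argmax (st.act h x) (fun _ => 0)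
  else if st.ranV h x ≤ scaled I h st.Dhat then
    I.argmax (st.act h x) (fun a => max (st.Qt h x a) (st.Qlo h x a))
  else
    I.argmax (st.act h x) (fun a => st.Qup h x a - st.Qlo h x a)

/-- The first step `h' > h` with `x_{h'} ∉ G_{h'}`, or `H` (the step after the last one) if there
is none. -/
def bootStep [DecidableEq S] (G : Fin H → Finset S) (x : Fin (H + 1) → S) (h : Fin H) : ℕ :=
  if hs : (Finset.univ.filter fun j : Fin H => h < j ∧ x j.castSucc ∉ G j).Nonempty then
    ((Finset.univ.filter fun j : Fin H => h < j ∧ x j.castSucc ∉ G j).min' hs : ℕ)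
  else H

/-- `V_j(x_j)`, which is `0` after the last step. -/
def valueAt (V : Fin H → S → ℝ) (x : Fin (H + 1) → S) (j : ℕ) : ℝ :=
  if hj : j < H then V ⟨j, hj⟩ (x (Fin.castSucc ⟨j, hj⟩)) else 0

/-- The reward collected in the steps `h, …, j - 1`. -/
def segReward (rew : Fin H → ℝ) (h : Fin H) (j : ℕ) : ℝ :=
  ∑ i ∈ Finset.univ.filter (fun i : Fin H => h ≤ i ∧ (i : ℕ) < j), rew i

/-! The updates at the end of an episode in which the states `x`, the actions `a` and the rewards
`rew` were observed. The argument `st` is the state at the beginning of the episode. -/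

section Update

variable [Fintype S] [DecidableEq S] [Fintype A] [DecidableEq A]
variable (I : Input S A H) (st : State S A H)
variable (x : Fin (H + 1) → S) (a : Fin H → A) (rew : Fin H → ℝ)

def nextN (h : Fin H) (y : S) (b : A) : ℕ :=
  if y = x h.castSucc ∧ b = a h then st.N h y b + 1 else st.N h y b

/-- `(y,b)` was visited at step `h`, and `y` was not a determined state. -/
def Learned (h : Fin H) (y : S) (b : A) : Prop :=
  (y = x h.castSucc ∧ b = a h) ∧ y ∉ st.G h

instance (h : Fin H) (y : S) (b : A) : Decidable (Learned st x a h y b) := by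
  unfold Learned; infer_instance

def nextqup (h : Fin H) (y : S) (b : A) : ℝ :=
  let n := nextN st x a h y b
  let h' := bootStep st.G x h
  if Learned st x a h y b then
    (1 - alpha H n) * st.qup h y b +
      alpha H n * (segReward rew h h' + valueAt st.Vup x h' + bonus I n)
  else st.qup h y b

def nextqlo (h : Fin H) (y : S) (b : A) : ℝ :=
  let n := nextN st x a h y b
  let h' := bootStep st.G x h
  if Learned st x a h y b then
    (1 - alpha H n) * st.qlo h y b +
      alpha H n * (segReward rew h h' + valueAt st.Vlo x h' - bonus I n)
  else st.qlo h y b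

def nextQup (h : Fin H) (y : S) (b : A) : ℝ := min (st.Qup h y b) (nextqup I st x a rew h y b)

def nextQlo (h : Fin H) (y : S) (b : A) : ℝ := max (st.Qlo h y b) (nextqlo I st x a rew h y b)

def nextVup (h : Fin H) (y : S) : ℝ :=
  if y = x h.castSucc ∧ y ∉ st.G h then maxOver (st.act h y) (nextQup I st x a rew h y)
  else st.Vup h y

def nextVlo (h : Fin H) (y : S) : ℝ :=
  if y = x h.castSucc ∧ y ∉ st.G h then maxOver (st.act h y) (nextQlo I st x a rew h y)
  else st.Vlo h y

def nextAct (h : Fin H) (y : S) : Finset A :=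
  (st.act h y).filter fun b => nextVlo I st x a rew h y ≤ nextQup I st x a rew h y b

def nextRup (h : Fin H) (y : S) (b : A) : ℝ :=
  let n := nextN st x a h y b
  if y = x h.castSucc ∧ b = a h then
    (1 - alpha H n) * st.Rup h y b +
      alpha H n * (rew h + valueAt st.Vt x (h + 1) + bonus I n)
  else st.Rup h y b

def nextQt (h : Fin H) (y : S) (b : A) : ℝ :=
  if y = x h.castSucc ∧ b = a h then
    min (nextRup I st x a rew h y b) (min (st.Qt h y b) (nextQup I st x a rew h y b))
  else st.Qt h y b

def nextVt (h : Fin H) (y : S) : ℝ :=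
  if y = x h.castSucc then
    maxOver (nextAct I st x a rew h y)
      (fun b => max (nextQt I st x a rew h y b) (nextQlo I st x a rew h y b))
  else st.Vt h y

def nextRanTargets (h : Fin H) (y : S) (b : A) : List ℝ :=
  if Learned st x a h y b then
    st.ranTargets h y b ++ [valueAt st.ranV x (bootStep st.G x h)]
  else st.ranTargets h y b

/-- `min {RanQ^{k-1}, α_n^0 H + β_n + ∑_{i=1}^n α_n^i RanV_{h'}^{k_i}(x_{h'}^{k_i})}`. -/
def nextRanQ (h : Fin H) (y : S) (b : A) : ℝ :=
  let n := nextN st x a h y b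
  min (st.ranQ h y b)
    (alphaZero n * H + beta I n +
      ∑ i ∈ Finset.Icc 1 n, alphaW H n i * (nextRanTargets st x a h y b).getD (i - 1) 0)

def nextRanV (h : Fin H) (y : S) : ℝ :=
  min (st.ranV h y)
    (nextRanQ I st x a h y (I.argmax (nextAct I st x a rew h y)
      (fun b => nextQup I st x a rew h y b - nextQlo I st x a rew h y b)))

/-- The state at the beginning of the next episode. -/
def update : State S A H where
  N := nextN st x a
  Rup := nextRup I st x a rew
  qup := nextqup I st x a rew
  qlo := nextqlo I st x a rew
  Qup := nextQup I st x a rew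
  Qlo := nextQlo I st x a rew
  Vup := nextVup I st x a rew
  Vlo := nextVlo I st x a rew
  Qt := nextQt I st x a rew
  Vt := nextVt I st x a rew
  act := nextAct I st x a rew
  G := fun h => Finset.univ.filter fun y => (nextAct I st x a rew h y).card = 1
  ranTargets := nextRanTargets st x a
  ranQ := nextRanQ I st x a
  ranV := nextRanV I st x a rew
  Dhat := I.R / (I.K * H)

end Update

end Algorithm

/-! ## The interaction of the algorithm with the MDP -/

section Interaction

variable {S : Type*} {A : Type*} {H : ℕ}
variable [Fintype S] [DecidableEq S] [Fintype A] [DecidableEq A]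

/-- The states visited in `k` episodes (with the state reached after the last step included). -/
abbrev History (S : Type*) (H k : ℕ) := Fin k → Fin (H + 1) → S

/-- The state of the learner after the episodes recorded in the history. Of the MDP, it depends
only on the observed states and rewards. -/
def stateAfter (M : MDP S A H) (I : Input S A H) : (k : ℕ) → History S H k → State S A H
  | 0, _ => initState I
  | k + 1, w =>
    let st := stateAfter M I k (Fin.init w)
    let x := w (Fin.last k)
    let a : Fin H → A := fun h => choosePolicy I st h (x h.castSucc)
    update I st x a (fun h => M.r h (x h.castSucc) (a h))

/-- The policy played after the episodes recorded in the history. -/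
def policyAfter (M : MDP S A H) (I : Input S A H) (k : ℕ) (w : History S H k) : Policy S A H :=
  choosePolicy I (stateAfter M I k w)

/-- The law of the first `n + 1` states of an episode from `x` under the policy `π`. -/
def rollout (M : MDP S A H) (π : Policy S A H) (x : S) : (n : ℕ) → n ≤ H → PMF (Fin (n + 1) → S)
  | 0, _ => PMF.pure (fun _ => x)
  | n + 1, hn =>
    (rollout M π x n (Nat.le_of_succ_le hn)).bind fun t =>
      (M.P ⟨n, hn⟩ (t (Fin.last n)) (π ⟨n, hn⟩ (t (Fin.last n)))).map
        fun y => (Fin.snoc t y : Fin (n + 1 + 1) → S)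

/-- An adversary that picks the first state of each episode, possibly at random, after having seen
all earlier episodes. -/
abbrev Adversary (S : Type*) (H : ℕ) := (k : ℕ) → History S H k → PMF S

/-- The law of the first `k` episodes. -/
def historyLaw (M : MDP S A H) (I : Input S A H) (adv : Adversary S H) :
    (k : ℕ) → PMF (History S H k)
  | 0 => PMF.pure Fin.elim0
  | k + 1 =>
    (historyLaw M I adv k).bind fun w =>
      (adv k w).bind fun x =>
        (rollout M (policyAfter M I k w) x H le_rfl).map
          fun t => (Fin.snoc w t : History S H (k + 1))

/-- The regret `∑_k E[V_1^*(x_1^k) - V_1^{π^k}(x_1^k)]` over the `K` episodes. -/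
def regret (M : MDP S A H) (I : Input S A H) (adv : Adversary S H) : ℝ :=
  ∑ k : Fin I.K, expect (historyLaw M I adv I.K) fun w =>
    M.Vstar 0 (w k 0) -
      M.V (policyAfter M I k (fun j => w (Fin.castLE k.isLt.le j))) 0 (w k 0)

end Interaction

end

end QLP

set_option linter.unusedSectionVars false

namespace QLP
noncomputable section

/-! ### Expectations on finite types -/

section Expect

variable {α β : Type*} [Fintype α] [Fintype β]

/-! The regret equals the expected sum of the gaps of the actions played (`regret_eq`). It therefore
suffices to bound this sum path by path on a good event and to use the trivial bound elsewhere
(`regret_le`).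

Good event. The weights α_n^i sum to one and their squares sum to at most 2H/n. An exponential
supermartingale along the visits of a fixed triple shows that the weighted sums of the one-step and
multi-step martingale differences of V* stay below b_n, except with probability at most
4HSAK·exp(-4ι) (`hexp_not_good_le`). On this event an induction over the episodes
(`GoodRun.valid_consistent`) shows that the estimates bracket Q*, that optimal actions stay active,
and that determined states are played optimally. The last fact is what makes bootstrapping across
determined states unbiased. The range functions dominate the confidence widths, so at an
undetermined state an active action has gap at most twice the range (`GoodRun.gap_le`).

Exploration. An exploring learner plays the action whose range bounds the range of the state, so
this range is at most β_n plus an average of earlier ranges at bootstrap states. Ranges are compared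
with thresholds τ(1+1/H)^{4(H-h)}. The decrease of the thresholds along an episode leaves room to
subtract max(τ, m/128)/H from β_n, where m is any lower bound for twice the range (`excess_le`). The
clipped bonuses of one triple then sum to O(H⁴ι/max(τ, m)) up to an additive H, and the excess of
later steps returns with a factor (1+1/H)², harmless over H steps (`sum_excessFrom_le`,
`sum_cost_le`). Taking τ = R/T and m = 0 gives the gap-independent bound; τ = max(R/T, Δ_min/128)
and m a local gap gives the gap-dependent one. Steps that do not explore have range at most 64R/T,
which costs O(R) in total. This proves the first claim.

Predictions. An approximate distillation keeps the refined values optimistic up to ε per remaining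
step (`GoodRun.optimism`). Conversely they overestimate only through costly exploration, visits of
fooling triples and earlier overestimation one step later (`overAt_le`); summing over steps loses
only a constant. Fooling visits are paid for by bonuses clipped at half the gap, or by
Cauchy-Schwarz. Since the threshold is R/T, gap-independent exploration costs about TSAH⁷ι/R. This
is at most λR as soon as √(λTSAH⁸ι) ≤ λR, which is why the λ-cost appears
(`regime_of_lambdaCost_le`). The second claim is elementary, with an explicit solution
(`existsUnique_ratio`). -/

theorem sum_toReal_eq_one (p : PMF α) : ∑ z, (p z).toReal = 1 := by
  have h := p.tsum_coe
  rw [tsum_fintype] at h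
  rw [← ENNReal.toReal_sum (fun z _ => p.apply_ne_top z), h, ENNReal.toReal_one]

theorem expect_const (p : PMF α) (c : ℝ) : expect p (fun _ => c) = c := by
  simp [expect, ← Finset.sum_mul, sum_toReal_eq_one]

theorem expect_add (p : PMF α) (f g : α → ℝ) :
    expect p (fun z => f z + g z) = expect p f + expect p g := by
  simp [expect, mul_add, Finset.sum_add_distrib]

theorem expect_sub (p : PMF α) (f g : α → ℝ) :
    expect p (fun z => f z - g z) = expect p f - expect p g := by
  simp [expect, mul_sub, Finset.sum_sub_distrib]

theorem expect_const_mul (p : PMF α) (c : ℝ) (f : α → ℝ) :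
    expect p (fun z => c * f z) = c * expect p f := by
  simp only [expect, Finset.mul_sum]
  exact Finset.sum_congr rfl fun z _ => by ring

theorem expect_sum {ι : Type*} (p : PMF α) (s : Finset ι) (f : ι → α → ℝ) :
    expect p (fun z => ∑ i ∈ s, f i z) = ∑ i ∈ s, expect p (f i) := by
  simp only [expect, Finset.mul_sum]
  exact Finset.sum_comm

theorem expect_mono (p : PMF α) {f g : α → ℝ} (h : ∀ z, f z ≤ g z) : expect p f ≤ expect p g :=
  Finset.sum_le_sum fun z _ => mul_le_mul_of_nonneg_left (h z) ENNReal.toReal_nonneg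

theorem expect_nonneg (p : PMF α) {f : α → ℝ} (h : ∀ z, 0 ≤ f z) : 0 ≤ expect p f :=
  Finset.sum_nonneg fun z _ => mul_nonneg ENNReal.toReal_nonneg (h z)

theorem expect_le_const (p : PMF α) {f : α → ℝ} {c : ℝ} (h : ∀ z, f z ≤ c) : expect p f ≤ c :=
  (expect_mono p h).trans_eq (expect_const p c)

theorem expect_eq_zero (p : PMF α) {f : α → ℝ} (h : ∀ z, f z = 0) : expect p f = 0 := by
  simp [expect, h]

theorem expect_bind (p : PMF α) (q : α → PMF β) (f : β → ℝ) :
    expect (p.bind q) f = expect p fun a => expect (q a) f := by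
  have key : ∀ b, ((p.bind q) b).toReal = ∑ a, (p a).toReal * (q a b).toReal := fun b => by
    rw [PMF.bind_apply, tsum_fintype, ENNReal.toReal_sum fun a _ =>
      ENNReal.mul_ne_top (p.apply_ne_top a) ((q a).apply_ne_top b)]
    simp
  simp only [expect, key, Finset.sum_mul, Finset.mul_sum]
  rw [Finset.sum_comm]
  exact Finset.sum_congr rfl fun a _ => Finset.sum_congr rfl fun b _ => by ring

theorem expect_pure (a : α) (f : α → ℝ) : expect (PMF.pure a) f = f a := by
  classical
  simp only [expect, PMF.pure_apply]
  rw [Finset.sum_eq_single a] <;> simp +contextual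

theorem expect_map (p : PMF α) (g : α → β) (f : β → ℝ) :
    expect (p.map g) f = expect p fun a => f (g a) := by
  rw [← PMF.bind_pure_comp, expect_bind]
  simp [expect_pure]

end Expect

/-! ### The Bellman equations -/

namespace MDP

variable {S A : Type*} {H : ℕ} [Fintype S]

theorem V_of_le (M : MDP S A H) (π : Policy S A H) {h : ℕ} (hh : H ≤ h) (x : S) :
    M.V π h x = 0 := by
  rw [V, dif_neg (not_lt.2 hh)]

theorem V_fin (M : MDP S A H) (π : Policy S A H) (h : Fin H) (x : S) :
    M.V π h x = M.r h x (π h x) + expect (M.P h x (π h x)) (M.V π (h + 1)) := by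
  rw [V, dif_pos h.isLt]

theorem V_mem (M : MDP S A H) (π : Policy S A H) (n : ℕ) :
    ∀ (h : ℕ) (_ : H - h = n) (x : S), 0 ≤ M.V π h x ∧ M.V π h x ≤ ((H - h : ℕ) : ℝ) := by
  induction n with
  | zero =>
    intro h hn x
    rw [V_of_le M π (by omega)]
    simp
  | succ n ih =>
    intro h hn x
    have hh : h < H := by omega
    have e := V_fin M π ⟨h, hh⟩ x
    simp only at e
    rw [e]
    obtain ⟨r0, r1⟩ := M.r_mem ⟨h, hh⟩ x (π ⟨h, hh⟩ x)
    have h0 := expect_nonneg (M.P ⟨h, hh⟩ x (π ⟨h, hh⟩ x))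
      (fun y => (ih (h + 1) (by omega) y).1)
    have h1 := expect_le_const (M.P ⟨h, hh⟩ x (π ⟨h, hh⟩ x))
      (fun y => (ih (h + 1) (by omega) y).2)
    have e2 : ((H - h : ℕ) : ℝ) = ((H - (h + 1) : ℕ) : ℝ) + 1 := by
      rw [← Nat.cast_succ]; congr 1; omega
    constructor <;> linarith

variable [Finite A]

theorem V_le_Vstar (M : MDP S A H) (π : Policy S A H) (h : ℕ) (x : S) :
    M.V π h x ≤ M.Vstar h x :=
  le_ciSup (Set.finite_range fun π : Policy S A H => M.V π h x).bddAbove π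

variable [Nonempty A]

theorem Vstar_nonneg (M : MDP S A H) (h : ℕ) (x : S) : 0 ≤ M.Vstar h x :=
  (M.V_mem (fun _ _ => Classical.arbitrary A) _ h rfl x).1.trans (M.V_le_Vstar _ h x)

theorem Vstar_le (M : MDP S A H) (h : ℕ) (x : S) : M.Vstar h x ≤ ((H - h : ℕ) : ℝ) :=
  ciSup_le fun π => (M.V_mem π _ h rfl x).2

theorem Vstar_of_le (M : MDP S A H) {h : ℕ} (hh : H ≤ h) (x : S) : M.Vstar h x = 0 :=
  le_antisymm ((M.Vstar_le h x).trans (by simp [Nat.sub_eq_zero_of_le hh])) (M.Vstar_nonneg h x)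

/-- Lets a policy be altered at one step while all later values are kept, as the backward
construction of an optimal policy requires. -/
theorem V_congr (M : MDP S A H) {π π' : Policy S A H} (n : ℕ) :
    ∀ (h : ℕ) (_ : H - h = n) (_ : ∀ i : Fin H, h ≤ i → π i = π' i) (x : S),
      M.V π h x = M.V π' h x := by
  induction n with
  | zero =>
    intro h hn _ x
    rw [V_of_le M π (by omega), V_of_le M π' (by omega)]
  | succ n ih =>
    intro h hn hp x
    have hh : h < H := by omega
    have e := V_fin M π ⟨h, hh⟩ x
    have e' := V_fin M π' ⟨h, hh⟩ x
    simp only at e e'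
    rw [e, e', hp ⟨h, hh⟩ le_rfl]
    congr 2
    funext y
    exact ih (h + 1) (by omega) (fun i hi => hp i (by omega)) y

/-- Backward induction: a greedy choice at step `h` is put in front of a policy that is optimal from
step `h + 1` on. One policy attains the supremum at all states at once, which gives the Bellman
equations. -/
theorem exists_optimal (M : MDP S A H) (n : ℕ) :
    ∀ (h : ℕ) (_ : H - h = n), ∃ π : Policy S A H, ∀ x, M.V π h x = M.Vstar h x := by
  induction n with
  | zero =>
    intro h hn
    refine ⟨fun _ _ => Classical.arbitrary A, fun x => ?_⟩
    rw [V_of_le M _ (by omega), Vstar_of_le M (by omega)]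
  | succ n ih =>
    intro h hn
    have hh : h < H := by omega
    obtain ⟨π, hπ⟩ := ih (h + 1) (by omega)
    choose g hg using fun x => Finite.exists_max fun a => M.Qstar ⟨h, hh⟩ x a
    refine ⟨Function.update π ⟨h, hh⟩ g, fun x => le_antisymm (M.V_le_Vstar _ h x) ?_⟩
    refine ciSup_le fun π' => ?_
    have e := V_fin M (Function.update π ⟨h, hh⟩ g) ⟨h, hh⟩ x
    have e' := V_fin M π' ⟨h, hh⟩ x
    simp only [Function.update_self] at e e'
    have e3 : ∀ y, M.V (Function.update π ⟨h, hh⟩ g) (h + 1) y = M.Vstar (h + 1) y := fun y => by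
      rw [← hπ y]
      refine M.V_congr _ (h + 1) rfl (fun i hi => ?_) y
      rw [Function.update_of_ne]
      rintro rfl
      simp at hi
    rw [e, e', funext e3]
    refine le_trans ?_ (hg x (π' ⟨h, hh⟩ x))
    exact add_le_add_right (expect_mono _ fun y => M.V_le_Vstar π' (h + 1) y) _

theorem Qstar_le_Vstar (M : MDP S A H) (h : Fin H) (x : S) (a : A) :
    M.Qstar h x a ≤ M.Vstar h x := by
  classical
  obtain ⟨π, hπ⟩ := M.exists_optimal _ (h + 1) rfl
  refine le_trans (le_of_eq ?_) (M.V_le_Vstar (Function.update π h fun _ => a) h x)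
  rw [V_fin, Function.update_self, Qstar]
  congr 2
  funext y
  rw [← hπ y]
  refine M.V_congr _ (h + 1) rfl (fun i hi => ?_) y
  rw [Function.update_of_ne]
  rintro rfl
  simp at hi

theorem gap_nonneg (M : MDP S A H) (h : Fin H) (x : S) (a : A) : 0 ≤ M.gap h x a :=
  sub_nonneg.2 (M.Qstar_le_Vstar h x a)

theorem exists_gap_eq_zero (M : MDP S A H) (h : Fin H) (x : S) : ∃ a, M.gap h x a = 0 := by
  obtain ⟨π, hπ⟩ := M.exists_optimal _ h rfl
  refine ⟨π h x, le_antisymm ?_ (M.gap_nonneg _ _ _)⟩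
  rw [gap, ← hπ x, V_fin, Qstar]
  have := expect_mono (M.P h x (π h x)) fun y => M.V_le_Vstar π (h + 1) y
  linarith

theorem Qstar_nonneg (M : MDP S A H) (h : Fin H) (x : S) (a : A) : 0 ≤ M.Qstar h x a :=
  add_nonneg (M.r_mem h x a).1 (expect_nonneg _ fun y => M.Vstar_nonneg _ y)

theorem Vstar_le_horizon (M : MDP S A H) (h : ℕ) (x : S) : M.Vstar h x ≤ H :=
  (M.Vstar_le h x).trans (by exact_mod_cast Nat.sub_le H h)

theorem Qstar_le_horizon (M : MDP S A H) (h : Fin H) (x : S) (a : A) : M.Qstar h x a ≤ H :=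
  (M.Qstar_le_Vstar h x a).trans (M.Vstar_le_horizon h x)

theorem gap_le_horizon (M : MDP S A H) (h : Fin H) (x : S) (a : A) : M.gap h x a ≤ H := by
  have := M.Qstar_nonneg h x a
  have := M.Vstar_le_horizon h x
  rw [gap]; linarith

end MDP
end
end QLP

namespace QLP
noncomputable section

/-! ### Learning rates -/

section Rates

/-- The weighted average `∑_{i=1}^n α_n^i f_i`. -/
def wsum (H n : ℕ) (f : ℕ → ℝ) : ℝ := ∑ i ∈ Finset.Icc 1 n, alphaW H n i * f i

variable {H : ℕ}

theorem alpha_one : alpha H 1 = 1 := by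
  rw [alpha, Nat.cast_one, div_self]
  positivity

theorem one_sub_alpha_succ (n : ℕ) : 1 - alpha H (n + 1) = n / ((H : ℝ) + n + 1) := by
  have : (H : ℝ) + n + 1 ≠ 0 := by positivity
  rw [alpha]; push_cast
  field_simp
  ring

theorem one_sub_alpha_nonneg {n : ℕ} (hn : 1 ≤ n) : 0 ≤ 1 - alpha H n := by
  obtain ⟨m, rfl⟩ : ∃ m, n = m + 1 := ⟨n - 1, by omega⟩
  rw [one_sub_alpha_succ]; positivity

theorem alpha_nonneg (n : ℕ) : 0 ≤ alpha H n := by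
  rw [alpha]; positivity

theorem alphaW_self (n : ℕ) : alphaW H n n = alpha H n := by
  simp [alphaW]

theorem alphaW_succ {n i : ℕ} (hi : i ≤ n) :
    alphaW H (n + 1) i = (1 - alpha H (n + 1)) * alphaW H n i := by
  rw [alphaW, alphaW, Finset.prod_Icc_succ_top (by omega)]
  ring

theorem alphaW_nonneg {n i : ℕ} (hi : 1 ≤ i) : 0 ≤ alphaW H n i :=
  mul_nonneg (alpha_nonneg i) (Finset.prod_nonneg fun j hj =>
    one_sub_alpha_nonneg (by have := (Finset.mem_Icc.1 hj).1; omega))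

@[simp] theorem wsum_zero (f : ℕ → ℝ) : wsum H 0 f = 0 := by simp [wsum]

theorem wsum_succ (n : ℕ) (f : ℕ → ℝ) :
    wsum H (n + 1) f = (1 - alpha H (n + 1)) * wsum H n f + alpha H (n + 1) * f (n + 1) := by
  rw [wsum, Finset.sum_Icc_succ_top (by omega), alphaW_self, wsum, Finset.mul_sum]
  congr 1
  refine Finset.sum_congr rfl fun i hi => ?_
  rw [alphaW_succ (Finset.mem_Icc.1 hi).2, mul_assoc]

theorem wsum_add (n : ℕ) (f g : ℕ → ℝ) :
    wsum H n (fun i => f i + g i) = wsum H n f + wsum H n g := by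
  simp [wsum, mul_add, Finset.sum_add_distrib]

theorem wsum_sub (n : ℕ) (f g : ℕ → ℝ) :
    wsum H n (fun i => f i - g i) = wsum H n f - wsum H n g := by
  simp [wsum, mul_sub, Finset.sum_sub_distrib]

theorem wsum_const_mul (n : ℕ) (c : ℝ) (f : ℕ → ℝ) :
    wsum H n (fun i => c * f i) = c * wsum H n f := by
  simp only [wsum, Finset.mul_sum]
  exact Finset.sum_congr rfl fun z _ => by ring

theorem wsum_mono {n : ℕ} {f g : ℕ → ℝ} (h : ∀ i, 1 ≤ i → i ≤ n → f i ≤ g i) :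
    wsum H n f ≤ wsum H n g :=
  Finset.sum_le_sum fun i hi => mul_le_mul_of_nonneg_left
    (h i (Finset.mem_Icc.1 hi).1 (Finset.mem_Icc.1 hi).2) (alphaW_nonneg (Finset.mem_Icc.1 hi).1)

theorem wsum_congr {n : ℕ} {f g : ℕ → ℝ} (h : ∀ i, 1 ≤ i → i ≤ n → f i = g i) :
    wsum H n f = wsum H n g :=
  Finset.sum_congr rfl fun i hi => by
    rw [h i (Finset.mem_Icc.1 hi).1 (Finset.mem_Icc.1 hi).2]

theorem wsum_nonneg {n : ℕ} {f : ℕ → ℝ} (h : ∀ i, 1 ≤ i → i ≤ n → 0 ≤ f i) :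
    0 ≤ wsum H n f :=
  Finset.sum_nonneg fun i hi => mul_nonneg (alphaW_nonneg (Finset.mem_Icc.1 hi).1)
    (h i (Finset.mem_Icc.1 hi).1 (Finset.mem_Icc.1 hi).2)

theorem wsum_const {n : ℕ} (hn : 1 ≤ n) (c : ℝ) : wsum H n (fun _ => c) = c := by
  induction n, hn using Nat.le_induction with
  | base => rw [wsum_succ, wsum_zero]; simp [alpha_one]
  | succ n hn ih => rw [wsum_succ, ih]; ring

theorem le_wsum {n : ℕ} (hn : 1 ≤ n) {f : ℕ → ℝ} (h : ∀ i, 1 ≤ i → i ≤ n → f n ≤ f i) :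
    f n ≤ wsum H n f :=
  (wsum_const hn (f n)).symm.trans_le (wsum_mono h)

/-- The constant 2 reproduces itself in the induction because 2√n√(n+1) ≤ 2n+1. It makes the
aggregated bonus β_n comparable with b_n. -/
theorem wsum_inv_sqrt_le {n : ℕ} (hn : 1 ≤ n) : wsum H n (fun i => 1 / √(i : ℝ)) ≤ 2 / √(n : ℝ) := by
  induction n, hn using Nat.le_induction with
  | base => rw [wsum_succ, wsum_zero]; simp [alpha_one]
  | succ n hn ih =>
    rw [wsum_succ]
    have hn0 : (0 : ℝ) < n := by exact_mod_cast hn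
    have hden : (0 : ℝ) < (H : ℝ) + n + 1 := by positivity
    set s := √(n : ℝ) with hs
    set t := √((n + 1 : ℕ) : ℝ) with ht
    have s0 : 0 < s := Real.sqrt_pos.2 hn0
    have t0 : 0 < t := Real.sqrt_pos.2 (by positivity)
    have ss : s * s = n := Real.mul_self_sqrt hn0.le
    have tt : t * t = n + 1 := by
      rw [ht, Real.mul_self_sqrt (by positivity)]; push_cast; ring
    have h1 : (1 - alpha H (n + 1)) * wsum H n (fun i => 1 / √(i : ℝ)) ≤
        (1 - alpha H (n + 1)) * (2 / s) :=
      mul_le_mul_of_nonneg_left ih (one_sub_alpha_nonneg (by omega))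
    refine (add_le_add_left h1 _).trans ?_
    rw [one_sub_alpha_succ, alpha]
    push_cast
    rw [← add_assoc, ← ss]
    have hden' : (0 : ℝ) < (H : ℝ) + s * s + 1 := by positivity
    rw [div_mul_div_comm, div_mul_div_comm, mul_one, div_add_div _ _ (by positivity) (by positivity),
      div_le_div_iff₀ (by positivity) t0]
    have key : 2 * s * t + (H + 1) ≤ 2 * (H + s * s + 1) := by
      have hH : (0 : ℝ) ≤ H := by positivity
      nlinarith [sq_nonneg (s - t)]
    have := mul_le_mul_of_nonneg_left key (show 0 ≤ (H + s * s + 1) * (s * t) by positivity)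
    nlinarith [this]

variable (hH : 0 < H)
include hH

theorem alphaW_le {n i : ℕ} (hi : 1 ≤ i) (hin : i ≤ n) : alphaW H n i ≤ 2 * H / n := by
  have h1 : (1 : ℝ) ≤ H := by exact_mod_cast hH
  induction n, hin using Nat.le_induction with
  | base =>
    have hi' : (0 : ℝ) < i := by exact_mod_cast hi
    rw [alphaW_self, alpha, div_le_div_iff₀ (by positivity) hi']
    nlinarith
  | succ n hn ih =>
    rw [alphaW_succ hn]
    have hn0 : (0 : ℝ) < n := by exact_mod_cast (hi.trans hn)
    refine (mul_le_mul_of_nonneg_left ih (one_sub_alpha_nonneg (by omega))).trans ?_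
    rw [one_sub_alpha_succ, div_mul_div_comm, mul_comm (n : ℝ), mul_div_mul_right _ _ hn0.ne']
    push_cast
    gcongr
    linarith

/-- The weights sum to one and each is at most 2H/n. This sum is the variance proxy of the
concentration bound. -/
theorem sum_alphaW_sq_le {n : ℕ} (hn : 1 ≤ n) :
    ∑ i ∈ Finset.Icc 1 n, alphaW H n i ^ 2 ≤ 2 * H / n := by
  have := wsum_mono (H := H) (n := n) (f := fun i => alphaW H n i) (g := fun _ => 2 * (H : ℝ) / n)
    fun i h1 h2 => alphaW_le hH h1 h2
  rw [wsum_const hn] at this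
  simpa [wsum, sq] using this

/-- The total influence of one sample on all later averages. The factor 1 + 1/H is the point of this
learning rate: compounded over H steps it stays bounded. The partial sum has a closed form with
remainder (N/H)·α_N^i. -/
theorem sum_alphaW_tail_le {i : ℕ} (hi : 1 ≤ i) (N : ℕ) :
    ∑ n ∈ Finset.Icc i N, alphaW H n i ≤ 1 + 1 / (H : ℝ) := by
  have h1 : (0 : ℝ) < H := by exact_mod_cast hH
  by_cases hN : i ≤ N
  · have key : ∑ n ∈ Finset.Icc i N, alphaW H n i =
        (1 + 1 / (H : ℝ)) - N / H * alphaW H N i := by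
      induction N, hN using Nat.le_induction with
      | base =>
        simp only [Finset.Icc_self, Finset.sum_singleton, alphaW_self, alpha]
        field_simp
        ring
      | succ N hN ih =>
        rw [Finset.sum_Icc_succ_top (by omega), ih,
          alphaW_succ hN, one_sub_alpha_succ]
        push_cast
        field_simp
        ring
    rw [key]
    have := alphaW_nonneg (H := H) (n := N) hi
    have : 0 ≤ N / H * alphaW H N i := by positivity
    linarith
  · rw [Finset.Icc_eq_empty (by omega), Finset.sum_empty]; positivity

/-- Exchange of summation: each sample is charged its total later influence. Samples are numbered
from 0 and weights from 1, hence the shift `i - 1`. -/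
theorem sum_wsum_le {g : ℕ → ℝ} (hg : ∀ i, 0 ≤ g i) (C : ℕ) :
    ∑ n ∈ Finset.range C, wsum H n (fun i => g (i - 1)) ≤
      (1 + 1 / (H : ℝ)) * ∑ i ∈ Finset.range C, g i := by
  have e1 : ∀ n ∈ Finset.range C, wsum H n (fun i => g (i - 1)) =
      ∑ i ∈ Finset.Icc 1 C, if i ≤ n then alphaW H n i * g (i - 1) else 0 := fun n hn => by
    rw [wsum, ← Finset.sum_filter]
    refine Finset.sum_congr ?_ fun _ _ => rfl
    ext i
    have := Finset.mem_range.1 hn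
    simp only [Finset.mem_Icc, Finset.mem_filter]
    omega
  rw [Finset.sum_congr rfl e1, Finset.sum_comm, Finset.mul_sum,
    Finset.sum_bij (g := fun i => ∑ n ∈ Finset.range C,
      if i + 1 ≤ n then alphaW H n (i + 1) * g i else 0) (t := Finset.range C)
      (fun i _ => i - 1)]
  · refine Finset.sum_le_sum fun i _ => ?_
    rw [← Finset.sum_filter, ← Finset.sum_mul]
    refine mul_le_mul_of_nonneg_right (le_trans (le_of_eq ?_)
      (sum_alphaW_tail_le hH (i := i + 1) (by omega) (C - 1))) (hg i)
    refine Finset.sum_congr ?_ fun _ _ => rfl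
    ext n
    simp only [Finset.mem_Icc, Finset.mem_filter, Finset.mem_range]
    omega
  · intro i hi; have := Finset.mem_Icc.1 hi; simp only [Finset.mem_range]; omega
  · intro i hi j hj h; have := Finset.mem_Icc.1 hi; have := Finset.mem_Icc.1 hj; omega
  · intro i hi; exact ⟨i + 1, by have := Finset.mem_range.1 hi; simp; omega, by simp⟩
  · intro i hi
    have := Finset.mem_Icc.1 hi
    rw [Nat.sub_add_cancel this.1]

end Rates

/-! ### Sums of truncated bonuses -/

section Clip

/-- Terms vanish once √n ≥ c/g, so only about (c/g)² of them count, and 1/√n sums to at most twice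
the square root of their number. -/
theorem sum_clip_aux {c g : ℝ} (hc : 0 ≤ c) (hg : 0 < g) (N : ℕ) :
    ∑ n ∈ Finset.Icc 1 N, max (c / √(n : ℝ) - g) 0 ≤ 2 * c * min (√(N : ℝ)) (c / g) := by
  induction N with
  | zero => simp; positivity
  | succ N ih =>
    rw [Finset.sum_Icc_succ_top (by omega)]
    have t0 : 0 < √((N + 1 : ℕ) : ℝ) := Real.sqrt_pos.2 (by positivity)
    have st : √(N : ℝ) ≤ √((N + 1 : ℕ) : ℝ) := Real.sqrt_le_sqrt (by simp)
    by_cases h : c / √((N + 1 : ℕ) : ℝ) ≤ g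
    · rw [max_eq_right (by linarith), add_zero]
      refine ih.trans ?_
      gcongr
    · push Not at h
      rw [max_eq_left (by linarith)]
      have h2 : √((N + 1 : ℕ) : ℝ) ≤ c / g := by
        rw [lt_div_iff₀ t0] at h
        rw [le_div_iff₀ hg]; linarith
      rw [min_eq_left h2]
      rw [min_eq_left (st.trans h2)] at ih
      set s := √(N : ℝ) with hs
      set t := √((N + 1 : ℕ) : ℝ) with ht
      have ss : s * s = N := Real.mul_self_sqrt (by positivity)
      have tt : t * t = N + 1 := by
        rw [ht, Real.mul_self_sqrt (by positivity)]; push_cast; ring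
      have s0 : 0 ≤ s := Real.sqrt_nonneg _
      have : c / t ≤ 2 * c * (t - s) := by
        rw [div_le_iff₀ t0]
        have : 1 ≤ 2 * (t - s) * t := by nlinarith [sq_nonneg (t - s)]
        nlinarith
      linarith

theorem sum_clip_le {c g : ℝ} (hc : 0 ≤ c) (hg : 0 < g) (N : ℕ) :
    ∑ n ∈ Finset.Icc 1 N, max (c / √(n : ℝ) - g) 0 ≤ 2 * c ^ 2 / g := by
  refine (sum_clip_aux hc hg N).trans ?_
  refine (mul_le_mul_of_nonneg_left (min_le_right _ _) (by positivity)).trans (le_of_eq ?_)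
  ring

theorem sum_div_sqrt_le {c : ℝ} (hc : 0 ≤ c) (N : ℕ) :
    ∑ n ∈ Finset.Icc 1 N, c / √(n : ℝ) ≤ 2 * c * √(N : ℝ) := by
  induction N with
  | zero => simp
  | succ N ih =>
    rw [Finset.sum_Icc_succ_top (by omega)]
    have t0 : 0 < √((N + 1 : ℕ) : ℝ) := Real.sqrt_pos.2 (by positivity)
    set s := √(N : ℝ) with hs
    set t := √((N + 1 : ℕ) : ℝ) with ht
    have ss : s * s = N := Real.mul_self_sqrt (by positivity)
    have tt : t * t = N + 1 := by
      rw [ht, Real.mul_self_sqrt (by positivity)]; push_cast; ring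
    have s0 : 0 ≤ s := Real.sqrt_nonneg _
    have : c / t ≤ 2 * c * (t - s) := by
      rw [div_le_iff₀ t0]
      have : 1 ≤ 2 * (t - s) * t := by nlinarith [sq_nonneg (t - s)]
      nlinarith
    linarith

end Clip

/-! ### Sums over visits -/

section Visits

/-- Change of variables from episodes to visit numbers: `Nat.count` gives the number of earlier
visits, `Nat.nth` the episode of a visit. -/
theorem sum_visits (p : ℕ → Prop) [DecidablePred p] (F : ℕ → ℕ → ℝ) (K : ℕ) :
    (∑ k ∈ Finset.range K, if p k then F (Nat.count p k) k else 0) =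
      ∑ i ∈ Finset.range (Nat.count p K), F i (Nat.nth p i) := by
  induction K with
  | zero => simp
  | succ K ih =>
    rw [Finset.sum_range_succ, ih, Nat.count_succ]
    by_cases h : p K
    · simp only [h, if_true]
      rw [Finset.sum_range_succ, Nat.nth_count h]
    · simp [h]

variable {Z : Type*} [Fintype Z] [DecidableEq Z] (zz : ℕ → Z) (p : Z → ℕ → Prop)
  [∀ z, DecidablePred (p z)] (hp : ∀ z k, p z k ↔ z = zz k)
include hp

theorem sum_group (F : Z → ℕ → ℕ → ℝ) (K : ℕ) :
    ∑ k ∈ Finset.range K, F (zz k) (Nat.count (p (zz k)) k) k =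
      ∑ z, ∑ i ∈ Finset.range (Nat.count (p z) K), F z i (Nat.nth (p z) i) := by
  simp_rw [← sum_visits]
  rw [Finset.sum_comm]
  refine Finset.sum_congr rfl fun k _ => ?_
  rw [Finset.sum_eq_single (zz k)]
  · rw [if_pos ((hp _ _).2 rfl)]
  · intro z _ hz
    rw [if_neg fun h => hz ((hp _ _).1 h)]
  · simp

theorem sum_wsum_visits_le {H : ℕ} (hH : 0 < H) {u : ℕ → ℝ} (hu : ∀ k, 0 ≤ u k) (K : ℕ) :
    ∑ k ∈ Finset.range K, wsum H (Nat.count (p (zz k)) k)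
        (fun i => u (Nat.nth (p (zz k)) (i - 1))) ≤
      (1 + 1 / (H : ℝ)) * ∑ k ∈ Finset.range K, u k := by
  rw [sum_group zz p hp (fun z n _ => wsum H n (fun i => u (Nat.nth (p z) (i - 1)))),
    sum_group zz p hp (fun _ _ k => u k), Finset.mul_sum]
  exact Finset.sum_le_sum fun z _ => sum_wsum_le hH (fun i => hu (Nat.nth (p z) i)) _

theorem sum_count (K : ℕ) : ∑ z, Nat.count (p z) K = K := by
  have := sum_group zz p hp (fun _ _ _ => 1) K
  simp only [Finset.sum_const, Finset.card_range, nsmul_eq_mul, mul_one] at this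
  exact_mod_cast this.symm

end Visits
end
end QLP

namespace QLP
noncomputable section

/-! ### Rollouts -/

section Rollout

variable {S A : Type*} {H : ℕ} [Fintype S]

/-- The extension of a finite sequence of states by its last entry. -/
def extend {n : ℕ} (t : Fin (n + 1) → S) (j : ℕ) : S := t ⟨min j n, by omega⟩

theorem extend_snoc_of_le {n : ℕ} (t : Fin (n + 1) → S) (y : S) {j : ℕ} (hj : j ≤ n) :
    extend (Fin.snoc t y : Fin (n + 1 + 1) → S) j = extend t j := by
  have e : (⟨min j (n + 1), by omega⟩ : Fin (n + 1 + 1)) =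
      Fin.castSucc (⟨min j n, by omega⟩ : Fin (n + 1)) := by
    ext; simp; omega
  rw [extend, e, extend]
  exact Fin.snoc_castSucc (α := fun _ => S) y t _

theorem extend_last {n : ℕ} (t : Fin (n + 1) → S) : extend t n = t (Fin.last n) := by
  rw [extend]; congr 1; ext; simp

/-- Induction on the length of the rollout: steps after `i` integrate out because nothing in the
integrand depends on them, and at step `i` the last factor is centred. Functions of infinite
sequences avoid changing the type of the path with its length. -/
theorem rollout_martingale_aux [DecidableEq S] (M : MDP S A H) (π : Policy S A H) (x : S)
    (i : Fin H) (G : (ℕ → S) → ℝ)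
    (hG : ∀ s s' : ℕ → S, (∀ j ≤ (i : ℕ), s j = s' j) → G s = G s') (f : S → ℝ) (n : ℕ)
    (hn : n ≤ H) (hi : (i : ℕ) < n) :
    expect (rollout M π x n hn) (fun t => G (extend t) *
      (f (extend t (i + 1)) - expect (M.P i (extend t i) (π i (extend t i))) f)) = 0 := by
  induction n with
  | zero => omega
  | succ n ih =>
    rw [rollout, expect_bind]
    simp only [expect_map]
    by_cases h : (i : ℕ) < n
    · rw [← ih (Nat.le_of_succ_le hn) h]
      congr 1
      funext t
      rw [← expect_const (M.P ⟨n, hn⟩ (t (Fin.last n)) (π ⟨n, hn⟩ (t (Fin.last n))))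
        (G (extend t) *
          (f (extend t (i + 1)) - expect (M.P i (extend t i) (π i (extend t i))) f))]
      congr 1
      funext y
      rw [extend_snoc_of_le t y (by omega), extend_snoc_of_le t y (by omega),
        hG _ (extend t) fun j hj => extend_snoc_of_le t y (by omega)]
    · have hin : (i : ℕ) = n := by omega
      obtain rfl : i = ⟨n, hn⟩ := Fin.ext hin
      rw [← expect_const (rollout M π x n (Nat.le_of_succ_le hn)) 0]
      congr 1
      funext t
      have e : ∀ y, G (extend (Fin.snoc t y : Fin (n + 1 + 1) → S)) = G (extend t) := fun y =>
        hG _ _ fun j hj => extend_snoc_of_le t y hj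
      simp only [e, extend_snoc_of_le t _ le_rfl, extend_last, Fin.snoc_last]
      rw [expect_const_mul, expect_sub, expect_const, sub_self, mul_zero]

theorem rollout_martingale [DecidableEq S] (M : MDP S A H) (π : Policy S A H) (x : S)
    (i : Fin H) (F : (Fin (H + 1) → S) → ℝ)
    (hF : ∀ t t' : Fin (H + 1) → S, (∀ j ≤ i.castSucc, t j = t' j) → F t = F t') (f : S → ℝ) :
    expect (rollout M π x H le_rfl) (fun t => F t *
      (f (t i.succ) - expect (M.P i (t i.castSucc) (π i (t i.castSucc))) f)) = 0 := by
  rw [← rollout_martingale_aux M π x i (fun s => F fun j => s j)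
    (fun s s' h => hF _ _ fun j hj => h j hj) f H le_rfl i.isLt]
  congr 1
  funext t
  have e : ∀ j : Fin (H + 1), extend t j = t j := fun j => by
    rw [extend]; congr 1; ext; simp; omega
  have e1 := e i.succ
  have e2 := e i.castSucc
  simp only [Fin.val_succ, Fin.val_castSucc] at e1 e2
  rw [e1, e2, funext e]

end Rollout

/-! ### Bootstrapped returns -/

section Segments

variable {S A : Type*} {H : ℕ}

theorem bootStep_gt [DecidableEq S] (G : Fin H → Finset S) (x : Fin (H + 1) → S) (h : Fin H) :
    (h : ℕ) < bootStep G x h := by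
  rw [bootStep]
  split_ifs with hs
  · exact_mod_cast (Finset.mem_filter.1 (Finset.min'_mem _ hs)).2.1
  · exact h.isLt

theorem bootStep_le [DecidableEq S] (G : Fin H → Finset S) (x : Fin (H + 1) → S) (h : Fin H) :
    bootStep G x h ≤ H := by
  rw [bootStep]
  split_ifs with hs
  · exact Fin.is_le'
  · exact le_rfl

theorem mem_of_lt_bootStep [DecidableEq S] {G : Fin H → Finset S} {x : Fin (H + 1) → S}
    {h i : Fin H} (h1 : h < i) (h2 : (i : ℕ) < bootStep G x h) : x i.castSucc ∈ G i := by
  by_contra hx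
  rw [bootStep] at h2
  have hm : i ∈ Finset.univ.filter fun j : Fin H => h < j ∧ x j.castSucc ∉ G j := by
    simp [h1, hx]
  rw [dif_pos ⟨i, hm⟩] at h2
  have := Finset.min'_le _ i hm
  exact absurd h2 (not_lt.2 this)

theorem notMem_bootStep [DecidableEq S] {G : Fin H → Finset S} {x : Fin (H + 1) → S}
    {h : Fin H} (hb : bootStep G x h < H) :
    x (Fin.castSucc ⟨bootStep G x h, hb⟩) ∉ G ⟨bootStep G x h, hb⟩ := by
  have key : ∀ j : Fin H, (j : ℕ) = bootStep G x h → x j.castSucc ∉ G j := by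
    intro j hj
    rw [bootStep] at hj
    split_ifs at hj with hs
    · have := (Finset.mem_filter.1 (Finset.min'_mem _ hs)).2.2
      rwa [← Fin.ext hj] at this
    · exact absurd hj j.isLt.ne
  exact key _ rfl

/-- Shows that the event that bootstrapping has not yet occurred at step `i` is decided by the
states up to `i`. The bootstrap step thus acts as a stopping time. -/
theorem lt_bootStep_iff [DecidableEq S] (G : Fin H → Finset S) (x : Fin (H + 1) → S)
    (h i : Fin H) : (i : ℕ) < bootStep G x h ↔ ∀ j : Fin H, h < j → j ≤ i → x j.castSucc ∈ G j := by
  constructor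
  · intro hi j h1 h2
    exact mem_of_lt_bootStep h1 (lt_of_le_of_lt h2 hi)
  · intro hall
    by_contra hi
    push Not at hi
    have hb : bootStep G x h < H := lt_of_le_of_lt hi i.isLt
    exact notMem_bootStep hb (hall ⟨_, hb⟩ (bootStep_gt G x h) hi)

theorem sum_segment_succ (h : Fin H) {j : ℕ} (hj : j < H) (hhj : (h : ℕ) ≤ j) (f : Fin H → ℝ) :
    ∑ i ∈ Finset.univ.filter (fun i : Fin H => h ≤ i ∧ (i : ℕ) < j + 1), f i =
      (∑ i ∈ Finset.univ.filter (fun i : Fin H => h ≤ i ∧ (i : ℕ) < j), f i) + f ⟨j, hj⟩ := by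
  have : Finset.univ.filter (fun i : Fin H => h ≤ i ∧ (i : ℕ) < j + 1) =
      insert ⟨j, hj⟩ (Finset.univ.filter fun i : Fin H => h ≤ i ∧ (i : ℕ) < j) := by
    ext i
    simp only [Finset.mem_filter, Finset.mem_univ, true_and, Finset.mem_insert, Fin.ext_iff,
      Fin.le_def]
    omega
  rw [this, Finset.sum_insert (by simp), add_comm]

theorem sum_segment_self (h : Fin H) (f : Fin H → ℝ) :
    ∑ i ∈ Finset.univ.filter (fun i : Fin H => h ≤ i ∧ (i : ℕ) < (h : ℕ)), f i = 0 := by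
  rw [Finset.filter_false_of_mem, Finset.sum_empty]
  intro i _ hi
  exact absurd hi.2 (not_lt.2 hi.1)

theorem segReward_nonneg {rew : Fin H → ℝ} (hr : ∀ i, 0 ≤ rew i) (h : Fin H) (j : ℕ) :
    0 ≤ segReward rew h j := Finset.sum_nonneg fun i _ => hr i

theorem segReward_le {rew : Fin H → ℝ} (hr : ∀ i, rew i ≤ 1) (h : Fin H) {j : ℕ}
    (hj : (h : ℕ) ≤ j) (hjH : j ≤ H) : segReward rew h j ≤ j - h := by
  induction j, hj using Nat.le_induction with
  | base => rw [segReward, sum_segment_self]; simp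
  | succ j hj ih =>
    rw [segReward, sum_segment_succ h (by omega) hj]
    have := ih (by omega)
    have := hr ⟨j, by omega⟩
    rw [segReward] at *
    push_cast
    linarith

variable [Fintype S] [Finite A] [Nonempty A]

/-- The martingale difference of the optimal value function at step `i` of an episode. -/
def tdError (M : MDP S A H) (π : Policy S A H) (x : Fin (H + 1) → S) (i : Fin H) : ℝ :=
  M.Vstar (i + 1) (x i.succ) -
    expect (M.P i (x i.castSucc) (π i (x i.castSucc))) (M.Vstar (i + 1))

theorem Qstar_add_tdError (M : MDP S A H) (π : Policy S A H) (x : Fin (H + 1) → S) (i : Fin H) :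
    M.r i (x i.castSucc) (π i (x i.castSucc)) + M.Vstar (i + 1) (x i.succ) =
      M.Qstar i (x i.castSucc) (π i (x i.castSucc)) + tdError M π x i := by
  rw [tdError, MDP.Qstar]; ring

theorem valueAt_Vstar (M : MDP S A H) (x : Fin (H + 1) → S) {j : ℕ} (hj : j < H + 1) :
    valueAt (fun h => M.Vstar h) x j = M.Vstar j (x ⟨j, hj⟩) := by
  rw [valueAt]
  split_ifs with h
  · rfl
  · rw [M.Vstar_of_le (by omega)]

/-- Each further step adds one martingale difference and the negative of the gap of its action. The
gaps strictly between `h` and `j` vanish, so the multi-step return is an unbiased sample of Q* at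
step `h`. -/
theorem segReward_add_value (M : MDP S A H) (π : Policy S A H) (x : Fin (H + 1) → S) (h : Fin H)
    {j : ℕ} (hj : (h : ℕ) + 1 ≤ j) (hjH : j ≤ H)
    (hopt : ∀ i : Fin H, h < i → (i : ℕ) < j → M.gap i (x i.castSucc) (π i (x i.castSucc)) = 0) :
    segReward (fun i => M.r i (x i.castSucc) (π i (x i.castSucc))) h j +
      valueAt (fun h => M.Vstar h) x j =
      M.Qstar h (x h.castSucc) (π h (x h.castSucc)) +
        ∑ i ∈ Finset.univ.filter (fun i : Fin H => h ≤ i ∧ (i : ℕ) < j), tdError M π x i := by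
  rw [valueAt_Vstar M x (Nat.lt_succ_of_le hjH)]
  induction j, hj using Nat.le_induction with
  | base =>
    rw [segReward, sum_segment_succ h h.isLt le_rfl, sum_segment_succ h h.isLt le_rfl,
      sum_segment_self, sum_segment_self, zero_add, zero_add]
    exact Qstar_add_tdError M π x h
  | succ j hj ih =>
    have hjH' : j < H := by omega
    have h1 := ih hjH'.le fun i h1 h2 => hopt i h1 (by omega)
    have h2 := hopt ⟨j, hjH'⟩ (by rw [Fin.lt_def]; exact hj) (Nat.lt_succ_self j)
    have h3 := Qstar_add_tdError M π x ⟨j, hjH'⟩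
    rw [segReward, sum_segment_succ h hjH' (by omega), sum_segment_succ h hjH' (by omega)]
    rw [segReward] at h1
    rw [MDP.gap] at h2
    simp only [Fin.castSucc_mk, Fin.succ_mk] at h1 h2 h3 ⊢
    linarith

end Segments

/-! ### Histories as infinite sequences of episodes -/

section Path

variable {S A : Type*} {H : ℕ} [Fintype S] [DecidableEq S] [Fintype A] [DecidableEq A]

/-- The learner's state at the beginning of episode `k`, when the episodes are given by `w`. -/
def run (M : MDP S A H) (I : Input S A H) (w : ℕ → Fin (H + 1) → S) : ℕ → State S A H
  | 0 => initState I
  | k + 1 =>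
    let st := run M I w k
    let a : Fin H → A := fun h => choosePolicy I st h (w k h.castSucc)
    update I st (w k) a (fun h => M.r h (w k h.castSucc) (a h))

/-- The policy of episode `k`. -/
def pol (M : MDP S A H) (I : Input S A H) (w : ℕ → Fin (H + 1) → S) (k : ℕ) : Policy S A H :=
  choosePolicy I (run M I w k)

/-- The action of step `h` of episode `k`. -/
def actAt (M : MDP S A H) (I : Input S A H) (w : ℕ → Fin (H + 1) → S) (k : ℕ) (h : Fin H) : A :=
  pol M I w k h (w k h.castSucc)

theorem run_congr (M : MDP S A H) (I : Input S A H) {w w' : ℕ → Fin (H + 1) → S} {k : ℕ}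
    (h : ∀ j < k, w j = w' j) : run M I w k = run M I w' k := by
  induction k with
  | zero => rfl
  | succ k ih => rw [run, run, ih fun j hj => h j (by omega), h k (by omega)]

theorem pol_congr (M : MDP S A H) (I : Input S A H) {w w' : ℕ → Fin (H + 1) → S} {k : ℕ}
    (h : ∀ j < k, w j = w' j) : pol M I w k = pol M I w' k := by
  rw [pol, pol, run_congr M I h]

theorem stateAfter_eq_run (M : MDP S A H) (I : Input S A H) (w : ℕ → Fin (H + 1) → S) (k : ℕ) :
    stateAfter M I k (fun j => w j) = run M I w k := by
  induction k with
  | zero => rfl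
  | succ k ih =>
    rw [stateAfter, run, ← ih]
    rfl

variable [Nonempty S]

/-- The extension of a history by arbitrary episodes. -/
def pad {k : ℕ} (w : History S H k) (j : ℕ) : Fin (H + 1) → S :=
  if h : j < k then w ⟨j, h⟩ else fun _ => Classical.arbitrary S

theorem policyAfter_eq (M : MDP S A H) (I : Input S A H) {k m : ℕ} (hk : k ≤ m)
    (w : History S H m) :
    policyAfter M I k (fun j => w (Fin.castLE hk j)) = pol M I (pad w) k := by
  have e : (fun j => w (Fin.castLE hk j) : History S H k) = fun j : Fin k => pad w j := by
    funext j
    rw [pad, dif_pos (by omega)]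
    rfl
  rw [policyAfter, pol, e, stateAfter_eq_run]

theorem pad_snoc {k : ℕ} (w : History S H k) (t : Fin (H + 1) → S) :
    pad (Fin.snoc w t : History S H (k + 1)) = Function.update (pad w) k t := by
  funext j
  rcases lt_trichotomy j k with h | rfl | h
  · rw [Function.update_of_ne h.ne, pad, pad, dif_pos (by omega), dif_pos h]
    exact Fin.snoc_castSucc (α := fun _ => Fin (H + 1) → S) t w ⟨j, h⟩
  · rw [Function.update_self, pad, dif_pos (by omega)]
    exact Fin.snoc_last (α := fun _ => Fin (H + 1) → S) t w
  · rw [Function.update_of_ne h.ne', pad, pad, dif_neg (by omega), dif_neg (by omega)]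

/-- The expectation of a function of the first `k` episodes. -/
def hexp (M : MDP S A H) (I : Input S A H) (adv : Adversary S H) (k : ℕ)
    (F : (ℕ → Fin (H + 1) → S) → ℝ) : ℝ :=
  expect (historyLaw M I adv k) fun w => F (pad w)

variable (M : MDP S A H) (I : Input S A H) (adv : Adversary S H)

theorem hexp_succ (k : ℕ) (F : (ℕ → Fin (H + 1) → S) → ℝ) :
    hexp M I adv (k + 1) F = expect (historyLaw M I adv k) fun w => expect (adv k w) fun x =>
      expect (rollout M (pol M I (pad w) k) x H le_rfl) fun t =>
        F (Function.update (pad w) k t) := by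
  rw [hexp, historyLaw, expect_bind]
  congr 1; funext w
  rw [expect_bind]
  congr 1; funext x
  rw [expect_map, ← policyAfter_eq M I le_rfl w]
  simp only [pad_snoc]
  rfl

theorem hexp_succ_eq {k : ℕ} {F G : (ℕ → Fin (H + 1) → S) → ℝ}
    (h : ∀ w x, expect (rollout M (pol M I w k) x H le_rfl)
      (fun t => F (Function.update w k t)) = G w) :
    hexp M I adv (k + 1) F = hexp M I adv k G := by
  rw [hexp_succ]
  simp only [h, expect_const]
  rfl

/-- Conditioning on the first `k` episodes. The hypothesis is uniform in the history and in the
initial state, so the adversary plays no further role. -/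
theorem hexp_succ_le {k : ℕ} {F G : (ℕ → Fin (H + 1) → S) → ℝ}
    (h : ∀ w x, expect (rollout M (pol M I w k) x H le_rfl)
      (fun t => F (Function.update w k t)) ≤ G w) :
    hexp M I adv (k + 1) F ≤ hexp M I adv k G := by
  rw [hexp_succ]
  exact expect_mono _ fun w => expect_le_const _ fun x => h _ _

theorem hexp_marginal {k m : ℕ} (hkm : k ≤ m) {F : (ℕ → Fin (H + 1) → S) → ℝ}
    (hF : ∀ w w', (∀ j < k, w j = w' j) → F w = F w') :
    hexp M I adv m F = hexp M I adv k F := by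
  induction m, hkm using Nat.le_induction with
  | base => rfl
  | succ m hm ih =>
    rw [← ih]
    refine hexp_succ_eq M I adv fun w x => ?_
    rw [← expect_const (rollout M (pol M I w m) x H le_rfl) (F w)]
    congr 1; funext t
    exact hF _ _ fun j hj => Function.update_of_ne (by omega) _ _

theorem hexp_zero (F : (ℕ → Fin (H + 1) → S) → ℝ) :
    hexp M I adv 0 F = F (fun _ _ => Classical.arbitrary S) := by
  rw [hexp, historyLaw, expect_pure]
  congr 1

variable [Nonempty A]

/-- The sum of the gaps of the actions taken in episode `k`. -/
def episodeGap (w : ℕ → Fin (H + 1) → S) (k : ℕ) : ℝ :=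
  ∑ h : Fin H, M.gap h (w k h.castSucc) (actAt M I w k h)

/-- Performance difference: along a trajectory V* - V^π telescopes into the gaps minus martingale
differences, which have mean zero. -/
theorem expect_rollout_gap (π : Policy S A H) (x : S) :
    expect (rollout M π x H le_rfl) (fun t => M.Vstar 0 (t 0) - M.V π 0 (t 0)) =
      expect (rollout M π x H le_rfl)
        (fun t => ∑ h : Fin H, M.gap h (t h.castSucc) (π h (t h.castSucc))) := by
  have key : ∀ t : Fin (H + 1) → S, M.Vstar 0 (t 0) - M.V π 0 (t 0) =
      (∑ h : Fin H, M.gap h (t h.castSucc) (π h (t h.castSucc))) -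
      ∑ h : Fin H, 1 * ((M.Vstar (h + 1) (t h.succ) - M.V π (h + 1) (t h.succ)) -
        expect (M.P h (t h.castSucc) (π h (t h.castSucc)))
          (fun y => M.Vstar (h + 1) y - M.V π (h + 1) y)) := by
    intro t
    rw [← Finset.sum_sub_distrib]
    have e : ∀ h : Fin H, M.gap h (t h.castSucc) (π h (t h.castSucc)) -
        1 * ((M.Vstar (h + 1) (t h.succ) - M.V π (h + 1) (t h.succ)) -
        expect (M.P h (t h.castSucc) (π h (t h.castSucc)))
          (fun y => M.Vstar (h + 1) y - M.V π (h + 1) y)) =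
        (fun j : Fin (H + 1) => M.Vstar j (t j) - M.V π j (t j)) h.castSucc -
        (fun j : Fin (H + 1) => M.Vstar j (t j) - M.V π j (t j)) h.succ := by
      intro h
      have := M.V_fin π h (t h.castSucc)
      rw [expect_sub, MDP.gap, MDP.Qstar]
      simp only [Fin.val_castSucc, Fin.val_succ]
      linarith
    have tel : ∀ (n : ℕ) (g : Fin (n + 1) → ℝ),
        ∑ h : Fin n, (g h.castSucc - g h.succ) = g 0 - g (Fin.last n) := by
      intro n
      induction n with
      | zero => intro g; simp
      | succ n ih =>
        intro g
        rw [Fin.sum_univ_castSucc]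
        have := ih (fun j => g j.castSucc)
        simp only [Fin.castSucc_zero] at this
        simp only [← Fin.succ_castSucc, Fin.succ_last] at this ⊢
        linarith
    rw [Finset.sum_congr rfl fun h _ => e h,
      tel H (fun j : Fin (H + 1) => M.Vstar j (t j) - M.V π j (t j))]
    simp [M.Vstar_of_le le_rfl, M.V_of_le π le_rfl]
  simp only [key]
  rw [expect_sub, expect_sum (f := fun (h : Fin H) (t : Fin (H + 1) → S) =>
    1 * ((M.Vstar (h + 1) (t h.succ) - M.V π (h + 1) (t h.succ)) -
        expect (M.P h (t h.castSucc) (π h (t h.castSucc)))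
          (fun y => M.Vstar (h + 1) y - M.V π (h + 1) y))), Finset.sum_eq_zero, sub_zero]
  intro h _
  exact rollout_martingale M π x h (fun _ => 1) (fun _ _ _ => rfl)
    (fun y => M.Vstar (h + 1) y - M.V π (h + 1) y)

/-- The term of episode `k` depends on the first `k + 1` episodes only. After marginalization the
performance difference is applied to the last of them. -/
theorem regret_eq : regret M I adv =
    hexp M I adv I.K fun w => ∑ k ∈ Finset.range I.K, episodeGap M I w k := by
  have e1 : ∀ k : Fin I.K, expect (historyLaw M I adv I.K) (fun w => M.Vstar 0 (w k 0) -
      M.V (policyAfter M I k (fun j => w (Fin.castLE k.isLt.le j))) 0 (w k 0)) =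
      hexp M I adv I.K (fun w => episodeGap M I w k) := by
    intro k
    have e2 : expect (historyLaw M I adv I.K) (fun w => M.Vstar 0 (w k 0) -
        M.V (policyAfter M I k (fun j => w (Fin.castLE k.isLt.le j))) 0 (w k 0)) =
        hexp M I adv I.K (fun w => M.Vstar 0 (w k 0) - M.V (pol M I w k) 0 (w k 0)) := by
      rw [hexp]
      congr 1; funext w
      rw [policyAfter_eq M I k.isLt.le w]
      simp [pad]
    rw [e2, hexp_marginal M I adv (k := k + 1) k.isLt, hexp_marginal M I adv (k := k + 1) k.isLt
      (F := fun w => episodeGap M I w k)]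
    · rw [hexp_succ, hexp_succ]
      congr 1; funext w
      congr 1; funext x
      have e3 : ∀ t, pol M I (Function.update (pad w) k t) k = pol M I (pad w) k := fun t =>
        pol_congr M I fun j hj => Function.update_of_ne hj.ne _ _
      simp only [episodeGap, actAt, e3, Function.update_self]
      exact expect_rollout_gap M _ x
    · intro w w' h
      simp only [episodeGap, actAt]
      rw [pol_congr M I (w := w) (w' := w') fun j hj => h j (by omega), h k (by omega)]
    · intro w w' h
      rw [pol_congr M I (w := w) (w' := w') fun j hj => h j (by omega), h k (by omega)]
  rw [regret, Finset.sum_congr rfl fun k _ => e1 k,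
    Fin.sum_univ_eq_sum_range (fun k => hexp M I adv I.K fun w => episodeGap M I w k)]
  simp only [hexp]
  rw [← expect_sum]

end Path
end
end QLP

namespace QLP
noncomputable section

/-! ### Concentration of weighted sums over visits -/

/-- Hoeffding's lemma before taking expectations: convexity on [-B, B] together with cosh t ≤
exp(t²/2). The bound is affine in `x` with a coefficient independent of `x`, so a centred `x` drops
out under any conditional law. -/
theorem exp_mul_sub_le {s x B : ℝ} (hB : 0 < B) (hx : |x| ≤ B) :
    Real.exp (s * x - s ^ 2 * B ^ 2 / 2) ≤
      1 + Real.exp (-(s ^ 2 * B ^ 2 / 2)) * Real.sinh (s * B) / B * x := by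
  obtain ⟨h1, h2⟩ := abs_le.1 hx
  have hconv : Real.exp (s * x) ≤ Real.cosh (s * B) + Real.sinh (s * B) / B * x := by
    have l1 : -1 ≤ x / B := by rw [le_div_iff₀ hB]; linarith
    have l2 : x / B ≤ 1 := by rw [div_le_iff₀ hB]; linarith
    have l3 : 0 ≤ (1 + x / B) / 2 := by linarith
    have l4 : 0 ≤ (1 - x / B) / 2 := by linarith
    have h := convexOn_exp.2 (Set.mem_univ (s * B)) (Set.mem_univ (-(s * B))) l3 l4 (by ring)
    simp only [smul_eq_mul] at h
    have e : (1 + x / B) / 2 * (s * B) + (1 - x / B) / 2 * -(s * B) = s * x := by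
      field_simp; ring
    rw [e] at h
    refine h.trans (le_of_eq ?_)
    rw [Real.cosh_eq, Real.sinh_eq]
    ring
  have hcosh : Real.cosh (s * B) ≤ Real.exp (s ^ 2 * B ^ 2 / 2) := by
    have := Real.cosh_le_exp_half_sq (s * B)
    rwa [mul_pow] at this
  rw [sub_eq_add_neg, Real.exp_add]
  set E := Real.exp (-(s ^ 2 * B ^ 2 / 2)) with hE
  have hE0 : 0 < E := Real.exp_pos _
  have hEE : Real.exp (s ^ 2 * B ^ 2 / 2) * E = 1 := by
    rw [hE, ← Real.exp_add, add_neg_cancel, Real.exp_zero]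
  calc Real.exp (s * x) * E
      ≤ (Real.exp (s ^ 2 * B ^ 2 / 2) + Real.sinh (s * B) / B * x) * E :=
        mul_le_mul_of_nonneg_right (by linarith) hE0.le
    _ = 1 + E * Real.sinh (s * B) / B * x := by rw [add_mul, hEE]; ring

theorem count_congr {p q : ℕ → Prop} [DecidablePred p] [DecidablePred q] {k : ℕ}
    (h : ∀ j < k, (p j ↔ q j)) : Nat.count p k = Nat.count q k := by
  induction k with
  | zero => simp
  | succ k ih =>
    rw [Nat.count_succ, Nat.count_succ, ih fun j hj => h j (by omega)]
    congr 1
    exact if_congr (h k (by omega)) rfl rfl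

/-! ### The exponential supermartingale along the visits. -/

section Concentration

variable {S A : Type*} {H : ℕ} [Fintype S] [DecidableEq S] [Fintype A] [DecidableEq A] [Nonempty S]
variable (M : MDP S A H) (I : Input S A H) (adv : Adversary S H)
variable (p : (ℕ → Fin (H + 1) → S) → ℕ → Prop) [∀ w, DecidablePred (p w)]
  (ξ : (ℕ → Fin (H + 1) → S) → ℕ → ℝ) (c : ℕ → ℝ) (n : ℕ)

/-- The part of `∑_{i<n} c_i ξ_i`, with `ξ_i` taken at the `i`-th visit, collected in the
episodes before `k`. -/
def visitSum (w : ℕ → Fin (H + 1) → S) (k : ℕ) : ℝ :=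
  ∑ j ∈ Finset.range k, if p w j then
    (if Nat.count (p w) j < n then c (Nat.count (p w) j) * ξ w j else 0) else 0

theorem visitSum_eq {w : ℕ → Fin (H + 1) → S} {k : ℕ} (hn : n ≤ Nat.count (p w) k) :
    visitSum p ξ c n w k = ∑ i ∈ Finset.range n, c i * ξ w (Nat.nth (p w) i) := by
  rw [visitSum, sum_visits (p w) (fun i j => if i < n then c i * ξ w j else 0),
    ← Finset.sum_filter]
  refine Finset.sum_congr ?_ fun _ _ => rfl
  ext i
  simp only [Finset.mem_filter, Finset.mem_range]
  omega

/-- The exponential supermartingale of `visitSum`. -/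
def visitExp (B θ : ℝ) (k : ℕ) (w : ℕ → Fin (H + 1) → S) : ℝ :=
  Real.exp (θ * visitSum p ξ c n w k +
    θ ^ 2 * B ^ 2 / 2 * ∑ i ∈ Finset.Ico (Nat.count (p w) k) n, c i ^ 2)

variable {p ξ}
variable (hp : ∀ k w w', (∀ j ≤ k, w j = w' j) → (p w k ↔ p w' k))
  (hξ : ∀ k w w', (∀ j ≤ k, w j = w' j) → ξ w k = ξ w' k)
  {B : ℝ} (hB : 0 < B) (hξB : ∀ w k, |ξ w k| ≤ B)
  (hmart : ∀ w x k, expect (rollout M (pol M I w k) x H le_rfl)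
    (fun t => if p (Function.update w k t) k then ξ (Function.update w k t) k else 0) = 0)
include hp hξ hB hξB hmart

/-- The exponent carries the variance budget of the visits still to come. One visit spends exactly
the term that `exp_mul_sub_le` asks for, and the affine remainder averages to zero. Without a visit,
or after `n` visits, nothing changes. -/
theorem hexp_visitExp_succ_le (θ : ℝ) (k : ℕ) :
    hexp M I adv (k + 1) (visitExp p ξ c n B θ (k + 1)) ≤
      hexp M I adv k (visitExp p ξ c n B θ k) := by
  refine hexp_succ_le M I adv fun w x => ?_
  set N := Nat.count (p w) k with hN
  set s := θ * c N with hs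
  -- Depends only on the history before episode `k`, so it can be pulled out of the rollout
  -- expectation.
  set κ : ℝ := if N < n then
    Real.exp (-(s ^ 2 * B ^ 2 / 2)) * Real.sinh (s * B) / B else 0 with hκ
  have hcount : ∀ t, ∀ j ≤ k, Nat.count (p (Function.update w k t)) j = Nat.count (p w) j :=
    fun t j hj => count_congr fun i hi => hp i _ _ fun l hl =>
      Function.update_of_ne (by omega) _ _
  have hsum : ∀ t, visitSum p ξ c n (Function.update w k t) k = visitSum p ξ c n w k := by
    intro t
    refine Finset.sum_congr rfl fun j hj => ?_
    have hj' := Finset.mem_range.1 hj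
    have e : ∀ l ≤ j, Function.update w k t l = w l := fun l hl =>
      Function.update_of_ne (by omega) _ _
    rw [hcount t j hj'.le, hξ j _ _ e]
    exact if_congr (hp j _ _ e) rfl rfl
  have key : ∀ t, visitExp p ξ c n B θ (k + 1) (Function.update w k t) ≤
      visitExp p ξ c n B θ k w * (1 + κ * (if p (Function.update w k t) k then
        ξ (Function.update w k t) k else 0)) := by
    intro t
    rw [visitExp, visitSum, Finset.sum_range_succ, ← visitSum, hsum, Nat.count_succ,
      hcount t k le_rfl, ← hN]
    by_cases hpt : p (Function.update w k t) k
    · simp only [if_pos hpt]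
      by_cases hNn : N < n
      · have hsp : ∑ i ∈ Finset.Ico N n, c i ^ 2 =
            c N ^ 2 + ∑ i ∈ Finset.Ico (N + 1) n, c i ^ 2 :=
          Finset.sum_eq_sum_Ico_succ_bot hNn _
        rw [if_pos hNn, hκ, if_pos hNn]
        have h1 := exp_mul_sub_le (s := s) hB (hξB (Function.update w k t) k)
        refine le_trans (le_of_eq ?_) (mul_le_mul_of_nonneg_left h1 (Real.exp_pos _).le)
        rw [visitExp, ← Real.exp_add, ← hN, hsp, hs]
        congr 1
        ring
      · rw [if_neg hNn, hκ, if_neg hNn, visitExp, ← hN, Finset.Ico_eq_empty (by omega),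
          Finset.Ico_eq_empty (by omega)]
        simp
    · simp only [if_neg hpt, add_zero, mul_zero, mul_one]
      exact le_rfl
  refine (expect_mono _ key).trans (le_of_eq ?_)
  rw [expect_const_mul, expect_add, expect_const, expect_const_mul, hmart, mul_zero, add_zero,
    mul_one]

theorem hexp_visitExp_le (θ : ℝ) (k : ℕ) :
    hexp M I adv k (visitExp p ξ c n B θ k) ≤
      Real.exp (θ ^ 2 * B ^ 2 / 2 * ∑ i ∈ Finset.range n, c i ^ 2) := by
  induction k with
  | zero =>
    rw [hexp_zero, visitExp, visitSum]
    simp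
  | succ k ih =>
    exact (hexp_visitExp_succ_le M I adv c n hp hξ hB hξB hmart θ k).trans ih

-- Chernoff bound. The event includes that `n` visits have occurred, so the random number of visits
-- needs no separate treatment.
open Classical in
theorem hexp_tail_le {θ : ℝ} (hθ : 0 ≤ θ) (u : ℝ) (k : ℕ) :
    hexp M I adv k (fun w => if n ≤ Nat.count (p w) k ∧
      u ≤ ∑ i ∈ Finset.range n, c i * ξ w (Nat.nth (p w) i) then 1 else 0) ≤
      Real.exp (-(θ * u) + θ ^ 2 * B ^ 2 / 2 * ∑ i ∈ Finset.range n, c i ^ 2) := by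
  have h1 : hexp M I adv k (fun w => if n ≤ Nat.count (p w) k ∧
      u ≤ ∑ i ∈ Finset.range n, c i * ξ w (Nat.nth (p w) i) then 1 else 0) ≤
      hexp M I adv k (fun w => Real.exp (-(θ * u)) * visitExp p ξ c n B θ k w) := by
    refine expect_mono _ fun z => ?_
    beta_reduce
    split_ifs with h
    · rw [visitExp, ← Real.exp_add, visitSum_eq p ξ c n h.1]
      rw [← Real.exp_zero]
      refine Real.exp_le_exp.2 ?_
      have h2 := mul_le_mul_of_nonneg_left h.2 hθ
      have h3 : 0 ≤ θ ^ 2 * B ^ 2 / 2 *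
          ∑ i ∈ Finset.Ico (Nat.count (p (pad z)) k) n, c i ^ 2 :=
        mul_nonneg (by positivity) (Finset.sum_nonneg fun i _ => sq_nonneg _)
      linarith
    · rw [visitExp]; positivity
  refine h1.trans ?_
  rw [hexp, expect_const_mul, Real.exp_add]
  exact mul_le_mul_of_nonneg_left (hexp_visitExp_le M I adv c n hp hξ hB hξB hmart θ k)
    (Real.exp_pos _).le

end Concentration

/-! ### Deviations at the level of the bonus. -/

section Deviation

variable {S A : Type*} {H : ℕ} [Fintype S] [DecidableEq S] [Fintype A] [DecidableEq A] [Nonempty S]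
variable (M : MDP S A H) (I : Input S A H) (adv : Adversary S H)
variable {p : (ℕ → Fin (H + 1) → S) → ℕ → Prop} [∀ w, DecidablePred (p w)]
  {ξ : (ℕ → Fin (H + 1) → S) → ℕ → ℝ}

theorem sum_range_alphaW (n : ℕ) (f : ℕ → ℝ) :
    ∑ i ∈ Finset.range n, alphaW H n (i + 1) * f i = wsum H n fun i => f (i - 1) := by
  rw [wsum, Finset.sum_bij (fun i _ => i + 1)]
  · intro i hi; have := Finset.mem_range.1 hi; simp; omega
  · intro i _ j _ h; omega
  · intro i hi
    have := Finset.mem_Icc.1 hi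
    exact ⟨i - 1, by simp; omega, by omega⟩
  · intro i _; simp

open Classical in
theorem hexp_deviation_le (hH : 0 < H) (hC : I.C₀ = 4) (hι : 0 ≤ iota S A H I.K)
    (hp : ∀ k w w', (∀ j ≤ k, w j = w' j) → (p w k ↔ p w' k))
    (hξ : ∀ k w w', (∀ j ≤ k, w j = w' j) → ξ w k = ξ w' k)
    (hξB : ∀ w k, |ξ w k| ≤ H)
    (hmart : ∀ w x k, expect (rollout M (pol M I w k) x H le_rfl)
      (fun t => if p (Function.update w k t) k then ξ (Function.update w k t) k else 0) = 0)
    {n : ℕ} (hn : 1 ≤ n) (k : ℕ) :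
    hexp M I adv k (fun w => if n ≤ Nat.count (p w) k ∧
      bonus I n ≤ wsum H n (fun i => ξ w (Nat.nth (p w) (i - 1))) then 1 else 0) ≤
      Real.exp (-(4 * iota S A H I.K)) := by
  have hH0 : (0 : ℝ) < H := by exact_mod_cast hH
  have hn0 : (0 : ℝ) < n := by exact_mod_cast hn
  have hu : 0 ≤ bonus I n := by rw [bonus, hC]; positivity
  -- With squared weights summing to at most 2H/n the exponent is at most -θu + θ²H³/n, minimal at θ
  -- = un/(2H³). For u = 4√(H³ι/n) its value is -4ι.
  have h := hexp_tail_le M I adv (fun i => alphaW H n (i + 1)) n hp hξ hH0 hξB hmart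
    (θ := bonus I n * n / (2 * (H : ℝ) ^ 3)) (by positivity) (bonus I n) k
  simp only [sum_range_alphaW n] at h
  refine h.trans (Real.exp_le_exp.2 ?_)
  have hs : ∑ i ∈ Finset.range n, alphaW H n (i + 1) ^ 2 ≤ 2 * H / n := by
    have e := sum_range_alphaW (H := H) n (fun i => alphaW H n (i + 1))
    simp only [← sq] at e
    rw [e]
    refine le_trans (le_of_eq ?_) (sum_alphaW_sq_le hH hn)
    refine Finset.sum_congr rfl fun i hi => ?_
    beta_reduce
    rw [Nat.sub_add_cancel (Finset.mem_Icc.1 hi).1, sq]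
  have hsq : bonus I n ^ 2 = 16 * ((H : ℝ) ^ 3 * iota S A H I.K / n) := by
    rw [bonus, hC, mul_pow, Real.sq_sqrt (by positivity)]; norm_num
  refine (add_le_add_right (mul_le_mul_of_nonneg_left hs (by positivity)) _).trans
    (le_of_eq ?_)
  have e : -(bonus I n * n / (2 * (H : ℝ) ^ 3) * bonus I n) +
      (bonus I n * n / (2 * (H : ℝ) ^ 3)) ^ 2 * (H : ℝ) ^ 2 / 2 * (2 * H / n) =
      -(bonus I n ^ 2 * n / (4 * (H : ℝ) ^ 3)) := by
    field_simp; ring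
  rw [e, hsq]
  field_simp
  ring

end Deviation

/-! ### The good event -/

section Good

variable {S A : Type*} {H : ℕ} [Fintype S] [DecidableEq S] [Fintype A] [DecidableEq A]
variable (M : MDP S A H) (I : Input S A H)

/-- In episode `k` the action `b` is taken at the state `y` in step `h`. -/
def Visited (h : Fin H) (y : S) (b : A) (w : ℕ → Fin (H + 1) → S) (k : ℕ) : Prop :=
  y = w k h.castSucc ∧ b = actAt M I w k h

instance (h : Fin H) (y : S) (b : A) (w : ℕ → Fin (H + 1) → S) :
    DecidablePred (Visited M I h y b w) := fun k => by
  unfold Visited; infer_instance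

theorem visited_congr (h : Fin H) (y : S) (b : A) {k : ℕ} {w w' : ℕ → Fin (H + 1) → S}
    (hw : ∀ j ≤ k, w j = w' j) : Visited M I h y b w k ↔ Visited M I h y b w' k := by
  rw [Visited, Visited, actAt, actAt, hw k le_rfl,
    pol_congr M I (w := w) (w' := w') fun j hj => hw j hj.le]

/-- At determined states the policy takes an optimal action. -/
def Sound (st : State S A H) : Prop :=
  ∀ h y, y ∈ st.G h → M.gap h y (choosePolicy I st h y) = 0

open Classical in
/-- The martingale difference of the multi-step bootstrapped return. -/
def segError (h : Fin H) (w : ℕ → Fin (H + 1) → S) (k : ℕ) : ℝ :=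
  if Sound M I (run M I w k) then
    ∑ i ∈ Finset.univ.filter
      (fun i : Fin H => h ≤ i ∧ (i : ℕ) < bootStep (run M I w k).G (w k) h),
      tdError M (pol M I w k) (w k) i
  else 0

/-- The martingale difference of the one-step bootstrapped return. -/
def stepError (h : Fin H) (w : ℕ → Fin (H + 1) → S) (k : ℕ) : ℝ :=
  tdError M (pol M I w k) (w k) h

/-- All weighted sums of martingale differences are dominated by the bonuses. -/
def Good (w : ℕ → Fin (H + 1) → S) : Prop :=
  ∀ (h : Fin H) (y : S) (b : A) (n : ℕ), 1 ≤ n → n ≤ Nat.count (Visited M I h y b w) I.K →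
    |wsum H n (fun i => segError M I h w (Nat.nth (Visited M I h y b w) (i - 1)))| ≤ bonus I n ∧
    |wsum H n (fun i => stepError M I h w (Nat.nth (Visited M I h y b w) (i - 1)))| ≤ bonus I n

variable [Nonempty A]

/-- The return of the steps `h, …` of episode `k` up to the first undetermined state, with the
optimal value there. -/
theorem segReturn_eq {w : ℕ → Fin (H + 1) → S} {k : ℕ} (hs : Sound M I (run M I w k))
    (h : Fin H) :
    segReward (fun i => M.r i (w k i.castSucc) (actAt M I w k i)) h
        (bootStep (run M I w k).G (w k) h) +
      valueAt (fun h => M.Vstar h) (w k) (bootStep (run M I w k).G (w k) h) =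
      M.Qstar h (w k h.castSucc) (actAt M I w k h) + segError M I h w k := by
  rw [segError, if_pos hs]
  exact segReward_add_value M (pol M I w k) (w k) h (bootStep_gt _ _ _) (bootStep_le _ _ _)
    fun i h1 h2 => hs i _ (mem_of_lt_bootStep h1 h2)

/-- The difference of a return and of Q*, both in [0, H]: the collected rewards are at most `j - h`
and the value at step `j` is at most `H - j`. -/
theorem abs_segError_le (h : Fin H) (w : ℕ → Fin (H + 1) → S) (k : ℕ) :
    |segError M I h w k| ≤ H := by
  by_cases hs : Sound M I (run M I w k)
  · have e := segReturn_eq M I hs h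
    set j := bootStep (run M I w k).G (w k) h with hj
    have h1 : (h : ℕ) < j := bootStep_gt _ _ _
    have h2 : j ≤ H := bootStep_le _ _ _
    have r0 := segReward_nonneg (rew := fun i => M.r i (w k i.castSucc) (actAt M I w k i))
      (fun i => (M.r_mem _ _ _).1) h j
    have r1 := segReward_le (rew := fun i => M.r i (w k i.castSucc) (actAt M I w k i))
      (fun i => (M.r_mem _ _ _).2) h h1.le h2
    rw [valueAt_Vstar M _ (Nat.lt_succ_of_le h2)] at e
    have v0 := M.Vstar_nonneg j (w k ⟨j, Nat.lt_succ_of_le h2⟩)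
    have v1 := M.Vstar_le j (w k ⟨j, Nat.lt_succ_of_le h2⟩)
    have q0 := M.Qstar_nonneg h (w k h.castSucc) (actAt M I w k h)
    have q1 := M.Qstar_le_horizon h (w k h.castSucc) (actAt M I w k h)
    rw [Nat.cast_sub h2] at v1
    have : (0 : ℝ) ≤ (h : ℕ) := Nat.cast_nonneg _
    rw [abs_le]
    constructor <;> linarith
  · rw [segError, if_neg hs]; simp

theorem abs_stepError_le (h : Fin H) (w : ℕ → Fin (H + 1) → S) (k : ℕ) :
    |stepError M I h w k| ≤ H := by
  have h1 := M.Vstar_nonneg (h + 1) (w k h.succ)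
  have h2 := M.Vstar_le_horizon (h + 1) (w k h.succ)
  have h3 := expect_nonneg (M.P h (w k h.castSucc) (pol M I w k h (w k h.castSucc)))
    (fun y => M.Vstar_nonneg (h + 1) y)
  have h4 := expect_le_const (M.P h (w k h.castSucc) (pol M I w k h (w k h.castSucc)))
    (fun y => M.Vstar_le_horizon (h + 1) y)
  rw [stepError, tdError, abs_le]
  constructor <;> linarith

theorem segError_congr (h : Fin H) {k : ℕ} {w w' : ℕ → Fin (H + 1) → S}
    (hw : ∀ j ≤ k, w j = w' j) : segError M I h w k = segError M I h w' k := by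
  rw [segError, segError, hw k le_rfl, run_congr M I (w := w) (w' := w') fun _ hj => hw _ hj.le,
    pol_congr M I (w := w) (w' := w') fun _ hj => hw _ hj.le]

theorem stepError_congr (h : Fin H) {k : ℕ} {w w' : ℕ → Fin (H + 1) → S}
    (hw : ∀ j ≤ k, w j = w' j) : stepError M I h w k = stepError M I h w' k := by
  rw [stepError, stepError, hw k le_rfl,
    pol_congr M I (w := w) (w' := w') fun _ hj => hw _ hj.le]

theorem pol_update (w : ℕ → Fin (H + 1) → S) (k : ℕ) (t : Fin (H + 1) → S) :
    pol M I (Function.update w k t) k = pol M I w k :=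
  pol_congr M I fun _ hj => Function.update_of_ne hj.ne _ _

theorem run_update (w : ℕ → Fin (H + 1) → S) (k : ℕ) (t : Fin (H + 1) → S) :
    run M I (Function.update w k t) k = run M I w k :=
  run_congr M I fun _ hj => Function.update_of_ne hj.ne _ _

theorem expect_stepError (h : Fin H) (y : S) (b : A) (w : ℕ → Fin (H + 1) → S) (x : S) (k : ℕ) :
    expect (rollout M (pol M I w k) x H le_rfl) (fun t =>
      if Visited M I h y b (Function.update w k t) k then
        stepError M I h (Function.update w k t) k else 0) = 0 := by
  refine Eq.trans ?_ (rollout_martingale M (pol M I w k) x h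
    (fun t => if y = t h.castSucc ∧ b = pol M I w k h (t h.castSucc) then 1 else 0)
    (fun t t' ht => by rw [ht h.castSucc le_rfl]) (M.Vstar (h + 1)))
  congr 1; funext t
  simp only [Visited, actAt, pol_update, Function.update_self, stepError, tdError]
  rw [ite_mul, one_mul, zero_mul]

theorem segError_update {w : ℕ → Fin (H + 1) → S} {k : ℕ} (hs : Sound M I (run M I w k))
    (h : Fin H) (t : Fin (H + 1) → S) :
    segError M I h (Function.update w k t) k = ∑ i ∈ Finset.univ.filter
      (fun i : Fin H => h ≤ i ∧ (i : ℕ) < bootStep (run M I w k).G t h),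
      tdError M (pol M I w k) t i := by
  rw [segError, if_pos (by rw [run_update]; exact hs), run_update, pol_update,
    Function.update_self]

/-- The error is a sum over all steps `i` of a martingale difference times the indicator that the
triple is visited and that bootstrapping occurs after `i`. This indicator is known at step `i`.
Setting `segError` to zero at unsound states makes the identity hold on every path, before soundness
is established. -/
theorem expect_segError (h : Fin H) (y : S) (b : A) (w : ℕ → Fin (H + 1) → S) (x : S) (k : ℕ) :
    expect (rollout M (pol M I w k) x H le_rfl) (fun t =>
      if Visited M I h y b (Function.update w k t) k then
        segError M I h (Function.update w k t) k else 0) = 0 := by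
  by_cases hs : Sound M I (run M I w k)
  · have e : ∀ t : Fin (H + 1) → S, (if Visited M I h y b (Function.update w k t) k then
        segError M I h (Function.update w k t) k else 0) = ∑ i : Fin H,
        (if (y = t h.castSucc ∧ b = pol M I w k h (t h.castSucc)) ∧ h ≤ i ∧
          (i : ℕ) < bootStep (run M I w k).G t h then (1 : ℝ) else 0) *
        (M.Vstar (i + 1) (t i.succ) -
          expect (M.P i (t i.castSucc) (pol M I w k i (t i.castSucc))) (M.Vstar (i + 1))) := by
      intro t
      simp only [segError_update M I hs, Visited, actAt, pol_update, Function.update_self, tdError]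
      by_cases hv : y = t h.castSucc ∧ b = pol M I w k h (t h.castSucc)
      · rw [if_pos hv, Finset.sum_filter]
        refine Finset.sum_congr rfl fun i _ => ?_
        by_cases hi : h ≤ i ∧ (i : ℕ) < bootStep (run M I w k).G t h
        · rw [if_pos hi, if_pos ⟨hv, hi⟩, one_mul]
        · rw [if_neg hi, if_neg fun h => hi h.2, zero_mul]
      · rw [if_neg hv, Finset.sum_eq_zero]
        intro i _
        rw [if_neg fun h => hv h.1, zero_mul]
    simp only [e]
    rw [expect_sum]
    refine Finset.sum_eq_zero fun i _ => ?_
    by_cases hhi : h ≤ i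
    · refine rollout_martingale M (pol M I w k) x i _ (fun t t' ht => ?_) (M.Vstar (i + 1))
      have e1 : t h.castSucc = t' h.castSucc := ht _ (Fin.castSucc_le_castSucc_iff.2 hhi)
      have e2 : (i : ℕ) < bootStep (run M I w k).G t h ↔
          (i : ℕ) < bootStep (run M I w k).G t' h := by
        rw [lt_bootStep_iff, lt_bootStep_iff]
        refine forall_congr' fun j => forall_congr' fun _ => forall_congr' fun hj => ?_
        rw [ht _ (Fin.castSucc_le_castSucc_iff.2 hj)]
      simp only [e1, e2]
    · refine expect_eq_zero _ fun t => ?_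
      rw [if_neg fun h => hhi h.2.1, zero_mul]
  · refine expect_eq_zero _ fun t => ?_
    have e : segError M I h (Function.update w k t) k = 0 := by
      rw [segError, if_neg]
      rw [run_update]; exact hs
    rw [e, ite_self]

variable [Nonempty S] (adv : Adversary S H)

-- Union bound over steps, states, actions and visit numbers up to `K`, with two kinds of error and
-- two signs; hence the factor 4.
open Classical in
theorem hexp_not_good_le (hH : 0 < H) (hC : I.C₀ = 4) (hι : 0 ≤ iota S A H I.K) :
    hexp M I adv I.K (fun w => if Good M I w then 0 else 1) ≤
      (H * (Fintype.card S * (Fintype.card A * (I.K * (4 *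
        Real.exp (-(4 * iota S A H I.K))))))) := by
  have wneg : ∀ (n : ℕ) (f : ℕ → ℝ), wsum H n (fun i => -f i) = -wsum H n f := fun n f => by
    simpa using wsum_const_mul (H := H) n (-1) f
  let D : (h : Fin H) → S → A → ℕ → ((ℕ → Fin (H + 1) → S) → ℕ → ℝ) →
      (ℕ → Fin (H + 1) → S) → ℝ := fun h y b n ξ w =>
    if n ≤ Nat.count (Visited M I h y b w) I.K ∧
      bonus I n ≤ wsum H n (fun i => ξ w (Nat.nth (Visited M I h y b w) (i - 1))) then 1 else 0
  have hD0 : ∀ h y b n ξ w, 0 ≤ D h y b n ξ w := fun h y b n ξ w => by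
    simp only [D]; split_ifs <;> norm_num
  have hE : ∀ h y b n, 1 ≤ n → hexp M I adv I.K (fun w =>
      D h y b n (segError M I h) w + D h y b n (fun w k => -segError M I h w k) w +
      (D h y b n (stepError M I h) w + D h y b n (fun w k => -stepError M I h w k) w)) ≤
      4 * Real.exp (-(4 * iota S A H I.K)) := by
    intro h y b n hn
    have hv : ∀ k w w', (∀ j ≤ k, w j = w' j) →
      (Visited M I h y b w k ↔ Visited M I h y b w' k) := fun k w w' hw =>
        visited_congr M I h y b hw
    have hneg : ∀ (ξ : (ℕ → Fin (H + 1) → S) → ℕ → ℝ) w x k,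
        expect (rollout M (pol M I w k) x H le_rfl) (fun t =>
          if Visited M I h y b (Function.update w k t) k then
          ξ (Function.update w k t) k else 0) = 0 →
        expect (rollout M (pol M I w k) x H le_rfl) (fun t =>
          if Visited M I h y b (Function.update w k t) k then
          -ξ (Function.update w k t) k else 0) = 0 := by
      intro ξ w x k h0
      have := expect_const_mul (rollout M (pol M I w k) x H le_rfl) (-1) (fun t =>
          if Visited M I h y b (Function.update w k t) k then
          ξ (Function.update w k t) k else 0)
      rw [h0, mul_zero] at this
      refine Eq.trans ?_ this
      congr 1; funext t
      split_ifs <;> ring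
    have h1 := hexp_deviation_le M I adv (ξ := segError M I h) hH hC hι hv
      (fun k w w' hw => segError_congr M I h hw)
      (abs_segError_le M I h) (fun w x k => expect_segError M I h y b w x k) hn I.K
    have h2 := hexp_deviation_le M I adv (ξ := fun w k => -segError M I h w k) hH hC hι hv
      (fun k w w' hw => by rw [segError_congr M I h hw])
      (fun w k => by rw [abs_neg]; exact abs_segError_le M I h w k)
      (fun w x k => hneg _ w x k (expect_segError M I h y b w x k)) hn I.K
    have h3 := hexp_deviation_le M I adv (ξ := stepError M I h) hH hC hι hv
      (fun k w w' hw => stepError_congr M I h hw)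
      (abs_stepError_le M I h) (fun w x k => expect_stepError M I h y b w x k) hn I.K
    have h4 := hexp_deviation_le M I adv (ξ := fun w k => -stepError M I h w k) hH hC hι hv
      (fun k w w' hw => by rw [stepError_congr M I h hw])
      (fun w k => by rw [abs_neg]; exact abs_stepError_le M I h w k)
      (fun w x k => hneg _ w x k (expect_stepError M I h y b w x k)) hn I.K
    simp only [hexp] at h1 h2 h3 h4 ⊢
    rw [expect_add, expect_add, expect_add]
    linarith
  have hle : ∀ w, (if Good M I w then (0 : ℝ) else 1) ≤ ∑ h : Fin H, ∑ y : S, ∑ b : A,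
      ∑ n ∈ Finset.Icc 1 I.K,
      (D h y b n (segError M I h) w + D h y b n (fun w k => -segError M I h w k) w +
      (D h y b n (stepError M I h) w + D h y b n (fun w k => -stepError M I h w k) w)) := by
    intro w
    have hT0 : ∀ h y b n, 0 ≤
        (D h y b n (segError M I h) w + D h y b n (fun w k => -segError M I h w k) w +
      (D h y b n (stepError M I h) w + D h y b n (fun w k => -stepError M I h w k) w)) :=
      fun h y b n => by
        have a1 := hD0 h y b n (segError M I h) w
        have a2 := hD0 h y b n (fun w k => -segError M I h w k) w
        have a3 := hD0 h y b n (stepError M I h) w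
        have a4 := hD0 h y b n (fun w k => -stepError M I h w k) w
        linarith
    split_ifs with hg
    · exact Finset.sum_nonneg fun h _ => Finset.sum_nonneg fun y _ =>
        Finset.sum_nonneg fun b _ => Finset.sum_nonneg fun n _ => hT0 h y b n
    · rw [Good] at hg
      push Not at hg
      obtain ⟨h, y, b, n, hn1, hn2, hg⟩ := hg
      have hnK : n ∈ Finset.Icc 1 I.K :=
        Finset.mem_Icc.2 ⟨hn1, hn2.trans (Nat.count_le _)⟩
      refine le_trans ?_ (Finset.single_le_sum (f := fun h => ∑ y : S, ∑ b : A,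
        ∑ n ∈ Finset.Icc 1 I.K, _) (fun h _ => Finset.sum_nonneg fun y _ =>
        Finset.sum_nonneg fun b _ => Finset.sum_nonneg fun n _ => hT0 h y b n) (Finset.mem_univ h))
      refine le_trans ?_ (Finset.single_le_sum (f := fun y => ∑ b : A,
        ∑ n ∈ Finset.Icc 1 I.K, _) (fun y _ =>
        Finset.sum_nonneg fun b _ => Finset.sum_nonneg fun n _ => hT0 h y b n) (Finset.mem_univ y))
      refine le_trans ?_ (Finset.single_le_sum (f := fun b =>
        ∑ n ∈ Finset.Icc 1 I.K, _) (fun b _ => Finset.sum_nonneg fun n _ => hT0 h y b n)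
        (Finset.mem_univ b))
      refine le_trans ?_ (Finset.single_le_sum (f := fun n => _) (fun n _ => hT0 h y b n) hnK)
      have hcase : bonus I n ≤ wsum H n
            (fun i => segError M I h w (Nat.nth (Visited M I h y b w) (i - 1))) ∨
          bonus I n ≤ wsum H n
            (fun i => -segError M I h w (Nat.nth (Visited M I h y b w) (i - 1))) ∨
          bonus I n ≤ wsum H n
            (fun i => stepError M I h w (Nat.nth (Visited M I h y b w) (i - 1))) ∨
          bonus I n ≤ wsum H n
            (fun i => -stepError M I h w (Nat.nth (Visited M I h y b w) (i - 1))) := by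
        rw [wneg, wneg]
        by_contra hcon
        push Not at hcon
        obtain ⟨c1, c2, c3, c4⟩ := hcon
        exact absurd (abs_le.2 ⟨by linarith, by linarith⟩)
          (not_le.2 (hg (abs_le.2 ⟨by linarith, by linarith⟩)))
      have a1 := hD0 h y b n (segError M I h) w
      have a2 := hD0 h y b n (fun w k => -segError M I h w k) w
      have a3 := hD0 h y b n (stepError M I h) w
      have a4 := hD0 h y b n (fun w k => -stepError M I h w k) w
      have hD1 : ∀ ξ : (ℕ → Fin (H + 1) → S) → ℕ → ℝ, bonus I n ≤ wsum H n
            (fun i => ξ w (Nat.nth (Visited M I h y b w) (i - 1))) → D h y b n ξ w = 1 :=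
        fun ξ hξ => if_pos ⟨hn2, hξ⟩
      rcases hcase with hc | hc | hc | hc
      · linarith [hD1 _ hc]
      · linarith [hD1 (fun w k => -segError M I h w k) hc]
      · linarith [hD1 _ hc]
      · linarith [hD1 (fun w k => -stepError M I h w k) hc]
  refine (expect_mono _ fun z => hle (pad z)).trans ?_
  simp only [expect_sum]
  refine le_trans (Finset.sum_le_sum fun h _ => Finset.sum_le_sum fun y _ =>
    Finset.sum_le_sum fun b _ => Finset.sum_le_sum fun n hn =>
      hE h y b n (Finset.mem_Icc.1 hn).1) (le_of_eq ?_)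
  simp

end Good
end
end QLP

namespace QLP
noncomputable section

/-! ### One update of the learner's state -/

section MaxOver

variable {A : Type*}

theorem le_maxOver {s : Finset A} {b : A} (hb : b ∈ s) (f : A → ℝ) : f b ≤ maxOver s f := by
  rw [maxOver, dif_pos ⟨b, hb⟩]
  exact Finset.le_sup' f hb

theorem exists_maxOver {s : Finset A} (hs : s.Nonempty) (f : A → ℝ) :
    ∃ b ∈ s, maxOver s f = f b := by
  rw [maxOver, dif_pos hs]
  exact Finset.exists_mem_eq_sup' hs f

theorem maxOver_le {s : Finset A} (hs : s.Nonempty) {f : A → ℝ} {c : ℝ} (h : ∀ b ∈ s, f b ≤ c) :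
    maxOver s f ≤ c := by
  rw [maxOver, dif_pos hs]
  exact Finset.sup'_le hs f h

end MaxOver

section Update

variable {S A : Type*} {H : ℕ} [Fintype S] [DecidableEq S] [Fintype A] [DecidableEq A] [Nonempty A]
variable (M : MDP S A H) (I : Input S A H)

/-- The confidence bounds hold, and the active sets contain the optimal actions. -/
structure Valid (st : State S A H) : Prop where
  qlo_le : ∀ h y b, st.qlo h y b ≤ M.Qstar h y b
  le_qup : ∀ h y b, M.Qstar h y b ≤ st.qup h y b
  Qlo_le : ∀ h y b, st.Qlo h y b ≤ M.Qstar h y b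
  le_Qup : ∀ h y b, M.Qstar h y b ≤ st.Qup h y b
  Vlo_le : ∀ (h : Fin H) y, st.Vlo h y ≤ M.Vstar h y
  le_Vup : ∀ (h : Fin H) y, M.Vstar h y ≤ st.Vup h y
  opt_mem : ∀ h y b, M.gap h y b = 0 → b ∈ st.act h y
  mem_G : ∀ h y, y ∈ st.G h ↔ (st.act h y).card = 1

/-- The values and the active sets are consistent with the action values. -/
structure Consistent (st : State S A H) : Prop where
  Qup_le_qup : ∀ h y b, st.Qup h y b ≤ st.qup h y b
  qlo_le_Qlo : ∀ h y b, st.qlo h y b ≤ st.Qlo h y b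
  Vlo_le_Qup : ∀ h y, ∀ b ∈ st.act h y, st.Vlo h y ≤ st.Qup h y b
  exists_Vup_le : ∀ h y, ∃ b ∈ st.act h y, st.Vup h y ≤ st.Qup h y b
  Qlo_le_Vlo : ∀ h y, ∀ b ∈ st.act h y, st.Qlo h y b ≤ st.Vlo h y
  exists_Vlo_le : ∀ h y, ∃ b ∈ st.act h y, st.Vlo h y ≤ st.Qlo h y b
  eliminated : ∀ h y b, b ∉ st.act h y → M.Qstar h y b ≤ st.Vlo h y

variable {M I} {st : State S A H}

theorem Valid.act_nonempty (hv : Valid M st) (h : Fin H) (y : S) : (st.act h y).Nonempty :=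
  let ⟨b, hb⟩ := M.exists_gap_eq_zero h y
  ⟨b, hv.opt_mem h y b hb⟩

theorem choosePolicy_mem (hI : IsArgmax I.argmax) (hv : Valid M st) (h : Fin H) (y : S) :
    choosePolicy I st h y ∈ st.act h y := by
  have hne := hv.act_nonempty h y
  rw [choosePolicy]
  split_ifs
  · exact (hI _ _ hne).1
  · exact (hI _ _ hne).1
  · exact (hI _ _ hne).1

theorem Valid.gap_eq_zero_of_mem (hv : Valid M st) {h : Fin H} {y : S} (hy : y ∈ st.G h) {b : A}
    (hb : b ∈ st.act h y) : M.gap h y b = 0 := by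
  obtain ⟨c, hc⟩ := M.exists_gap_eq_zero h y
  have := Finset.card_le_one.1 ((hv.mem_G h y).1 hy).le b hb c (hv.opt_mem h y c hc)
  rwa [this]

theorem Valid.sound (hI : IsArgmax I.argmax) (hv : Valid M st) : Sound M I st := fun h y hy =>
  hv.gap_eq_zero_of_mem hy (choosePolicy_mem hI hv h y)

theorem MDP.Qstar_eq_of_gap (M : MDP S A H) {h : Fin H} {y : S} {b : A} (hb : M.gap h y b = 0) :
    M.Qstar h y b = M.Vstar h y := by
  rw [MDP.gap] at hb; linarith

/-- With a single action all active sets are singletons from the start, whereas `initState` has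
empty `G`; that case is excluded. It is harmless, since then all gaps vanish. -/
theorem valid_initState (hA : Fintype.card A ≠ 1) : Valid M (initState I) where
  qlo_le := M.Qstar_nonneg
  le_qup := M.Qstar_le_horizon
  Qlo_le := M.Qstar_nonneg
  le_Qup := M.Qstar_le_horizon
  Vlo_le := fun h y => M.Vstar_nonneg h y
  le_Vup := fun h y => M.Vstar_le_horizon h y
  opt_mem := fun _ _ b _ => Finset.mem_univ b
  mem_G := fun h y => by
    simp only [initState, Finset.notMem_empty, Finset.card_univ, false_iff]
    exact hA

theorem consistent_initState : Consistent M (initState I) where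
  Qup_le_qup := fun _ _ _ => le_rfl
  qlo_le_Qlo := fun _ _ _ => le_rfl
  Vlo_le_Qup := fun _ _ _ _ => by simp [initState]
  exists_Vup_le := fun _ _ => ⟨Classical.arbitrary A, Finset.mem_univ _, le_rfl⟩
  Qlo_le_Vlo := fun _ _ _ _ => le_rfl
  exists_Vlo_le := fun _ _ => ⟨Classical.arbitrary A, Finset.mem_univ _, le_rfl⟩
  eliminated := fun _ _ b hb => absurd (Finset.mem_univ b) hb

variable {x : Fin (H + 1) → S} {a : Fin H → A} {rew : Fin H → ℝ}

/-- Only the bounds for the two supplementary estimates need probability; the rest follows. An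
optimal action survives because its upper estimate is at least V*, which is at least the lower
value. -/
theorem Valid.update (hv : Valid M st)
    (hup : ∀ h y b, M.Qstar h y b ≤ nextqup I st x a rew h y b)
    (hlo : ∀ h y b, nextqlo I st x a rew h y b ≤ M.Qstar h y b) :
    Valid M (update I st x a rew) := by
  have hQup : ∀ h y b, M.Qstar h y b ≤ nextQup I st x a rew h y b := fun h y b =>
    le_min (hv.le_Qup h y b) (hup h y b)
  have hQlo : ∀ h y b, nextQlo I st x a rew h y b ≤ M.Qstar h y b := fun h y b =>
    max_le (hv.Qlo_le h y b) (hlo h y b)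
  have hVlo : ∀ (h : Fin H) y, nextVlo I st x a rew h y ≤ M.Vstar h y := fun h y => by
    rw [nextVlo]
    split_ifs
    · exact maxOver_le (hv.act_nonempty h y) fun b _ =>
        (hQlo h y b).trans (M.Qstar_le_Vstar h y b)
    · exact hv.Vlo_le h y
  refine ⟨hlo, hup, hQlo, hQup, hVlo, fun h y => ?_, fun h y b hb => ?_, fun h y => ?_⟩
  · change _ ≤ nextVup I st x a rew h y
    rw [nextVup]
    split_ifs
    · obtain ⟨b, hb⟩ := M.exists_gap_eq_zero h y
      rw [← M.Qstar_eq_of_gap hb]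
      exact (hQup h y b).trans (le_maxOver (hv.opt_mem h y b hb) _)
    · exact hv.le_Vup h y
  · refine Finset.mem_filter.2 ⟨hv.opt_mem h y b hb, ?_⟩
    refine (hVlo h y).trans ?_
    rw [← M.Qstar_eq_of_gap hb]
    exact hQup h y b
  · simp [QLP.update]

theorem nextqup_of_not_learned {h : Fin H} {y : S} {b : A} (hl : ¬ Learned st x a h y b) :
    nextqup I st x a rew h y b = st.qup h y b := by
  simp only [nextqup, if_neg hl]

theorem nextqlo_of_not_learned {h : Fin H} {y : S} {b : A} (hl : ¬ Learned st x a h y b) :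
    nextqlo I st x a rew h y b = st.qlo h y b := by
  simp only [nextqlo, if_neg hl]

theorem Consistent.nextQup_of_not_learned (hc : Consistent M st) {h : Fin H} {y : S} {b : A}
    (hl : ¬ Learned st x a h y b) : nextQup I st x a rew h y b = st.Qup h y b := by
  rw [nextQup, nextqup_of_not_learned hl, min_eq_left (hc.Qup_le_qup h y b)]

theorem Consistent.nextQlo_of_not_learned (hc : Consistent M st) {h : Fin H} {y : S} {b : A}
    (hl : ¬ Learned st x a h y b) : nextQlo I st x a rew h y b = st.Qlo h y b := by
  rw [nextQlo, nextqlo_of_not_learned hl, max_eq_left (hc.qlo_le_Qlo h y b)]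

/-- Nothing is eliminated where nothing was learned, although the algorithm rechecks all states. -/
theorem Consistent.nextAct_of_not (hc : Consistent M st) {h : Fin H} {y : S}
    (hl : ¬ (y = x h.castSucc ∧ y ∉ st.G h)) : nextAct I st x a rew h y = st.act h y := by
  rw [nextAct, Finset.filter_true_of_mem]
  intro b hb
  rw [nextVlo, if_neg hl, hc.nextQup_of_not_learned fun h' => hl ⟨h'.1.1, h'.2⟩]
  exact hc.Vlo_le_Qup h y b hb

theorem Consistent.update (hc : Consistent M st) (hv : Valid M st)
    (hv' : Valid M (update I st x a rew)) : Consistent M (update I st x a rew) := by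
  have hcase : ∀ (h : Fin H) (y : S),
      (∃ b ∈ nextAct I st x a rew h y,
        nextVup I st x a rew h y ≤ nextQup I st x a rew h y b) ∧
      (∀ b ∈ nextAct I st x a rew h y, nextQlo I st x a rew h y b ≤ nextVlo I st x a rew h y) ∧
      (∃ b ∈ nextAct I st x a rew h y,
        nextVlo I st x a rew h y ≤ nextQlo I st x a rew h y b) ∧
      (∀ b, b ∉ nextAct I st x a rew h y → M.Qstar h y b ≤ nextVlo I st x a rew h y) := by
    intro h y
    by_cases hl : y = x h.castSucc ∧ y ∉ st.G h
    · have e1 : nextVup I st x a rew h y = maxOver (st.act h y) (nextQup I st x a rew h y) := by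
        rw [nextVup, if_pos hl]
      have e2 : nextVlo I st x a rew h y = maxOver (st.act h y) (nextQlo I st x a rew h y) := by
        rw [nextVlo, if_pos hl]
      have hne := hv.act_nonempty h y
      have hsub : ∀ b ∈ nextAct I st x a rew h y, b ∈ st.act h y := fun b hb =>
        (Finset.mem_filter.1 hb).1
      refine ⟨?_, ?_, ?_, ?_⟩
      -- The maximum is taken over the old active set, so its maximizer must be shown to survive. It
      -- does, since its upper estimate is at least V*.
      · obtain ⟨b, hb, hb'⟩ := exists_maxOver hne (nextQup I st x a rew h y)
        refine ⟨b, Finset.mem_filter.2 ⟨hb, ?_⟩, (e1.trans hb').le⟩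
        rw [← hb', ← e1]
        exact (hv'.Vlo_le h y).trans (hv'.le_Vup h y)
      · intro b hb
        rw [e2]
        exact le_maxOver (hsub b hb) _
      · obtain ⟨b, hb, hb'⟩ := exists_maxOver hne (nextQlo I st x a rew h y)
        refine ⟨b, Finset.mem_filter.2 ⟨hb, ?_⟩, (e2.trans hb').le⟩
        rw [e2, hb']
        exact (hv'.Qlo_le h y b).trans (hv'.le_Qup h y b)
      · intro b hb
        by_cases hb' : b ∈ st.act h y
        · have : ¬ nextVlo I st x a rew h y ≤ nextQup I st x a rew h y b := fun h' =>
            hb (Finset.mem_filter.2 ⟨hb', h'⟩)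
          exact (hv'.le_Qup h y b).trans (not_le.1 this).le
        -- For an action eliminated earlier: the lower value can only have grown, because some then
        -- active `c` attained it and lower estimates increase.
        · obtain ⟨c, hcm, hcl⟩ := hc.exists_Vlo_le h y
          rw [e2]
          exact (hc.eliminated h y b hb').trans (hcl.trans ((le_max_left _ _).trans
            (le_maxOver hcm (nextQlo I st x a rew h y))))
    · have hl' : ∀ b, ¬ Learned st x a h y b := fun b h' => hl ⟨h'.1.1, h'.2⟩
      rw [hc.nextAct_of_not hl, nextVup, if_neg hl, nextVlo, if_neg hl]
      refine ⟨?_, ?_, ?_, hc.eliminated h y⟩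
      · obtain ⟨b, hb, hb'⟩ := hc.exists_Vup_le h y
        exact ⟨b, hb, by rw [hc.nextQup_of_not_learned (hl' b)]; exact hb'⟩
      · intro b hb
        rw [hc.nextQlo_of_not_learned (hl' b)]
        exact hc.Qlo_le_Vlo h y b hb
      · obtain ⟨b, hb, hb'⟩ := hc.exists_Vlo_le h y
        exact ⟨b, hb, by rw [hc.nextQlo_of_not_learned (hl' b)]; exact hb'⟩
  exact ⟨fun h y b => min_le_right _ _, fun h y b => le_max_right _ _,
    fun h y b hb => (Finset.mem_filter.1 hb).2, fun h y => (hcase h y).1,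
    fun h y => (hcase h y).2.1, fun h y => (hcase h y).2.2.1, fun h y => (hcase h y).2.2.2⟩

end Update

/-! ### Explicit formulas for the estimates -/

section Formulas

variable {S A : Type*} {H : ℕ} [Fintype S] [DecidableEq S] [Fintype A] [DecidableEq A] [Nonempty A]
variable (M : MDP S A H) (I : Input S A H) (w : ℕ → Fin (H + 1) → S)

/-- The number of visits before episode `k`. -/
abbrev visits (h : Fin H) (y : S) (b : A) (k : ℕ) : ℕ := Nat.count (Visited M I h y b w) k

/-- The episode of the `i`-th visit. -/
abbrev visitAt (h : Fin H) (y : S) (b : A) (i : ℕ) : ℕ := Nat.nth (Visited M I h y b w) (i - 1)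

theorem nth_of_lt_count {p : ℕ → Prop} [DecidablePred p] {k i : ℕ} (hi : i < Nat.count p k) :
    Nat.nth p i < k ∧ p (Nat.nth p i) := by
  induction k with
  | zero => simp at hi
  | succ k ih =>
    rw [Nat.count_succ] at hi
    by_cases h : i < Nat.count p k
    · exact ⟨(ih h).1.trans (Nat.lt_succ_self k), (ih h).2⟩
    · split_ifs at hi with hp
      · have : i = Nat.count p k := by omega
        rw [this, Nat.nth_count hp]
        exact ⟨Nat.lt_succ_self k, hp⟩
      · omega

variable {M I w}

theorem visitAt_spec {h : Fin H} {y : S} {b : A} {k i : ℕ} (h1 : 1 ≤ i)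
    (h2 : i ≤ visits M I w h y b k) :
    visitAt M I w h y b i < k ∧ Visited M I h y b w (visitAt M I w h y b i) :=
  nth_of_lt_count (show i - 1 < visits M I w h y b k by omega)

theorem visits_mono (h : Fin H) (y : S) (b : A) {j k : ℕ} (hjk : j ≤ k) :
    visits M I w h y b j ≤ visits M I w h y b k := Nat.count_monotone _ hjk

variable (M I w)

theorem N_run (h : Fin H) (y : S) (b : A) (k : ℕ) :
    (run M I w k).N h y b = visits M I w h y b k := by
  induction k with
  | zero => simp [run, initState]
  | succ k ih =>
    rw [visits, Nat.count_succ, ← visits, ← ih]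
    change nextN (run M I w k) (w k) (actAt M I w k) h y b = _
    rw [nextN]
    by_cases hv : Visited M I h y b w k
    · rw [if_pos (And.intro hv.1 hv.2), if_pos hv]
    · rw [if_neg (fun h' : y = w k h.castSucc ∧ b = actAt M I w k h => hv h'), if_neg hv, add_zero]

/-- The rewards observed in episode `k`. -/
def rewAt (k : ℕ) (h : Fin H) : ℝ := M.r h (w k h.castSucc) (actAt M I w k h)

/-- The step whose value is used for bootstrapping at step `h` of episode `k`. -/
def bootAt (k : ℕ) (h : Fin H) : ℕ := bootStep (run M I w k).G (w k) h

/-- The initial value is forgotten at the first visit because α_1 = 1. -/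
theorem avg_succ (N : ℕ) (c : ℝ) (f : ℕ → ℝ) :
    (1 - alpha H (N + 1)) * (alphaZero N * c + wsum H N f) + alpha H (N + 1) * f (N + 1) =
      alphaZero (N + 1) * c + wsum H (N + 1) f := by
  rw [wsum_succ]
  rcases Nat.eq_zero_or_pos N with rfl | hN
  · simp [alpha_one, alphaZero]
  · rw [alphaZero, alphaZero, if_neg hN.ne', if_neg (by omega)]; ring

variable {M I w}

theorem learned_iff {k : ℕ} {h : Fin H} {y : S} {b : A} :
    Learned (run M I w k) (w k) (actAt M I w k) h y b ↔
      Visited M I h y b w k ∧ y ∉ (run M I w k).G h := Iff.rfl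

theorem nextN_of_visited {k : ℕ} {h : Fin H} {y : S} {b : A} (hv : Visited M I h y b w k) :
    nextN (run M I w k) (w k) (actAt M I w k) h y b = visits M I w h y b k + 1 := by
  rw [nextN, if_pos (And.intro hv.1 hv.2), N_run]

/-- The visit counter also advances at determined states, where the estimate is frozen. The
assumption `hG` ensures that visits and updates coincide. -/
theorem qup_run {h : Fin H} {y : S} {b : A} {k : ℕ}
    (hG : ∀ j < k, Visited M I h y b w j → y ∉ (run M I w j).G h) :
    (run M I w k).qup h y b = alphaZero (visits M I w h y b k) * H +
      wsum H (visits M I w h y b k) (fun i =>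
        segReward (rewAt M I w (visitAt M I w h y b i)) h (bootAt M I w (visitAt M I w h y b i) h) +
        valueAt (run M I w (visitAt M I w h y b i)).Vup (w (visitAt M I w h y b i))
          (bootAt M I w (visitAt M I w h y b i) h) + bonus I i) := by
  induction k with
  | zero => simp [run, initState, alphaZero]
  | succ k ih =>
    have ih' := ih fun j hj => hG j (by omega)
    change nextqup I (run M I w k) (w k) (actAt M I w k) (rewAt M I w k) h y b = _
    by_cases hv : Visited M I h y b w k
    · have hl : Learned (run M I w k) (w k) (actAt M I w k) h y b :=
        learned_iff.2 ⟨hv, hG k (Nat.lt_succ_self k) hv⟩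
      have hn : visits M I w h y b (k + 1) = visits M I w h y b k + 1 := by
        rw [visits, Nat.count_succ, if_pos hv]
      simp only [nextqup, if_pos hl, nextN_of_visited hv]
      rw [hn, ← avg_succ, ← ih']
      simp only [visitAt, Nat.add_sub_cancel, Nat.nth_count hv]
      rfl
    · have hl : ¬ Learned (run M I w k) (w k) (actAt M I w k) h y b := fun h' => hv h'.1
      have hn : visits M I w h y b (k + 1) = visits M I w h y b k := by
        rw [visits, Nat.count_succ, if_neg hv, add_zero]
      rw [nextqup_of_not_learned hl, hn, ih']

theorem qlo_run {h : Fin H} {y : S} {b : A} {k : ℕ}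
    (hG : ∀ j < k, Visited M I h y b w j → y ∉ (run M I w j).G h) :
    (run M I w k).qlo h y b =
      wsum H (visits M I w h y b k) (fun i =>
        segReward (rewAt M I w (visitAt M I w h y b i)) h (bootAt M I w (visitAt M I w h y b i) h) +
        valueAt (run M I w (visitAt M I w h y b i)).Vlo (w (visitAt M I w h y b i))
          (bootAt M I w (visitAt M I w h y b i) h) - bonus I i) := by
  induction k with
  | zero => simp [run, initState]
  | succ k ih =>
    have ih' := ih fun j hj => hG j (by omega)
    change nextqlo I (run M I w k) (w k) (actAt M I w k) (rewAt M I w k) h y b = _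
    by_cases hv : Visited M I h y b w k
    · have hl : Learned (run M I w k) (w k) (actAt M I w k) h y b :=
        learned_iff.2 ⟨hv, hG k (Nat.lt_succ_self k) hv⟩
      have hn : visits M I w h y b (k + 1) = visits M I w h y b k + 1 := by
        rw [visits, Nat.count_succ, if_pos hv]
      simp only [nextqlo, if_pos hl, nextN_of_visited hv]
      rw [hn, wsum_succ, ← ih']
      simp only [visitAt, Nat.add_sub_cancel, Nat.nth_count hv]
      rfl
    · have hl : ¬ Learned (run M I w k) (w k) (actAt M I w k) h y b := fun h' => hv h'.1
      have hn : visits M I w h y b (k + 1) = visits M I w h y b k := by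
        rw [visits, Nat.count_succ, if_neg hv, add_zero]
      rw [nextqlo_of_not_learned hl, hn, ih']

theorem Rup_run (h : Fin H) (y : S) (b : A) (k : ℕ) :
    (run M I w k).Rup h y b = alphaZero (visits M I w h y b k) * H +
      wsum H (visits M I w h y b k) (fun i =>
        rewAt M I w (visitAt M I w h y b i) h +
        valueAt (run M I w (visitAt M I w h y b i)).Vt (w (visitAt M I w h y b i)) (h + 1) +
          bonus I i) := by
  induction k with
  | zero => simp [run, initState, alphaZero]
  | succ k ih =>
    change nextRup I (run M I w k) (w k) (actAt M I w k) (rewAt M I w k) h y b = _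
    by_cases hv : Visited M I h y b w k
    · have hn : visits M I w h y b (k + 1) = visits M I w h y b k + 1 := by
        rw [visits, Nat.count_succ, if_pos hv]
      simp only [nextRup, nextN_of_visited hv]
      rw [if_pos (And.intro hv.1 hv.2), hn, ← avg_succ, ← ih]
      simp only [visitAt, Nat.add_sub_cancel, Nat.nth_count hv]
    · have hn : visits M I w h y b (k + 1) = visits M I w h y b k := by
        rw [visits, Nat.count_succ, if_neg hv, add_zero]
      simp only [nextRup]
      rw [if_neg (fun h' : y = w k h.castSucc ∧ b = actAt M I w k h => hv h'), hn, ih]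

theorem ranTargets_run {h : Fin H} {y : S} {b : A} {k : ℕ}
    (hG : ∀ j < k, Visited M I h y b w j → y ∉ (run M I w j).G h) :
    (run M I w k).ranTargets h y b = (List.range (visits M I w h y b k)).map fun i =>
      valueAt (run M I w (visitAt M I w h y b (i + 1))).ranV (w (visitAt M I w h y b (i + 1)))
        (bootAt M I w (visitAt M I w h y b (i + 1)) h) := by
  induction k with
  | zero => simp [run, initState]
  | succ k ih =>
    have ih' := ih fun j hj => hG j (by omega)
    change nextRanTargets (run M I w k) (w k) (actAt M I w k) h y b = _
    by_cases hv : Visited M I h y b w k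
    · have hl : Learned (run M I w k) (w k) (actAt M I w k) h y b :=
        learned_iff.2 ⟨hv, hG k (Nat.lt_succ_self k) hv⟩
      have hn : visits M I w h y b (k + 1) = visits M I w h y b k + 1 := by
        rw [visits, Nat.count_succ, if_pos hv]
      rw [nextRanTargets, if_pos hl, hn, List.range_succ, List.map_append, ← ih']
      simp only [visitAt, Nat.add_sub_cancel, Nat.nth_count hv, List.map_cons, List.map_nil]
      rfl
    · have hl : ¬ Learned (run M I w k) (w k) (actAt M I w k) h y b := fun h' => hv h'.1
      have hn : visits M I w h y b (k + 1) = visits M I w h y b k := by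
        rw [visits, Nat.count_succ, if_neg hv, add_zero]
      rw [nextRanTargets, if_neg hl, hn, ih']

theorem ranTargets_getD {h : Fin H} {y : S} {b : A} {k i : ℕ}
    (hG : ∀ j < k, Visited M I h y b w j → y ∉ (run M I w j).G h) (h1 : 1 ≤ i)
    (h2 : i ≤ visits M I w h y b k) :
    ((run M I w k).ranTargets h y b).getD (i - 1) 0 =
      valueAt (run M I w (visitAt M I w h y b i)).ranV (w (visitAt M I w h y b i))
        (bootAt M I w (visitAt M I w h y b i) h) := by
  rw [ranTargets_run hG, List.getD_eq_getElem _ _ (by simp; omega)]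
  simp only [List.getElem_map, List.getElem_range, Nat.sub_add_cancel h1]

end Formulas
end
end QLP

namespace QLP
noncomputable section

/-! ### Validity of the confidence bounds -/

section Bonus

variable {S A : Type*} {H : ℕ} [Fintype S] [Fintype A] {I : Input S A H}

theorem bonus_eq (hC : I.C₀ = 4) (hι : 0 ≤ iota S A H I.K) (n : ℕ) :
    bonus I n = 4 * √((H : ℝ) ^ 3 * iota S A H I.K) * (1 / √(n : ℝ)) := by
  rw [bonus, hC, Real.sqrt_div (by positivity)]; ring

theorem bonus_anti (hC : I.C₀ = 4) (hι : 0 ≤ iota S A H I.K) {i n : ℕ} (hi : 1 ≤ i) (hin : i ≤ n) :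
    bonus I n ≤ bonus I i := by
  rw [bonus_eq hC hι, bonus_eq hC hι]
  have hi0 : 0 < √(i : ℝ) := Real.sqrt_pos.2 (by exact_mod_cast hi)
  have : (i : ℝ) ≤ n := by exact_mod_cast hin
  gcongr

theorem bonus_le_wsum (hC : I.C₀ = 4) (hι : 0 ≤ iota S A H I.K) {n : ℕ} (hn : 1 ≤ n) :
    bonus I n ≤ wsum H n (bonus I) :=
  le_wsum hn fun _ h1 h2 => bonus_anti hC hι h1 h2

theorem beta_eq (n : ℕ) : beta I n = 2 * wsum H n (bonus I) := rfl

theorem beta_le (hC : I.C₀ = 4) (hι : 0 ≤ iota S A H I.K) {n : ℕ} (hn : 1 ≤ n) :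
    beta I n ≤ 16 * √((H : ℝ) ^ 3 * iota S A H I.K) / √(n : ℝ) := by
  rw [beta_eq, wsum_congr fun i _ _ => bonus_eq hC hι i, wsum_const_mul]
  have h := mul_le_mul_of_nonneg_left (wsum_inv_sqrt_le (H := H) hn)
    (show 0 ≤ 8 * √((H : ℝ) ^ 3 * iota S A H I.K) by positivity)
  refine le_trans (le_of_eq ?_) (h.trans (le_of_eq ?_)) <;> ring

theorem beta_zero : beta I 0 = 0 := by
  rw [beta_eq, wsum_zero, mul_zero]

end Bonus

section GoodRun

variable {S A : Type*} {H : ℕ} [Fintype S] [DecidableEq S] [Fintype A] [DecidableEq A] [Nonempty A]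

/-- A run of the algorithm in which the good event holds. -/
structure GoodRun (M : MDP S A H) (I : Input S A H) (w : ℕ → Fin (H + 1) → S) : Prop where
  pos : 0 < H
  C₀_eq : I.C₀ = 4
  C₁_eq : I.C₁ = 1
  R_nonneg : 0 ≤ I.R
  iota_nonneg : 0 ≤ iota S A H I.K
  card : Fintype.card A ≠ 1
  argmax : IsArgmax I.argmax
  good : Good M I w

variable {M : MDP S A H} {I : Input S A H} {w : ℕ → Fin (H + 1) → S}

theorem valueAt_mono {U V : Fin H → S → ℝ} {x : Fin (H + 1) → S} {j : ℕ}
    (h : ∀ hj : j < H, U ⟨j, hj⟩ (x (Fin.castSucc ⟨j, hj⟩)) ≤ V ⟨j, hj⟩ (x (Fin.castSucc ⟨j, hj⟩))) :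
    valueAt U x j ≤ valueAt V x j := by
  rw [valueAt, valueAt]
  split_ifs with hj
  · exact h hj
  · exact le_rfl

theorem mem_G_update {st : State S A H} {x : Fin (H + 1) → S} {a : Fin H → A} {rew : Fin H → ℝ}
    (hv : Valid M st) (hv' : Valid M (update I st x a rew)) {h : Fin H} {y : S}
    (hy : y ∈ st.G h) : y ∈ (update I st x a rew).G h := by
  rw [hv'.mem_G]
  refine le_antisymm ?_ (Finset.card_pos.2 (hv'.act_nonempty h y))
  rw [← (hv.mem_G h y).1 hy]
  exact Finset.card_le_card (Finset.filter_subset _ _)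

theorem G_mono {m : ℕ} (hv : ∀ j ≤ m, Valid M (run M I w j)) {i j : ℕ} (hij : i ≤ j) (hj : j ≤ m)
    {h : Fin H} {y : S} (hy : y ∈ (run M I w i).G h) : y ∈ (run M I w j).G h := by
  induction j, hij using Nat.le_induction with
  | base => exact hy
  | succ j hij ih =>
    exact mem_G_update (hv j (by omega)) (hv (j + 1) hj) (ih (by omega))

/-- Strong induction: validity in all earlier episodes makes their policies sound. Their multi-step
returns are then Q* plus `segError`, and the good event bounds the averaged error by the bonus. -/
theorem GoodRun.valid_consistent (hg : GoodRun M I w) :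
    ∀ k ≤ I.K, Valid M (run M I w k) ∧ Consistent M (run M I w k) := by
  intro k
  induction k using Nat.strong_induction_on with
  | _ k ih =>
  intro hk
  rcases k with _ | k
  · exact ⟨valid_initState hg.card, consistent_initState⟩
  have hv : ∀ j ≤ k, Valid M (run M I w j) := fun j hj => (ih j (by omega) (by omega)).1
  -- Determined states stay determined, so a state that is undetermined now was so at all earlier
  -- visits, and the explicit averages apply.
  have hnot : ∀ {h : Fin H} {y : S}, y ∉ (run M I w k).G h → ∀ {b : A}, ∀ j < k + 1,
      Visited M I h y b w j → y ∉ (run M I w j).G h := fun hy _ j hj _ hy' =>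
    hy (G_mono hv (by omega) le_rfl hy')
  have hseg : ∀ (h : Fin H) (y : S) (b : A) (i : ℕ), 1 ≤ i → i ≤ visits M I w h y b (k + 1) →
      segReward (rewAt M I w (visitAt M I w h y b i)) h (bootAt M I w (visitAt M I w h y b i) h) +
        valueAt (fun h => M.Vstar h) (w (visitAt M I w h y b i))
          (bootAt M I w (visitAt M I w h y b i) h) =
        M.Qstar h y b + segError M I h w (visitAt M I w h y b i) := by
    intro h y b i h1 h2
    obtain ⟨hlt, hvis⟩ := visitAt_spec h1 h2
    have := segReturn_eq M I ((hv _ (Nat.lt_succ_iff.1 hlt)).sound hg.argmax) h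
    rw [← hvis.1, ← hvis.2] at this
    exact this
  have hn1 : ∀ {h : Fin H} {y : S} {b : A}, Visited M I h y b w k →
      1 ≤ visits M I w h y b (k + 1) := fun hvis => by
    rw [visits, Nat.count_succ, if_pos hvis]; omega
  have hup : ∀ h y b, M.Qstar h y b ≤
      nextqup I (run M I w k) (w k) (actAt M I w k) (rewAt M I w k) h y b := by
    intro h y b
    by_cases hl : Learned (run M I w k) (w k) (actAt M I w k) h y b
    · have hn := hn1 hl.1
      have e := qup_run (k := k + 1) (b := b) (hnot hl.2)
      change nextqup I (run M I w k) (w k) (actAt M I w k) (rewAt M I w k) h y b = _ at e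
      rw [e, alphaZero, if_neg (by omega), zero_mul, zero_add]
      have hgood := (hg.good h y b _ hn (visits_mono h y b hk)).1
      have hb := bonus_le_wsum (I := I) hg.C₀_eq hg.iota_nonneg hn
      have key : wsum H (visits M I w h y b (k + 1)) (fun i =>
          (M.Qstar h y b + segError M I h w (visitAt M I w h y b i)) + bonus I i) ≤
          wsum H (visits M I w h y b (k + 1)) (fun i =>
        segReward (rewAt M I w (visitAt M I w h y b i)) h (bootAt M I w (visitAt M I w h y b i) h) +
        valueAt (run M I w (visitAt M I w h y b i)).Vup (w (visitAt M I w h y b i))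
          (bootAt M I w (visitAt M I w h y b i) h) + bonus I i) := by
        refine wsum_mono fun i h1 h2 => ?_
        rw [← hseg h y b i h1 h2]
        gcongr
        refine valueAt_mono fun hj => ?_
        exact (hv _ (Nat.lt_succ_iff.1 (visitAt_spec h1 h2).1)).le_Vup _ _
      refine le_trans ?_ key
      rw [wsum_add, wsum_add, wsum_const hn]
      have := (abs_le.1 hgood).1
      linarith
    · rw [nextqup_of_not_learned hl]
      exact (hv k le_rfl).le_qup h y b
  have hlo : ∀ h y b, nextqlo I (run M I w k) (w k) (actAt M I w k) (rewAt M I w k) h y b ≤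
      M.Qstar h y b := by
    intro h y b
    by_cases hl : Learned (run M I w k) (w k) (actAt M I w k) h y b
    · have hn := hn1 hl.1
      have e := qlo_run (k := k + 1) (b := b) (hnot hl.2)
      change nextqlo I (run M I w k) (w k) (actAt M I w k) (rewAt M I w k) h y b = _ at e
      rw [e]
      have hgood := (hg.good h y b _ hn (visits_mono h y b hk)).1
      have hb := bonus_le_wsum (I := I) hg.C₀_eq hg.iota_nonneg hn
      have key : wsum H (visits M I w h y b (k + 1)) (fun i =>
        segReward (rewAt M I w (visitAt M I w h y b i)) h (bootAt M I w (visitAt M I w h y b i) h) +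
        valueAt (run M I w (visitAt M I w h y b i)).Vlo (w (visitAt M I w h y b i))
          (bootAt M I w (visitAt M I w h y b i) h) - bonus I i) ≤
          wsum H (visits M I w h y b (k + 1)) (fun i =>
          (M.Qstar h y b + segError M I h w (visitAt M I w h y b i)) - bonus I i) := by
        refine wsum_mono fun i h1 h2 => ?_
        rw [← hseg h y b i h1 h2]
        gcongr
        refine valueAt_mono fun hj => ?_
        exact (hv _ (Nat.lt_succ_iff.1 (visitAt_spec h1 h2).1)).Vlo_le _ _
      refine key.trans ?_
      rw [wsum_sub, wsum_add, wsum_const hn]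
      have := (abs_le.1 hgood).2
      linarith
    · rw [nextqlo_of_not_learned hl]
      exact (hv k le_rfl).qlo_le h y b
  have hv' : Valid M (run M I w (k + 1)) := (hv k le_rfl).update hup hlo
  exact ⟨hv', (ih k (by omega) (by omega)).2.update (hv k le_rfl) hv'⟩

theorem GoodRun.valid (hg : GoodRun M I w) {k : ℕ} (hk : k ≤ I.K) : Valid M (run M I w k) :=
  (hg.valid_consistent k hk).1

theorem GoodRun.consistent (hg : GoodRun M I w) {k : ℕ} (hk : k ≤ I.K) :
    Consistent M (run M I w k) := (hg.valid_consistent k hk).2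

theorem GoodRun.notMem_G (hg : GoodRun M I w) {j k : ℕ} (hjk : j ≤ k) (hk : k ≤ I.K) {h : Fin H}
    {y : S} (hy : y ∉ (run M I w k).G h) : y ∉ (run M I w j).G h := fun hy' =>
  hy (G_mono (fun _ hj => hg.valid hj) hjk hk hy')

/-! ### Range functions -/

/-- The range of the value at the bootstrap state of step `h` of episode `k`. -/
def bootRan (M : MDP S A H) (I : Input S A H) (w : ℕ → Fin (H + 1) → S) (k : ℕ) (h : Fin H) : ℝ :=
  valueAt (run M I w k).ranV (w k) (bootAt M I w k h)

theorem GoodRun.ranQ_succ (hg : GoodRun M I w) {k : ℕ} (hk : k + 1 ≤ I.K) {h : Fin H} {y : S}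
    (hy : y ∉ (run M I w (k + 1)).G h) (b : A) :
    (run M I w (k + 1)).ranQ h y b = min ((run M I w k).ranQ h y b)
      (alphaZero (visits M I w h y b (k + 1)) * H + beta I (visits M I w h y b (k + 1)) +
        wsum H (visits M I w h y b (k + 1)) fun i =>
          bootRan M I w (visitAt M I w h y b i) h) := by
  have e : nextN (run M I w k) (w k) (actAt M I w k) h y b = visits M I w h y b (k + 1) :=
    N_run M I w h y b (k + 1)
  change nextRanQ I (run M I w k) (w k) (actAt M I w k) h y b = _
  simp only [nextRanQ, e]
  congr 2
  refine Finset.sum_congr rfl fun i hi => ?_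
  congr 1
  exact ranTargets_getD (k := k + 1) (fun j hj _ => hg.notMem_G hj.le hk hy)
    (Finset.mem_Icc.1 hi).1 (Finset.mem_Icc.1 hi).2

theorem ranV_succ_le (k : ℕ) (h : Fin H) (y : S) :
    (run M I w (k + 1)).ranV h y ≤ (run M I w (k + 1)).ranQ h y
      (I.argmax ((run M I w (k + 1)).act h y)
        fun b => (run M I w (k + 1)).Qup h y b - (run M I w (k + 1)).Qlo h y b) :=
  min_le_right _ _

theorem ranV_le_horizon (k : ℕ) (h : Fin H) (y : S) : (run M I w k).ranV h y ≤ H := by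
  induction k with
  | zero => exact le_rfl
  | succ k ih => exact (min_le_left _ _).trans ih

/-- The width of the averaged estimates satisfies the same recursion as the range, with twice the
averaged bonus equal to `beta`. The minima with earlier values are harmless because widths only
shrink. -/
theorem GoodRun.range_le (hg : GoodRun M I w) : ∀ k ≤ I.K,
    (∀ h y, y ∉ (run M I w k).G h → ∀ b,
      (run M I w k).Qup h y b - (run M I w k).Qlo h y b ≤ (run M I w k).ranQ h y b) ∧
    (∀ h y, y ∉ (run M I w k).G h → ∀ b ∈ (run M I w k).act h y,
      (run M I w k).Qup h y b - (run M I w k).Qlo h y b ≤ (run M I w k).ranV h y) := by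
  intro k
  induction k using Nat.strong_induction_on with
  | _ k ih =>
  intro hk
  rcases k with _ | k
  · constructor
    · intro h y _ b; simp [run, initState]
    · intro h y _ b _; simp [run, initState]
  -- The maximizer of the upper estimates alone bounds the width of the value; it is active, so the
  -- range of the bootstrap state applies to it.
  have hboot : ∀ j < k + 1, ∀ h : Fin H, valueAt (run M I w j).Vup (w j) (bootAt M I w j h) -
      valueAt (run M I w j).Vlo (w j) (bootAt M I w j h) ≤ bootRan M I w j h := by
    intro j hj h
    rw [bootRan, valueAt, valueAt, valueAt]
    split_ifs with hb
    · have hx := notMem_bootStep (G := (run M I w j).G) (x := w j) (h := h) hb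
      have hc := hg.consistent (k := j) (by omega)
      obtain ⟨b, hb1, hb2⟩ := hc.exists_Vup_le ⟨bootAt M I w j h, hb⟩
        (w j (Fin.castSucc ⟨bootAt M I w j h, hb⟩))
      have h1 := hc.Qlo_le_Vlo _ _ b hb1
      have h2 := (ih j hj (by omega)).2 ⟨bootAt M I w j h, hb⟩
        (w j (Fin.castSucc ⟨bootAt M I w j h, hb⟩)) hx b hb1
      exact le_trans (by linarith) h2
    · simp
  have hQ : ∀ h y, y ∉ (run M I w (k + 1)).G h → ∀ b,
      (run M I w (k + 1)).Qup h y b - (run M I w (k + 1)).Qlo h y b ≤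
        (run M I w (k + 1)).ranQ h y b := by
    intro h y hy b
    have hy' := fun j (hj : j < k + 1) => hg.notMem_G hj.le hk hy
    have hc := hg.consistent hk
    rw [hg.ranQ_succ hk hy b]
    refine le_min ?_ ?_
    · have h1 : (run M I w (k + 1)).Qup h y b ≤ (run M I w k).Qup h y b := min_le_left _ _
      have h2 : (run M I w k).Qlo h y b ≤ (run M I w (k + 1)).Qlo h y b := le_max_left _ _
      have h3 := (ih k (by omega) (by omega)).1 h y (hy' k (by omega)) b
      linarith
    · have h1 := hc.Qup_le_qup h y b
      have h2 := hc.qlo_le_Qlo h y b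
      rw [qup_run fun j hj _ => hy' j hj] at h1
      rw [qlo_run fun j hj _ => hy' j hj] at h2
      have h3 : wsum H (visits M I w h y b (k + 1)) (fun i =>
          valueAt (run M I w (visitAt M I w h y b i)).Vup (w (visitAt M I w h y b i))
            (bootAt M I w (visitAt M I w h y b i) h) -
          valueAt (run M I w (visitAt M I w h y b i)).Vlo (w (visitAt M I w h y b i))
            (bootAt M I w (visitAt M I w h y b i) h)) ≤
          wsum H (visits M I w h y b (k + 1)) fun i =>
            bootRan M I w (visitAt M I w h y b i) h :=
        wsum_mono fun i h1 h2 => hboot _ (visitAt_spec h1 h2).1 h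
      rw [wsum_add, wsum_add] at h1
      rw [wsum_sub, wsum_add] at h2
      rw [wsum_sub] at h3
      have h4 := beta_eq (I := I) (visits M I w h y b (k + 1))
      have e : wsum H (visits M I w h y b (k + 1)) (fun i => bonus I i) =
        wsum H (visits M I w h y b (k + 1)) (bonus I) := rfl
      linarith
  refine ⟨hQ, fun h y hy b hb => ?_⟩
  have hy' := hg.notMem_G (Nat.le_succ k) hk hy
  have h1 : (run M I w (k + 1)).Qup h y b ≤ (run M I w k).Qup h y b := min_le_left _ _
  have h2 : (run M I w k).Qlo h y b ≤ (run M I w (k + 1)).Qlo h y b := le_max_left _ _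
  have h3 := (ih k (by omega) (by omega)).2 h y hy' b (Finset.mem_filter.1 hb).1
  have hne := (hg.valid hk).act_nonempty h y
  have h4 := (hg.argmax _ (fun b => (run M I w (k + 1)).Qup h y b -
    (run M I w (k + 1)).Qlo h y b) hne).2 b hb
  refine le_min (by linarith) (h4.trans (hQ h y hy _))

theorem GoodRun.ranV_nonneg (hg : GoodRun M I w) {k : ℕ} (hk : k ≤ I.K) {h : Fin H} {y : S}
    (hy : y ∉ (run M I w k).G h) : 0 ≤ (run M I w k).ranV h y := by
  obtain ⟨b, hb⟩ := (hg.valid hk).act_nonempty h y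
  have h1 := (hg.range_le k hk).2 h y hy b hb
  have h2 := (hg.valid hk).Qlo_le h y b
  have h3 := (hg.valid hk).le_Qup h y b
  linarith

theorem GoodRun.Qup_le (hg : GoodRun M I w) {k : ℕ} (hk : k ≤ I.K) {h : Fin H} {y : S}
    (hy : y ∉ (run M I w k).G h) {b : A} (hb : b ∈ (run M I w k).act h y) :
    (run M I w k).Qup h y b ≤ M.Vstar h y + (run M I w k).ranV h y := by
  have h1 := (hg.range_le k hk).2 h y hy b hb
  have h2 := (hg.valid hk).Qlo_le h y b
  have h3 := M.Qstar_le_Vstar h y b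
  linarith

/-- The gap of an active action is controlled by the range. -/
theorem GoodRun.gap_le (hg : GoodRun M I w) {k : ℕ} (hk : k ≤ I.K) {h : Fin H} {y : S}
    (hy : y ∉ (run M I w k).G h) {b : A} (hb : b ∈ (run M I w k).act h y) :
    M.gap h y b ≤ 2 * (run M I w k).ranV h y := by
  have hv := hg.valid hk
  have hc := hg.consistent hk
  -- The optimal `o` is active: its upper estimate exceeds its lower one by at most the range. That
  -- lower estimate is at most the upper one of `b`, or `b` would have been eliminated. The range of
  -- `b` is used once more.
  obtain ⟨o, ho⟩ := M.exists_gap_eq_zero h y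
  have hom := hv.opt_mem h y o ho
  have h1 := (hg.range_le k hk).2 h y hy b hb
  have h2 := (hg.range_le k hk).2 h y hy o hom
  have h3 := hv.le_Qup h y o
  have h4 := hc.Qlo_le_Vlo h y o hom
  have h5 := hc.Vlo_le_Qup h y b hb
  have h6 := hv.Qlo_le h y b
  rw [MDP.gap] at ho ⊢
  linarith

/-! ### Exploration -/

/-- In step `h` of episode `k` the learner maximizes the confidence range. -/
def Explores (M : MDP S A H) (I : Input S A H) (w : ℕ → Fin (H + 1) → S) (k : ℕ) (h : Fin H) :
    Prop :=
  w k h.castSucc ∉ (run M I w k).G h ∧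
    ¬ (run M I w k).ranV h (w k h.castSucc) ≤ scaled I h (run M I w k).Dhat

/-- The range of the value at the state of step `h` of episode `k`. -/
def ranAt (M : MDP S A H) (I : Input S A H) (w : ℕ → Fin (H + 1) → S) (k : ℕ) (h : Fin H) : ℝ :=
  (run M I w k).ranV h (w k h.castSucc)

/-- The number of earlier visits to the state and action of step `h` of episode `k`. -/
def visitsAt (M : MDP S A H) (I : Input S A H) (w : ℕ → Fin (H + 1) → S) (k : ℕ) (h : Fin H) : ℕ :=
  visits M I w h (w k h.castSucc) (actAt M I w k h) k

/-- The weighted average of `u` over the earlier visits to the state and action of step `h` of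
episode `k`. -/
def pastAvg (M : MDP S A H) (I : Input S A H) (w : ℕ → Fin (H + 1) → S) (k : ℕ) (h : Fin H)
    (u : ℕ → ℝ) : ℝ :=
  wsum H (visitsAt M I w k h) fun i => u (visitAt M I w h (w k h.castSucc) (actAt M I w k h) i)

theorem GoodRun.actAt_mem (hg : GoodRun M I w) {k : ℕ} (hk : k ≤ I.K) (h : Fin H) :
    actAt M I w k h ∈ (run M I w k).act h (w k h.castSucc) :=
  choosePolicy_mem hg.argmax (hg.valid hk) h _

theorem GoodRun.actAt_of_explores (hg : GoodRun M I w) {k : ℕ} (hk : k ≤ I.K) {h : Fin H}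
    (he : Explores M I w k h) :
    actAt M I w k h = I.argmax ((run M I w k).act h (w k h.castSucc)) fun b =>
      (run M I w k).Qup h (w k h.castSucc) b - (run M I w k).Qlo h (w k h.castSucc) b := by
  rw [actAt, pol, choosePolicy, if_neg fun hc => he.1 (((hg.valid hk).mem_G _ _).2 hc),
    if_neg he.2]

/-- The exploring action is the same maximizer that the last update used to define the range of the
state, so the recursion for `ranQ` applies to the action actually played. -/
theorem GoodRun.ranAt_le_of_explores (hg : GoodRun M I w) {k : ℕ} (hk : k ≤ I.K) {h : Fin H}
    (he : Explores M I w k h) :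
    ranAt M I w k h ≤ alphaZero (visitsAt M I w k h) * H + beta I (visitsAt M I w k h) +
      pastAvg M I w k h fun j => bootRan M I w j h := by
  have ha := hg.actAt_of_explores hk he
  rcases k with _ | k
  · have : visitsAt M I w 0 h = 0 := by simp [visitsAt]
    rw [pastAvg, this, beta_zero, wsum_zero, alphaZero, if_pos rfl]
    have := ranV_le_horizon (M := M) (I := I) (w := w) 0 h (w 0 h.castSucc)
    simpa [ranAt] using this
  · have h1 := ranV_succ_le (M := M) (I := I) (w := w) k h (w (k + 1) h.castSucc)
    rw [← ha, hg.ranQ_succ hk he.1] at h1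
    exact h1.trans (min_le_right _ _)

/-- The sum of past averages along the episodes. -/
theorem sum_pastAvg_le (hH : 0 < H) (h : Fin H) {u : ℕ → ℝ} (hu : ∀ k, 0 ≤ u k) (K : ℕ) :
    ∑ k ∈ Finset.range K, pastAvg M I w k h u ≤
      (1 + 1 / (H : ℝ)) * ∑ k ∈ Finset.range K, u k :=
  sum_wsum_visits_le (fun k => (w k h.castSucc, actAt M I w k h))
    (fun z : S × A => Visited M I h z.1 z.2 w)
    (fun z k => by rw [Visited, Prod.ext_iff]) hH hu K

theorem sum_visitsAt (h : Fin H) (F : S → A → ℕ → ℝ) (K : ℕ) :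
    ∑ k ∈ Finset.range K, F (w k h.castSucc) (actAt M I w k h) (visitsAt M I w k h) =
      ∑ z : S × A, ∑ i ∈ Finset.range (visits M I w h z.1 z.2 K), F z.1 z.2 i :=
  sum_group (fun k => (w k h.castSucc, actAt M I w k h))
    (fun z : S × A => Visited M I h z.1 z.2 w)
    (fun z k => by rw [Visited, Prod.ext_iff]) (fun z n _ => F z.1 z.2 n) K

theorem sum_visits_eq (h : Fin H) (K : ℕ) :
    ∑ z : S × A, visits M I w h z.1 z.2 K = K :=
  sum_count (fun k => (w k h.castSucc, actAt M I w k h))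
    (fun z : S × A => Visited M I h z.1 z.2 w)
    (fun z k => by rw [Visited, Prod.ext_iff]) K

end GoodRun
end
end QLP

namespace QLP
noncomputable section

/-! ### Numerical facts about `(1 + 1/H)^H` -/

section Growth

variable {H : ℕ}

/-- The growth factor `1 + 1/H`. -/
def growth (H : ℕ) : ℝ := 1 + 1 / (H : ℝ)

theorem one_le_growth : 1 ≤ growth H := by
  rw [growth]
  have : 0 ≤ 1 / (H : ℝ) := by positivity
  linarith

theorem growth_pos : 0 < growth H := lt_of_lt_of_le one_pos one_le_growth

theorem growth_le_two (hH : 0 < H) : growth H ≤ 2 := by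
  have : 1 / (H : ℝ) ≤ 1 := by
    rw [div_le_one (by exact_mod_cast hH)]; exact_mod_cast hH
  rw [growth]; linarith

theorem growth_pow_le (hH : 0 < H) (m : ℕ) : growth H ^ (m * H) ≤ (2.7182818286 : ℝ) ^ m := by
  have h0 : (0 : ℝ) < H := by exact_mod_cast hH
  have h1 : growth H ≤ Real.exp (1 / H) := by
    rw [growth, add_comm]; exact Real.add_one_le_exp _
  calc growth H ^ (m * H) ≤ Real.exp (1 / H) ^ (m * H) :=
        pow_le_pow_left₀ growth_pos.le h1 _
    _ = Real.exp 1 ^ m := by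
        rw [← Real.exp_nat_mul, ← Real.exp_nat_mul]
        congr 1
        push_cast
        field_simp
    _ ≤ _ := pow_le_pow_left₀ (Real.exp_pos _).le Real.exp_one_lt_d9.le _

theorem growth_pow_four_le (hH : 0 < H) {m : ℕ} (hm : m ≤ H) : growth H ^ (4 * m) ≤ 64 :=
  (pow_le_pow_right₀ one_le_growth (by omega)).trans
    ((growth_pow_le hH 4).trans (by norm_num))

/-- A linear recursion over the steps of an episode. -/
theorem layer_bound {s : ℕ → ℝ} {B : Fin H → ℝ} {q : ℝ} (hq : 1 ≤ q) (hB : ∀ h, 0 ≤ B h)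
    (hs : ∀ h : Fin H, s h ≤ B h + q * s (h + 1)) (hsH : s H = 0) {j : ℕ} (hj : j ≤ H) :
    s j ≤ q ^ H * ∑ h, B h := by
  have key : ∀ n j, H - j = n → j ≤ H →
      s j ≤ q ^ n * ∑ h ∈ Finset.univ.filter (fun h : Fin H => j ≤ h), B h := by
    intro n
    induction n with
    | zero =>
      intro j h1 h2
      obtain rfl : j = H := by omega
      rw [hsH]
      exact mul_nonneg (by positivity) (Finset.sum_nonneg fun h _ => hB h)
    | succ n ih =>
      intro j h1 h2
      have hjH : j < H := by omega
      have h3 := ih (j + 1) (by omega) (by omega)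
      have h4 := hs ⟨j, hjH⟩
      simp only at h4
      have e : Finset.univ.filter (fun h : Fin H => j ≤ h) =
          insert ⟨j, hjH⟩ (Finset.univ.filter fun h : Fin H => j + 1 ≤ h) := by
        ext i
        simp only [Finset.mem_filter, Finset.mem_univ, true_and, Finset.mem_insert, Fin.ext_iff]
        omega
      rw [e, Finset.sum_insert (by simp)]
      have h5 : B ⟨j, hjH⟩ ≤ q ^ (n + 1) * B ⟨j, hjH⟩ :=
        le_mul_of_one_le_left (hB _) (one_le_pow₀ hq)
      have h6 := mul_le_mul_of_nonneg_left h3 (zero_le_one.trans hq)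
      calc s j ≤ B ⟨j, hjH⟩ + q * s (j + 1) := h4
        _ ≤ _ := by rw [mul_add, pow_succ]; rw [pow_succ] at h5; linarith
  refine (key _ j rfl hj).trans ?_
  have h1 : 0 ≤ ∑ h ∈ Finset.univ.filter (fun h : Fin H => j ≤ h), B h :=
    Finset.sum_nonneg fun h _ => hB h
  have h2 : ∑ h ∈ Finset.univ.filter (fun h : Fin H => j ≤ h), B h ≤ ∑ h, B h :=
    Finset.sum_le_sum_of_subset_of_nonneg (Finset.filter_subset _ _) fun h _ _ => hB h
  exact mul_le_mul (pow_le_pow_right₀ hq (by omega)) h2 h1 (by positivity)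

end Growth

/-! ### Total range of the exploration steps -/

section Exploration

variable {S A : Type*} {H : ℕ} [Fintype S] [DecidableEq S] [Fintype A] [DecidableEq A] [Nonempty A]
variable (M : MDP S A H) (I : Input S A H) (w : ℕ → Fin (H + 1) → S) (τ : ℝ)

/-- Range thresholds which decrease along an episode. -/
def threshold (H : ℕ) (τ : ℝ) (j : ℕ) : ℝ := τ * growth H ^ (4 * (H - j))

open Classical in
/-- The excess of the range over the threshold in an exploration step. -/
def excess (k : ℕ) (h : Fin H) : ℝ :=
  if Explores M I w k h then max (ranAt M I w k h - threshold H τ h / growth H ^ 2) 0 else 0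

/-- The excess at the first undetermined state from step `j` on. -/
def excessFrom (k : ℕ) (j : ℕ) : ℝ :=
  if hj : j < H then
    if w k (Fin.castSucc ⟨j, hj⟩) ∉ (run M I w k).G ⟨j, hj⟩ then excess M I w τ k ⟨j, hj⟩
    else excessFrom k (j + 1)
  else 0
termination_by H - j

variable {M I w τ}

theorem excess_nonneg (k : ℕ) (h : Fin H) : 0 ≤ excess M I w τ k h := by
  rw [excess]
  split_ifs
  · exact le_max_right _ _
  · exact le_rfl

theorem excessFrom_end (k : ℕ) : excessFrom M I w τ k H = 0 := by
  rw [excessFrom, dif_neg (lt_irrefl _)]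

theorem excessFrom_of_notMem {k : ℕ} {h : Fin H} (hx : w k h.castSucc ∉ (run M I w k).G h) :
    excessFrom M I w τ k h = excess M I w τ k h := by
  rw [excessFrom, dif_pos h.isLt, if_pos hx]

theorem excessFrom_of_mem {k : ℕ} {h : Fin H} (hx : w k h.castSucc ∈ (run M I w k).G h) :
    excessFrom M I w τ k h = excessFrom M I w τ k (h + 1) := by
  rw [excessFrom, dif_pos h.isLt, if_neg (not_not.2 hx)]

theorem excessFrom_nonneg (k : ℕ) (j : ℕ) : 0 ≤ excessFrom M I w τ k j := by
  have key : ∀ n j, H - j = n → 0 ≤ excessFrom M I w τ k j := by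
    intro n
    induction n with
    | zero => intro j hj; rw [excessFrom, dif_neg (by omega)]
    | succ n ih =>
      intro j hj
      rw [excessFrom]
      split_ifs
      · exact ih _ (by omega)
      · exact excess_nonneg _ _
      · exact le_rfl
  exact key _ j rfl

theorem excess_le_excessFrom (k : ℕ) (h : Fin H) :
    excess M I w τ k h ≤ excessFrom M I w τ k h := by
  by_cases hx : w k h.castSucc ∈ (run M I w k).G h
  · rw [excess, if_neg fun he => he.1 hx]
    exact excessFrom_nonneg _ _
  · rw [excessFrom_of_notMem hx]

variable (hg : GoodRun M I w) (hτ0 : 0 < τ) (hτ : I.R / (I.K * H) ≤ τ)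

theorem threshold_nonneg (hτ : 0 ≤ τ) (j : ℕ) : 0 ≤ threshold H τ j :=
  mul_nonneg hτ (pow_nonneg growth_pos.le _)

theorem threshold_anti (hτ : 0 ≤ τ) {i j : ℕ} (hij : i ≤ j) :
    threshold H τ j ≤ threshold H τ i :=
  mul_le_mul_of_nonneg_left (pow_le_pow_right₀ one_le_growth (by omega)) hτ

include hg hτ0 hτ

theorem scaled_le (k : ℕ) (h : Fin H) :
    scaled I h (run M I w k).Dhat ≤ threshold H τ h := by
  have hD : (run M I w k).Dhat ≤ τ := by
    rcases k with _ | k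
    · exact hτ0.le
    · exact hτ
  rw [scaled, hg.C₁_eq, one_mul, threshold, mul_comm τ]
  exact mul_le_mul_of_nonneg_left hD (pow_nonneg growth_pos.le _)

theorem ranAt_le_excess {k : ℕ} {h : Fin H} (hx : w k h.castSucc ∉ (run M I w k).G h) :
    ranAt M I w k h ≤ excess M I w τ k h + threshold H τ h := by
  by_cases he : Explores M I w k h
  · have h0 := threshold_nonneg (H := H) hτ0.le h
    have h1 : threshold H τ h / growth H ^ 2 ≤ threshold H τ h :=
      div_le_self h0 (one_le_pow₀ one_le_growth)
    rw [excess, if_pos he]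
    have := le_max_left (ranAt M I w k h - threshold H τ h / growth H ^ 2) 0
    linarith
  · rw [excess, if_neg he, zero_add]
    have : (run M I w k).ranV h (w k h.castSucc) ≤ scaled I h (run M I w k).Dhat := by
      by_contra hc
      exact he ⟨hx, hc⟩
    exact this.trans (scaled_le hg hτ0 hτ k h)

/-- Moving back from the bootstrap step through determined states leaves `excessFrom` unchanged and
only increases the threshold. -/
theorem bootRan_le (k : ℕ) (h : Fin H) :
    bootRan M I w k h ≤ excessFrom M I w τ k (h + 1) + threshold H τ (h + 1) := by
  have hbH : bootAt M I w k h ≤ H := bootStep_le _ _ _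
  have key : ∀ n i, bootAt M I w k h - i = n → (h : ℕ) + 1 ≤ i → i ≤ bootAt M I w k h →
      bootRan M I w k h ≤ excessFrom M I w τ k i + threshold H τ i := by
    intro n
    induction n with
    | zero =>
      intro i h1 h2 h3
      obtain rfl : i = bootAt M I w k h := by omega
      by_cases hb : bootAt M I w k h < H
      · rw [bootRan, valueAt, dif_pos hb]
        have hx : w k (Fin.castSucc ⟨bootAt M I w k h, hb⟩) ∉
          (run M I w k).G ⟨bootAt M I w k h, hb⟩ := notMem_bootStep hb
        have e := excessFrom_of_notMem (τ := τ) hx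
        have h4 := ranAt_le_excess hg hτ0 hτ hx
        simp only at e h4
        rw [e]
        exact h4
      · rw [bootRan, valueAt, dif_neg hb]
        exact add_nonneg (excessFrom_nonneg _ _) (threshold_nonneg hτ0.le _)
    | succ n ih =>
      intro i h1 h2 h3
      have hi : i < bootAt M I w k h := by omega
      have hx : w k (Fin.castSucc ⟨i, by omega⟩) ∈ (run M I w k).G ⟨i, by omega⟩ :=
        mem_of_lt_bootStep (h := h) (Fin.lt_def.2 (by simp only; omega)) hi
      have e := excessFrom_of_mem (τ := τ) hx
      simp only at e
      rw [e]
      have h4 := ih (i + 1) (by omega) (by omega) (by omega)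
      have h5 := threshold_anti (H := H) hτ0.le (Nat.le_succ i)
      exact h4.trans (by simp only [Nat.succ_eq_add_one] at h5; linarith)
  exact key _ _ rfl le_rfl (bootStep_gt _ _ _)

omit hg hτ0 hτ in
/-- The excess from step `h + 1` on, if the state of step `h` is undetermined. -/
def excessAfter (M : MDP S A H) (I : Input S A H) (w : ℕ → Fin (H + 1) → S) (τ : ℝ)
    (h : Fin H) (j : ℕ) : ℝ :=
  if w j h.castSucc ∉ (run M I w j).G h then excessFrom M I w τ j (h + 1) else 0

omit hg hτ0 hτ in
theorem excessAfter_nonneg (h : Fin H) (j : ℕ) : 0 ≤ excessAfter M I w τ h j := by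
  rw [excessAfter]
  split_ifs
  · exact le_rfl
  · exact excessFrom_nonneg _ _

omit hg hτ0 hτ in
theorem excessAfter_le (h : Fin H) (j : ℕ) :
    excessAfter M I w τ h j ≤ excessFrom M I w τ j (h + 1) := by
  rw [excessAfter]
  split_ifs
  · exact excessFrom_nonneg _ _
  · exact le_rfl

/-- An undetermined state was undetermined at all its earlier visits, so restricting to
`excessAfter` loses nothing there. -/
theorem pastAvg_bootRan_le {k : ℕ} (hk : k ≤ I.K) {h : Fin H}
    (hx : w k h.castSucc ∉ (run M I w k).G h) (hn : 1 ≤ visitsAt M I w k h) :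
    pastAvg M I w k h (fun j => bootRan M I w j h) ≤
      pastAvg M I w k h (excessAfter M I w τ h) + threshold H τ (h + 1) := by
  rw [pastAvg, pastAvg, ← wsum_const hn (threshold H τ (h + 1)), ← wsum_add]
  refine wsum_mono fun i h1 h2 => ?_
  obtain ⟨hlt, hvis⟩ := visitAt_spec h1 h2
  have hx' := hg.notMem_G hlt.le hk hx
  nth_rewrite 2 [hvis.1] at hx'
  rw [excessAfter, if_pos hx']
  have := bootRan_le hg hτ0 hτ
    (visitAt M I w h (w k h.castSucc) (actAt M I w k h) i) h
  exact this

/-- The contribution of a visit number `n` to the exploration bound. -/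
def penalty (I : Input S A H) (δ : ℝ) (n : ℕ) : ℝ := alphaZero n * H + max (beta I n - δ) 0

omit hg hτ0 hτ in
theorem alphaZero_nonneg (n : ℕ) : 0 ≤ alphaZero n := by
  rw [alphaZero]; split_ifs <;> norm_num

omit hg hτ0 hτ in
theorem penalty_nonneg (δ : ℝ) (n : ℕ) : 0 ≤ penalty I δ n :=
  add_nonneg (mul_nonneg (alphaZero_nonneg n) (Nat.cast_nonneg _)) (le_max_right _ _)

omit hg hτ0 hτ in
theorem pastAvg_nonneg {u : ℕ → ℝ} (hu : ∀ j, 0 ≤ u j) (k : ℕ) (h : Fin H) :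
    0 ≤ pastAvg M I w k h u := wsum_nonneg fun _ _ _ => hu _

/-- The core recursion. The slack subtracted from the bonus is what makes the bonuses summable with
an inverse dependence on τ or on the gap. -/
theorem excess_le {k : ℕ} (hk : k ≤ I.K) {h : Fin H} (he : Explores M I w k h) {m : ℝ}
    (hm : m ≤ 2 * ranAt M I w k h) :
    excess M I w τ k h ≤ growth H * (penalty I (max τ (m / 128) / H) (visitsAt M I w k h) +
      pastAvg M I w k h (excessAfter M I w τ h)) := by
  have hH0 : (0 : ℝ) < H := by exact_mod_cast hg.pos
  have hran := hg.ranAt_le_of_explores hk he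
  have hρ := one_le_growth (H := H)
  set U := pastAvg M I w k h (excessAfter M I w τ h) with hU
  have hU0 : 0 ≤ U := pastAvg_nonneg (fun j => excessAfter_nonneg h j) k h
  set n := visitsAt M I w k h with hn
  set g := max τ (m / 128) with hgdef
  set θ := threshold H τ h / growth H ^ 2 with hθ
  have hθ0 : 0 ≤ θ := div_nonneg (threshold_nonneg hτ0.le _) (by positivity)
  have hrhs0 : 0 ≤ penalty I (g / H) n + U := add_nonneg (penalty_nonneg _ _) hU0
  have hrhs : penalty I (g / H) n + U ≤ growth H * (penalty I (g / H) n + U) :=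
    le_mul_of_one_le_left hrhs0 hρ
  rw [excess, if_pos he]
  refine max_le ?_ (hrhs0.trans hrhs)
  rcases Nat.eq_zero_or_pos n with h0 | h1
  · have e1 : ranAt M I w k h ≤ H := ranV_le_horizon k h _
    have e2 : (H : ℝ) ≤ penalty I (g / H) n := by
      rw [penalty, h0, alphaZero, if_pos rfl]
      have := le_max_right (beta I 0 - g / H) 0
      linarith
    linarith
  have hα : alphaZero n = 0 := by rw [alphaZero, if_neg (by omega)]
  have hboot := pastAvg_bootRan_le hg hτ0 hτ hk he.1 h1
  rw [hα, zero_mul, zero_add] at hran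
  have hpen : penalty I (g / H) n = max (beta I n - g / H) 0 := by
    rw [penalty, hα, zero_mul, zero_add]
  have hpen1 := le_max_left (beta I n - g / H) 0
  rw [← hpen] at hpen1
  set t := threshold H τ (h + 1) with ht
  have hth : threshold H τ h = growth H ^ 4 * t := by
    rw [ht, threshold, threshold, show 4 * (H - (h : ℕ)) = 4 * (H - (h + 1)) + 4 by omega,
      pow_add]
    ring
  have hθt : θ = growth H ^ 2 * t := by
    rw [hθ, hth]
    have : growth H ≠ 0 := growth_pos.ne'
    field_simp
  have htτ : τ ≤ t := by
    rw [ht, threshold]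
    exact le_mul_of_one_le_right hτ0.le (one_le_pow₀ hρ)
  -- Of the four factors 1 + 1/H between consecutive thresholds, two are spent in the definition of
  -- `excess` and two leave this room.
  have hdrop : 2 * τ / H ≤ θ - t := by
    have e1 : growth H ^ 2 - 1 = 2 / H + 1 / (H : ℝ) ^ 2 := by
      rw [growth]; field_simp; ring
    have e2 : θ - t = t * (2 / H + 1 / (H : ℝ) ^ 2) := by rw [hθt, ← e1]; ring
    rw [e2]
    calc 2 * τ / H = τ * (2 / H) := by ring
      _ ≤ t * (2 / H + 1 / (H : ℝ) ^ 2) := by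
        refine mul_le_mul htτ ?_ (by positivity) (hτ0.le.trans htτ)
        have : 0 ≤ 1 / (H : ℝ) ^ 2 := by positivity
        linarith
  -- If τ is comparable with `m`, the drop of the thresholds pays for `g / H`. Otherwise the range,
  -- at least m/2, dwarfs the threshold, below m/4, so `g / H` is at most `Y / (2 * H)`, and one
  -- factor 1 + 1/H recovers this loss.
  by_cases hcase : m / 256 ≤ τ
  · have hg2 : g ≤ 2 * τ := max_le (by linarith) (by linarith)
    have : g / H ≤ 2 * τ / H := by gcongr
    linarith
  · push Not at hcase
    have hθ64 : θ ≤ 64 * τ := by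
      refine (div_le_self (threshold_nonneg hτ0.le _) (one_le_pow₀ hρ)).trans ?_
      rw [threshold, mul_comm]
      exact mul_le_mul_of_nonneg_right (growth_pow_four_le hg.pos (Nat.sub_le _ _)) hτ0.le
    set Y := ranAt M I w k h - θ with hY
    have hYm : m / 4 ≤ Y := by linarith
    have hgm : g ≤ m / 8 := max_le (by linarith) (by linarith)
    have h3 : g / H ≤ Y / (2 * H) := by
      rw [div_le_div_iff₀ hH0 (by positivity)]
      nlinarith
    have h4 : Y * (1 - 1 / (2 * H)) ≤ penalty I (g / H) n + U := by
      have : Y * (1 - 1 / (2 * H)) = Y - Y / (2 * H) := by ring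
      rw [this]
      have h5 : 0 ≤ 2 * τ / H := by positivity
      linarith
    have h5 : 1 ≤ growth H * (1 - 1 / (2 * H)) := by
      have hH1 : (1 : ℝ) ≤ H := by exact_mod_cast hg.pos
      have e : growth H * (1 - 1 / (2 * H)) = 1 + (H - 1) / (2 * (H : ℝ) ^ 2) := by
        rw [growth]; field_simp; ring
      rw [e]
      have : 0 ≤ ((H : ℝ) - 1) / (2 * (H : ℝ) ^ 2) := div_nonneg (by linarith) (by positivity)
      linarith
    calc Y ≤ Y * (growth H * (1 - 1 / (2 * H))) :=
          le_mul_of_one_le_right (by linarith) h5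
      _ = growth H * (Y * (1 - 1 / (2 * H))) := by ring
      _ ≤ _ := mul_le_mul_of_nonneg_left h4 growth_pos.le

-- The initial `H` pays for the first visit. The rest is a clipped sum with coefficient 16√(H³ι),
-- and 512 = 2·16².
omit hτ0 hτ in
theorem sum_penalty_le {δ : ℝ} (hδ : 0 < δ) (N : ℕ) :
    ∑ n ∈ Finset.range N, penalty I δ n ≤
      H + 512 * ((H : ℝ) ^ 3 * iota S A H I.K) / δ := by
  have hι := hg.iota_nonneg
  have hmono : ∑ n ∈ Finset.range N, penalty I δ n ≤
      ∑ n ∈ Finset.range (N + 1), penalty I δ n := by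
    rw [Finset.sum_range_succ]
    linarith [penalty_nonneg (I := I) δ N]
  refine hmono.trans ?_
  rw [Finset.sum_range_succ', add_comm]
  have h0 : penalty I δ 0 = H := by
    rw [penalty, alphaZero, if_pos rfl, beta_zero, max_eq_right (by linarith)]; ring
  rw [h0]
  refine add_le_add_right ?_ _
  have h1 : ∑ n ∈ Finset.range N, penalty I δ (n + 1) ≤
      ∑ n ∈ Finset.Icc 1 N, max (16 * √((H : ℝ) ^ 3 * iota S A H I.K) / √(n : ℝ) - δ) 0 := by
    rw [Finset.range_eq_Ico, Finset.sum_Ico_add' (fun n => penalty I δ n) 0 N 1]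
    refine Finset.sum_le_sum fun n hn => ?_
    have hn' := Finset.mem_Ico.1 hn
    rw [penalty, alphaZero, if_neg (by omega), zero_mul, zero_add]
    exact max_le_max (sub_le_sub_right (beta_le hg.C₀_eq hι (by omega)) δ) le_rfl
  refine h1.trans ((sum_clip_le (by positivity) hδ N).trans (le_of_eq ?_))
  rw [mul_pow, Real.sq_sqrt (by positivity)]
  ring

/-- The bound for the total excess, per state, action and step. -/
theorem sum_excessFrom_le {m : Fin H → S → A → ℝ}
    (hm : ∀ k < I.K, ∀ h, Explores M I w k h →
      m h (w k h.castSucc) (actAt M I w k h) ≤ 2 * ranAt M I w k h) {j : ℕ} (hj : j ≤ H) :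
    ∑ k ∈ Finset.range I.K, excessFrom M I w τ k j ≤ 16 * ∑ h : Fin H, ∑ z : S × A,
      (H + 512 * ((H : ℝ) ^ 4 * iota S A H I.K) / max τ (m h z.1 z.2 / 128)) := by
  have hH0 : (0 : ℝ) < H := by exact_mod_cast hg.pos
  have hρ := one_le_growth (H := H)
  have hι := hg.iota_nonneg
  set B : Fin H → ℝ := fun h => ∑ z : S × A,
      (H + 512 * ((H : ℝ) ^ 4 * iota S A H I.K) / max τ (m h z.1 z.2 / 128)) with hB
  have hB0 : ∀ h, 0 ≤ B h := fun h => Finset.sum_nonneg fun z _ => by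
    have : 0 < max τ (m h z.1 z.2 / 128) := lt_max_of_lt_left hτ0
    positivity
  have hpen : ∀ h : Fin H, ∑ k ∈ Finset.range I.K,
      penalty I (max τ (m h (w k h.castSucc) (actAt M I w k h) / 128) / H) (visitsAt M I w k h) ≤
      B h := by
    intro h
    rw [sum_visitsAt h (fun y b n => penalty I (max τ (m h y b / 128) / H) n)]
    refine Finset.sum_le_sum fun z _ => ?_
    have hpos : 0 < max τ (m h z.1 z.2 / 128) := lt_max_of_lt_left hτ0
    refine (sum_penalty_le hg (div_pos hpos hH0) _).trans (le_of_eq ?_)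
    field_simp
  have hrec : ∀ h : Fin H, ∑ k ∈ Finset.range I.K, excessFrom M I w τ k h ≤
      growth H * B h + growth H ^ 2 * ∑ k ∈ Finset.range I.K, excessFrom M I w τ k (h + 1) := by
    intro h
    -- At a determined state the excess passes through with factor 1; at an undetermined one it is
    -- replaced by past averages. Subtracting `excessAfter` keeps these two contributions disjoint,
    -- so the combined factor is (1 + 1/H)² rather than a sum of both.
    have h1 : ∀ k ∈ Finset.range I.K, excessFrom M I w τ k h ≤
        growth H * (penalty I (max τ (m h (w k h.castSucc) (actAt M I w k h) / 128) / H)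
          (visitsAt M I w k h) + pastAvg M I w k h (excessAfter M I w τ h)) +
        (excessFrom M I w τ k (h + 1) - excessAfter M I w τ h k) := by
      intro k hk
      have hk' := Finset.mem_range.1 hk
      have hnn : 0 ≤ growth H *
          (penalty I (max τ (m h (w k h.castSucc) (actAt M I w k h) / 128) / H)
          (visitsAt M I w k h) + pastAvg M I w k h (excessAfter M I w τ h)) :=
        mul_nonneg growth_pos.le (add_nonneg (penalty_nonneg _ _)
          (pastAvg_nonneg (fun j => excessAfter_nonneg h j) k h))
      by_cases hx : w k h.castSucc ∈ (run M I w k).G h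
      · rw [excessFrom_of_mem hx, excessAfter, if_neg (not_not.2 hx)]
        linarith
      · rw [excessFrom_of_notMem hx, excessAfter, if_pos hx, sub_self, add_zero]
        by_cases he : Explores M I w k h
        · exact excess_le hg hτ0 hτ hk'.le he (hm k hk' h he)
        · rw [excess, if_neg he]
          exact hnn
    refine (Finset.sum_le_sum h1).trans ?_
    rw [Finset.sum_add_distrib, ← Finset.mul_sum, Finset.sum_add_distrib, Finset.sum_sub_distrib]
    have h2 := hpen h
    have h3 := sum_pastAvg_le (M := M) (I := I) (w := w) hg.pos h
      (u := excessAfter M I w τ h) (fun j => excessAfter_nonneg h j) I.K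
    rw [← growth] at h3
    have h4 : ∑ k ∈ Finset.range I.K, excessAfter M I w τ h k ≤
      ∑ k ∈ Finset.range I.K, excessFrom M I w τ k (h + 1) :=
      Finset.sum_le_sum fun k _ => excessAfter_le h k
    have h5 := mul_le_mul_of_nonneg_left (add_le_add h2 h3) growth_pos.le (a := growth H)
    have h6 : 0 ≤ growth H ^ 2 - 1 := by
      have := one_le_pow₀ hρ (n := 2)
      linarith
    have h7 := mul_le_mul_of_nonneg_left h4 h6
    linarith
  have hfin := layer_bound (s := fun j => ∑ k ∈ Finset.range I.K, excessFrom M I w τ k j)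
    (one_le_pow₀ hρ (n := 2)) (fun h => mul_nonneg growth_pos.le (hB0 h)) hrec
    (Finset.sum_eq_zero fun k _ => excessFrom_end k) hj
  refine hfin.trans ?_
  rw [← Finset.mul_sum, ← mul_assoc, ← pow_mul]
  refine mul_le_mul_of_nonneg_right ?_ (Finset.sum_nonneg fun h _ => hB0 h)
  have h1 := growth_pow_le hg.pos 2
  have h2 := growth_le_two hg.pos
  -- The recursion costs at most e² over all steps, and the remaining factor is at most 2.
  calc growth H ^ (2 * H) * growth H ≤ (2.7182818286 : ℝ) ^ 2 * 2 :=
        mul_le_mul h1 h2 growth_pos.le (by positivity)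
    _ ≤ 16 := by norm_num

/-- An exploration step at a state with an active action that is not optimal. -/
def Costly (M : MDP S A H) (I : Input S A H) (w : ℕ → Fin (H + 1) → S) (k : ℕ) (h : Fin H) :
    Prop :=
  Explores M I w k h ∧ ∃ b ∈ (run M I w k).act h (w k h.castSucc),
    0 < M.gap h (w k h.castSucc) b

open Classical in
/-- The range of a costly step. -/
def cost (M : MDP S A H) (I : Input S A H) (w : ℕ → Fin (H + 1) → S) (k : ℕ) (h : Fin H) : ℝ :=
  if Costly M I w k h then ranAt M I w k h else 0

omit hτ0 hτ in
theorem cost_nonneg {k : ℕ} (hk : k ≤ I.K) (h : Fin H) : 0 ≤ cost M I w k h := by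
  rw [cost]
  split_ifs with hc
  · exact hg.ranV_nonneg hk hc.1.1
  · exact le_rfl

/-- Turns the bound on excesses into one on full ranges: a range above its threshold is at most `2 *
H` times its excess. -/
theorem sum_cost_le {m : Fin H → S → A → ℝ}
    (hm : ∀ k < I.K, ∀ h, Explores M I w k h →
      m h (w k h.castSucc) (actAt M I w k h) ≤ 2 * ranAt M I w k h)
    (hthr : ∀ k < I.K, 1 ≤ k → ∀ h, Costly M I w k h → threshold H τ h ≤ ranAt M I w k h) :
    ∑ h : Fin H, ∑ k ∈ Finset.range I.K, cost M I w k h ≤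
      32 * (H : ℝ) ^ 2 * (∑ h : Fin H, ∑ z : S × A,
      (H + 512 * ((H : ℝ) ^ 4 * iota S A H I.K) / max τ (m h z.1 z.2 / 128))) + (H : ℝ) ^ 2 := by
  have hH0 : (0 : ℝ) < H := by exact_mod_cast hg.pos
  have hρ := one_le_growth (H := H)
  -- The first episode runs with `Dhat = 0`, so its ranges may lie below the threshold; it is
  -- charged `H` per step.
  have h1 : ∀ h : Fin H, ∀ k ∈ Finset.range I.K, cost M I w k h ≤
      2 * H * excessFrom M I w τ k h + if k = 0 then (H : ℝ) else 0 := by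
    intro h k hk
    have hk' := Finset.mem_range.1 hk
    have hY := excess_le_excessFrom (M := M) (I := I) (w := w) (τ := τ) k h
    have hY0 := excess_nonneg (M := M) (I := I) (w := w) (τ := τ) k h
    have hnn : 0 ≤ 2 * H * excessFrom M I w τ k h := by
      have := hY0.trans hY
      positivity
    rw [cost]
    split_ifs with hc h0 h0
    · have : ranAt M I w k h ≤ H := ranV_le_horizon k h _
      linarith
    · have ht := hthr k hk' (by omega) h hc
      have hE : ranAt M I w k h - threshold H τ h / growth H ^ 2 ≤ excess M I w τ k h := by
        rw [excess, if_pos hc.1]; exact le_max_left _ _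
      have hr0 : 0 ≤ ranAt M I w k h := hg.ranV_nonneg hk'.le hc.1.1
      have h2 : threshold H τ h / growth H ^ 2 ≤ ranAt M I w k h / growth H ^ 2 := by gcongr
      -- `excess` subtracts only the threshold divided by (1 + 1/H)², which leaves a fraction of at
      -- least 1/(2H) of the range.
      have h3 : 1 ≤ 2 * H * (1 - 1 / growth H ^ 2) := by
        have e : 2 * (H : ℝ) * (1 - 1 / growth H ^ 2) =
            1 + (3 * (H : ℝ) ^ 2 - 1) / (H + 1) ^ 2 := by
          rw [growth]; field_simp; ring
        rw [e]
        have hH1 : (1 : ℝ) ≤ H := by exact_mod_cast hg.pos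
        have : 0 ≤ (3 * (H : ℝ) ^ 2 - 1) / (H + 1) ^ 2 :=
          div_nonneg (by nlinarith) (by positivity)
        linarith
      have h4 : ranAt M I w k h ≤ 2 * H * (1 - 1 / growth H ^ 2) * ranAt M I w k h :=
        le_mul_of_one_le_left hr0 h3
      have h5 : 2 * (H : ℝ) * (1 - 1 / growth H ^ 2) * ranAt M I w k h =
          2 * H * (ranAt M I w k h - ranAt M I w k h / growth H ^ 2) := by ring
      have h6 : 2 * (H : ℝ) * (ranAt M I w k h - ranAt M I w k h / growth H ^ 2) ≤
          2 * H * excessFrom M I w τ k h :=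
        mul_le_mul_of_nonneg_left (by linarith) (by positivity)
      linarith
    · linarith
    · linarith
  have h2 : ∀ h : Fin H, ∑ k ∈ Finset.range I.K, cost M I w k h ≤
      2 * H * (16 * ∑ h : Fin H, ∑ z : S × A,
      (H + 512 * ((H : ℝ) ^ 4 * iota S A H I.K) / max τ (m h z.1 z.2 / 128))) + H := by
    intro h
    refine (Finset.sum_le_sum (h1 h)).trans ?_
    rw [Finset.sum_add_distrib, ← Finset.mul_sum]
    refine add_le_add (mul_le_mul_of_nonneg_left
      (sum_excessFrom_le hg hτ0 hτ hm h.isLt.le) (by positivity)) ?_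
    rw [Finset.sum_ite_eq' (Finset.range I.K) 0 (fun _ => (H : ℝ))]
    split_ifs
    · exact le_rfl
    · exact hH0.le
  refine (Finset.sum_le_sum fun h _ => h2 h).trans (le_of_eq ?_)
  rw [Finset.sum_const, Finset.card_univ, Fintype.card_fin, nsmul_eq_mul]
  ring

end Exploration
end
end QLP

namespace QLP
noncomputable section

/-! ### Gap-independent and gap-dependent bounds for the total range -/

section Cost

variable {S A : Type*} {H : ℕ} [Fintype S] [DecidableEq S] [Fintype A] [DecidableEq A] [Nonempty A]

theorem sum_triples (f : Fin H → S → A → ℝ) :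
    ∑ h : Fin H, ∑ z : S × A, f h z.1 z.2 = ∑ t : S × A × Fin H, f t.2.2 t.1 t.2.1 := by
  simp only [Fintype.sum_prod_type]
  rw [Finset.sum_comm]
  exact Finset.sum_congr rfl fun y _ => Finset.sum_comm

/-- `∑ 1/Δ` over the suboptimal triples, with the contribution of multiple optimal actions. -/
def gapSum (M : MDP S A H) : ℝ :=
  (∑ z ∈ M.subopt, 1 / M.gap z.2.2 z.1 z.2.1) + M.multiOpt.card / M.minGap

theorem minGap_spec (M : MDP S A H) (hex : ∃ h x a, 0 < M.gap h x a) :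
    0 < M.minGap ∧ ∀ h x a, 0 < M.gap h x a → M.minGap ≤ M.gap h x a := by
  have hfin : {δ : ℝ | ∃ h x a, 0 < M.gap h x a ∧ δ = M.gap h x a}.Finite := by
    refine (Set.finite_range fun t : Fin H × S × A => M.gap t.1 t.2.1 t.2.2).subset ?_
    rintro δ ⟨h, x, a, _, rfl⟩
    exact ⟨(h, x, a), rfl⟩
  have hne : {δ : ℝ | ∃ h x a, 0 < M.gap h x a ∧ δ = M.gap h x a}.Nonempty := by
    obtain ⟨h, x, a, hp⟩ := hex
    exact ⟨_, h, x, a, hp, rfl⟩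
  constructor
  · obtain ⟨h, x, a, hp, he⟩ := hne.csInf_mem hfin
    rw [MDP.minGap, he]
    exact hp
  · intro h x a hp
    exact csInf_le hfin.bddBelow ⟨h, x, a, hp, rfl⟩

/-- The reciprocal of a positive gap. -/
def invGap (M : MDP S A H) (h : Fin H) (y : S) (b : A) : ℝ :=
  if 0 < M.gap h y b then 1 / M.gap h y b else 0

theorem invGap_nonneg (M : MDP S A H) (h : Fin H) (y : S) (b : A) : 0 ≤ invGap M h y b := by
  rw [invGap]; split_ifs with hp
  · positivity
  · exact le_rfl

theorem sum_invGap (M : MDP S A H) :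
    ∑ t : S × A × Fin H, invGap M t.2.2 t.1 t.2.1 =
      ∑ z ∈ M.subopt, 1 / M.gap z.2.2 z.1 z.2.1 := by
  rw [MDP.subopt, Finset.sum_filter]
  refine Finset.sum_congr rfl fun t _ => ?_
  simp only [invGap, not_le]

/-- A lower bound for twice the range at a state where `b` is explored. -/
def exploredGap (M : MDP S A H) (h : Fin H) (y : S) (b : A) : ℝ :=
  if 0 < M.gap h y b then M.gap h y b
  else if (M.optActions h 0 y).card = 1 then 1 / ∑ c, invGap M h y c else 0

theorem mem_optActions (M : MDP S A H) {h : Fin H} {y : S} {b : A} :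
    b ∈ M.optActions h 0 y ↔ M.gap h y b = 0 := by
  rw [MDP.optActions, Finset.mem_filter]
  exact ⟨fun hb => le_antisymm hb.2 (M.gap_nonneg h y b), fun hb => ⟨Finset.mem_univ _, hb.le⟩⟩

theorem gap_pos_of_ne (M : MDP S A H) {h : Fin H} {y : S} (hc : (M.optActions h 0 y).card = 1)
    {b c : A} (hbc : b ≠ c) (hb : ¬ 0 < M.gap h y b) : 0 < M.gap h y c := by
  by_contra hc'
  have h1 := (mem_optActions M).2 (le_antisymm (not_lt.1 hb) (M.gap_nonneg h y b))
  have h2 := (mem_optActions M).2 (le_antisymm (not_lt.1 hc') (M.gap_nonneg h y c))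
  exact hbc (Finset.card_le_one.1 hc.le b h1 c h2)

theorem inv_sum_invGap_le (M : MDP S A H) {h : Fin H} {y : S} {b : A} (hb : 0 < M.gap h y b) :
    1 / ∑ c, invGap M h y c ≤ M.gap h y b := by
  have h1 : 1 / M.gap h y b ≤ ∑ c, invGap M h y c := by
    have := Finset.single_le_sum (f := fun c => invGap M h y c)
      (fun c _ => invGap_nonneg M h y c) (Finset.mem_univ b)
    simpa only [invGap, if_pos hb] using this
  have h0 : 0 < 1 / M.gap h y b := by positivity
  rw [div_le_iff₀ (h0.trans_le h1)]
  calc (1 : ℝ) = M.gap h y b * (1 / M.gap h y b) := by field_simp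
    _ ≤ _ := mul_le_mul_of_nonneg_left h1 hb.le

/-- A unique optimal action is given the reciprocal of the sum of the inverse gaps at its state, so
it costs no more than all suboptimal actions there together. Only multiple optimal actions fall back
on τ, hence on Δ_min. -/
theorem sum_inv_exploredGap_le (M : MDP S A H) (hA : Fintype.card A ≠ 1)
    (hex : ∃ h x a, 0 < M.gap h x a) {τ : ℝ} (hτ : M.minGap / 128 ≤ τ) :
    ∑ t : S × A × Fin H, 1 / max τ (exploredGap M t.2.2 t.1 t.2.1 / 128) ≤ 256 * gapSum M := by
  obtain ⟨hmin, -⟩ := minGap_spec M hex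
  have hτ0 : 0 < τ := by linarith
  have key : ∀ h y b, 1 / max τ (exploredGap M h y b / 128) ≤
      128 * invGap M h y b + (if M.gap h y b = 0 ∧ 1 < (M.optActions h 0 y).card then
        128 / M.minGap else 0) +
      (if M.gap h y b = 0 ∧ (M.optActions h 0 y).card = 1 then
        128 * ∑ c, invGap M h y c else 0) := by
    intro h y b
    have hg0 : 0 < max τ (exploredGap M h y b / 128) := lt_max_of_lt_left hτ0
    have hs0 : 0 ≤ ∑ c, invGap M h y c := Finset.sum_nonneg fun c _ => invGap_nonneg M h y c
    by_cases hp : 0 < M.gap h y b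
    · rw [if_neg fun hc => hp.ne' hc.1, if_neg fun hc => hp.ne' hc.1, add_zero, add_zero, invGap,
        if_pos hp, exploredGap, if_pos hp]
      have : 1 / max τ (M.gap h y b / 128) ≤ 1 / (M.gap h y b / 128) :=
        one_div_le_one_div_of_le (by positivity) (le_max_right _ _)
      refine this.trans (le_of_eq ?_)
      field_simp
    · have hz : M.gap h y b = 0 := le_antisymm (not_lt.1 hp) (M.gap_nonneg h y b)
      have hcard : 0 < (M.optActions h 0 y).card :=
        Finset.card_pos.2 ⟨b, (mem_optActions M).2 hz⟩
      rw [invGap, if_neg hp, mul_zero, zero_add]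
      by_cases h1 : (M.optActions h 0 y).card = 1
      · rw [if_neg fun hc => by omega, if_pos ⟨hz, h1⟩, zero_add, exploredGap, if_neg hp, if_pos h1]
        have hspos : 0 < ∑ c, invGap M h y c := by
          obtain ⟨c, hc⟩ : ∃ c, b ≠ c := by
            by_contra hall
            push Not at hall
            exact hA (Fintype.card_eq_one_iff.2 ⟨b, fun c => (hall c).symm⟩)
          refine Finset.sum_pos' (fun c _ => invGap_nonneg M h y c) ⟨c, Finset.mem_univ _, ?_⟩
          have := gap_pos_of_ne M h1 hc hp
          rw [invGap, if_pos this]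
          positivity
        have : 1 / max τ (1 / (∑ c, invGap M h y c) / 128) ≤
            1 / (1 / (∑ c, invGap M h y c) / 128) :=
          one_div_le_one_div_of_le (by positivity) (le_max_right _ _)
        refine this.trans (le_of_eq ?_)
        field_simp
      · rw [if_pos ⟨hz, by omega⟩, if_neg fun hc => h1 hc.2, add_zero]
        have : 1 / max τ (exploredGap M h y b / 128) ≤ 1 / (M.minGap / 128) :=
          one_div_le_one_div_of_le (by positivity) (hτ.trans (le_max_left _ _))
        refine this.trans (le_of_eq ?_)
        field_simp
  refine (Finset.sum_le_sum fun t _ => key t.2.2 t.1 t.2.1).trans ?_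
  rw [Finset.sum_add_distrib, Finset.sum_add_distrib, ← Finset.mul_sum, sum_invGap]
  have e2 : ∑ t : S × A × Fin H, (if M.gap t.2.2 t.1 t.2.1 = 0 ∧
      1 < (M.optActions t.2.2 0 t.1).card then 128 / M.minGap else 0) =
      128 * (M.multiOpt.card / M.minGap) := by
    rw [← Finset.sum_filter, Finset.sum_const, nsmul_eq_mul, MDP.multiOpt]
    ring
  have e3 : ∑ t : S × A × Fin H, (if M.gap t.2.2 t.1 t.2.1 = 0 ∧
      (M.optActions t.2.2 0 t.1).card = 1 then 128 * ∑ c, invGap M t.2.2 t.1 c else 0) ≤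
      128 * ∑ z ∈ M.subopt, 1 / M.gap z.2.2 z.1 z.2.1 := by
    rw [← sum_invGap, ← sum_triples (fun h y b => if M.gap h y b = 0 ∧
      (M.optActions h 0 y).card = 1 then 128 * ∑ c, invGap M h y c else 0),
      ← sum_triples (fun h y b => invGap M h y b), Finset.mul_sum]
    refine Finset.sum_le_sum fun h _ => ?_
    rw [Fintype.sum_prod_type, Fintype.sum_prod_type, Finset.mul_sum]
    refine Finset.sum_le_sum fun y _ => ?_
    have hs0 : 0 ≤ ∑ c, invGap M h y c := Finset.sum_nonneg fun c _ => invGap_nonneg M h y c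
    by_cases h1 : (M.optActions h 0 y).card = 1
    · simp only [h1, and_true]
      rw [← Finset.sum_filter, Finset.sum_const, nsmul_eq_mul]
      have e : Finset.univ.filter (fun b => M.gap h y b = 0) = M.optActions h 0 y := by
        ext b
        rw [mem_optActions, Finset.mem_filter]
        simp
      rw [e, h1, Nat.cast_one, one_mul]
    · simp only [h1, and_false, if_false, Finset.sum_const_zero]
      positivity
  have hm0 : 0 ≤ (M.multiOpt.card : ℝ) / M.minGap := by positivity
  rw [e2, gapSum]
  linarith

variable {M : MDP S A H} {I : Input S A H} {w : ℕ → Fin (H + 1) → S}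

theorem scaled_eq (hg : GoodRun M I w) {k : ℕ} (hk : 1 ≤ k) (h : Fin H) :
    scaled I h (run M I w k).Dhat = threshold H (I.R / (I.K * H)) h := by
  obtain ⟨j, rfl⟩ : ∃ j, k = j + 1 := ⟨k - 1, by omega⟩
  rw [scaled, hg.C₁_eq, one_mul, threshold, mul_comm]
  rfl

/-- The choice `m = 0`, τ = R/T: the exploration rule itself puts the range above the threshold. -/
theorem GoodRun.sum_cost_le_of_target (hg : GoodRun M I w) (hR : 0 < I.R) (hK : 0 < I.K) :
    ∑ h : Fin H, ∑ k ∈ Finset.range I.K, cost M I w k h ≤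
      32 * (H : ℝ) ^ 2 * (H * (Fintype.card S * Fintype.card A *
        (H + 512 * ((H : ℝ) ^ 4 * iota S A H I.K) / (I.R / (I.K * H))))) + (H : ℝ) ^ 2 := by
  have hH0 : (0 : ℝ) < H := by exact_mod_cast hg.pos
  have hK0 : (0 : ℝ) < I.K := by exact_mod_cast hK
  have hτ0 : 0 < I.R / (I.K * H) := by positivity
  refine (sum_cost_le (m := fun _ _ _ => 0) hg hτ0 le_rfl (fun k hk h he => ?_)
    (fun k hk hk1 h hc => ?_)).trans (le_of_eq ?_)
  · have := hg.ranV_nonneg hk.le he.1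
    change 0 ≤ 2 * ranAt M I w k h
    rw [ranAt]; linarith
  · have := hc.1.2
    rw [scaled_eq hg hk1] at this
    exact (not_le.1 this).le
  · rw [zero_div, max_eq_left hτ0.le]
    simp only [Finset.sum_const, Finset.card_univ, Fintype.card_fin, Fintype.card_prod,
      nsmul_eq_mul, Nat.cast_mul]

theorem GoodRun.sum_cost_le_of_gap (hg : GoodRun M I w) (hex : ∃ h x a, 0 < M.gap h x a) :
    ∑ h : Fin H, ∑ k ∈ Finset.range I.K, cost M I w k h ≤
      32 * (H : ℝ) ^ 2 * (H * (Fintype.card S * Fintype.card A * H) +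
        512 * ((H : ℝ) ^ 4 * iota S A H I.K) * (256 * gapSum M)) + (H : ℝ) ^ 2 := by
  obtain ⟨hmin, hmin'⟩ := minGap_spec M hex
  have hι := hg.iota_nonneg
  have hτ0 : 0 < max (I.R / (I.K * H)) (M.minGap / 128) := lt_max_of_lt_right (by positivity)
  refine (sum_cost_le (m := exploredGap M) hg hτ0 (le_max_left _ _) (fun k hk h he => ?_)
    (fun k hk hk1 h hc => ?_)).trans ?_
  · have hran := hg.ranV_nonneg hk.le he.1
    rw [exploredGap]
    split_ifs with h1 h2
    · exact hg.gap_le hk.le he.1 (hg.actAt_mem hk.le h)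
    -- The unique optimal action is played at an undetermined state. A second action is therefore
    -- active, and its positive gap bounds the range from below.
    · have hv := hg.valid hk.le
      have hcard : 1 < ((run M I w k).act h (w k h.castSucc)).card := by
        have h3 := Finset.card_pos.2 (hv.act_nonempty h (w k h.castSucc))
        have h4 : ((run M I w k).act h (w k h.castSucc)).card ≠ 1 := fun hc =>
          he.1 ((hv.mem_G _ _).2 hc)
        omega
      obtain ⟨c, hc, hne⟩ := Finset.exists_mem_ne hcard (actAt M I w k h)
      exact (inv_sum_invGap_le M (gap_pos_of_ne M h2 hne.symm h1)).trans
        (hg.gap_le hk.le he.1 hc)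
    · change 0 ≤ 2 * ranAt M I w k h
      rw [ranAt]; linarith
  · rw [threshold, max_mul_of_nonneg _ _ (pow_nonneg growth_pos.le _)]
    refine max_le ?_ ?_
    · have := hc.1.2
      rw [scaled_eq hg hk1] at this
      exact (not_le.1 this).le
    -- The threshold factor is at most 64, so 64·Δ_min/128 = Δ_min/2, which is at most the range
    -- because a suboptimal action is active. This is where costliness is used.
    · obtain ⟨b, hb, hpos⟩ := hc.2
      have h1 := hg.gap_le hk.le hc.1.1 hb
      have h2 := hmin' h _ b hpos
      have h3 := growth_pow_four_le hg.pos (Nat.sub_le H h)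
      have h4 := mul_le_mul_of_nonneg_left h3 (show 0 ≤ M.minGap / 128 by positivity)
      rw [ranAt]
      linarith
  · have h1 := sum_inv_exploredGap_le M hg.card hex
      (le_max_right (I.R / (I.K * H)) (M.minGap / 128))
    rw [← sum_triples (fun h y b =>
      1 / max (max (I.R / (I.K * H)) (M.minGap / 128)) (exploredGap M h y b / 128))] at h1
    have h2 : ∑ h : Fin H, ∑ z : S × A, (H + 512 * ((H : ℝ) ^ 4 * iota S A H I.K) /
        max (max (I.R / (I.K * H)) (M.minGap / 128)) (exploredGap M h z.1 z.2 / 128)) ≤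
        H * (Fintype.card S * Fintype.card A * H) +
        512 * ((H : ℝ) ^ 4 * iota S A H I.K) * (256 * gapSum M) := by
      simp only [Finset.sum_add_distrib, div_eq_mul_one_div (512 * ((H : ℝ) ^ 4 * iota S A H I.K)),
        ← Finset.mul_sum]
      refine add_le_add (le_of_eq ?_) (mul_le_mul_of_nonneg_left h1 (by positivity))
      simp only [Finset.sum_const, Finset.card_univ, Fintype.card_fin, Fintype.card_prod,
        nsmul_eq_mul, Nat.cast_mul]
    gcongr

/-- The regret with arbitrary predictions. -/
theorem GoodRun.sum_episodeGap_le (hg : GoodRun M I w) (hK : 0 < I.K) :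
    ∑ k ∈ Finset.range I.K, episodeGap M I w k ≤
      2 * (∑ h : Fin H, ∑ k ∈ Finset.range I.K, cost M I w k h) + 128 * I.R := by
  have hH0 : (0 : ℝ) < H := by exact_mod_cast hg.pos
  have hK0 : (0 : ℝ) < I.K := by exact_mod_cast hK
  have hτ0 : 0 ≤ I.R / (I.K * H) := div_nonneg hg.R_nonneg (by positivity)
  have key : ∀ h : Fin H, ∀ k ∈ Finset.range I.K,
      M.gap h (w k h.castSucc) (actAt M I w k h) ≤
        2 * cost M I w k h + 128 * (I.R / (I.K * H)) := by
    intro h k hk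
    have hk' := (Finset.mem_range.1 hk).le
    have hcost := cost_nonneg hg hk' h
    have hmem := hg.actAt_mem hk' h
    by_cases hx : w k h.castSucc ∈ (run M I w k).G h
    · rw [(hg.valid hk').gap_eq_zero_of_mem hx hmem]
      linarith
    have hgap := hg.gap_le hk' hx hmem
    by_cases he : Explores M I w k h
    · by_cases hc : Costly M I w k h
      · rw [cost, if_pos hc, ranAt]
        linarith
      · have : ¬ 0 < M.gap h (w k h.castSucc) (actAt M I w k h) := fun hp =>
          hc ⟨he, _, hmem, hp⟩
        linarith
    -- An exploiting step has range at most 64R/T, hence gap at most 128R/T; summed over the T steps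
    -- this is 128R.
    · have h1 : (run M I w k).ranV h (w k h.castSucc) ≤ scaled I h (run M I w k).Dhat := by
        by_contra hcon
        exact he ⟨hx, hcon⟩
      have h2 : scaled I h (run M I w k).Dhat ≤ 64 * (I.R / (I.K * H)) := by
        rcases Nat.eq_zero_or_pos k with rfl | hk1
        · have : (run M I w 0).Dhat = 0 := rfl
          rw [scaled, this, mul_zero]
          positivity
        · rw [scaled_eq hg hk1, threshold, mul_comm]
          exact mul_le_mul_of_nonneg_right (growth_pow_four_le hg.pos (Nat.sub_le _ _)) hτ0
      linarith
  simp only [episodeGap]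
  rw [Finset.sum_comm]
  refine (Finset.sum_le_sum fun h _ => Finset.sum_le_sum (key h)).trans (le_of_eq ?_)
  simp only [Finset.sum_add_distrib, ← Finset.mul_sum, Finset.sum_const, Finset.card_univ,
    Finset.card_range, Fintype.card_fin, nsmul_eq_mul]
  field_simp

end Cost
end
end QLP

namespace QLP
noncomputable section

/-! ### Refined predictions -/

section Refined

variable {S A : Type*} {H : ℕ} [Fintype S] [DecidableEq S] [Fintype A] [DecidableEq A] [Nonempty A]
variable {M : MDP S A H} {I : Input S A H} {w : ℕ → Fin (H + 1) → S}

/-- Although updated only at visited states, the value is always this maximum: at other states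
neither the entries nor the active set change. Nonnegative predictions are needed at the start,
where the lower estimate 0 is absent from the definition. -/
theorem Vt_run (hg : GoodRun M I w) (hpred : ∀ h y b, 0 ≤ I.pred h y b) {k : ℕ} (hk : k ≤ I.K)
    (h : Fin H) (y : S) :
    (run M I w k).Vt h y = maxOver ((run M I w k).act h y)
      fun b => max ((run M I w k).Qt h y b) ((run M I w k).Qlo h y b) := by
  induction k with
  | zero =>
    change maxOver Finset.univ (I.pred h y) = maxOver Finset.univ fun b => max (I.pred h y b) 0
    congr 1
    funext b
    rw [max_eq_left (hpred h y b)]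
  | succ k ih =>
    have hc := hg.consistent (k := k) (by omega)
    by_cases hv : y = w k h.castSucc
    · change nextVt I (run M I w k) (w k) (actAt M I w k) (rewAt M I w k) h y = _
      rw [nextVt, if_pos hv]
      rfl
    · change nextVt I (run M I w k) (w k) (actAt M I w k) (rewAt M I w k) h y =
        maxOver (nextAct I (run M I w k) (w k) (actAt M I w k) (rewAt M I w k) h y) fun b =>
          max (nextQt I (run M I w k) (w k) (actAt M I w k) (rewAt M I w k) h y b)
            (nextQlo I (run M I w k) (w k) (actAt M I w k) (rewAt M I w k) h y b)
      rw [nextVt, if_neg hv, hc.nextAct_of_not fun h' => hv h'.1, ih (by omega)]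
      congr 1
      funext b
      rw [hc.nextQlo_of_not_learned fun h' => hv h'.1.1, nextQt, if_neg fun h' => hv h'.1]

theorem Qt_le_pred (k : ℕ) (h : Fin H) (y : S) (b : A) :
    (run M I w k).Qt h y b ≤ I.pred h y b := by
  induction k with
  | zero => exact le_rfl
  | succ k ih =>
    change nextQt I (run M I w k) (w k) (actAt M I w k) (rewAt M I w k) h y b ≤ _
    rw [nextQt]
    split_ifs
    · exact (min_le_right _ _).trans ((min_le_left _ _).trans ih)
    · exact ih

theorem Qt_le (hg : GoodRun M I w) (hpred : ∀ h y b, I.pred h y b ≤ H) {k : ℕ} (hk : k ≤ I.K)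
    (h : Fin H) (y : S) (b : A) :
    (run M I w k).Qt h y b ≤ (run M I w k).Rup h y b ∧
      (run M I w k).Qt h y b ≤ (run M I w k).Qup h y b := by
  induction k with
  | zero => exact ⟨hpred h y b, hpred h y b⟩
  | succ k ih =>
    have hc := hg.consistent (k := k) (by omega)
    change nextQt I (run M I w k) (w k) (actAt M I w k) (rewAt M I w k) h y b ≤
        nextRup I (run M I w k) (w k) (actAt M I w k) (rewAt M I w k) h y b ∧
      nextQt I (run M I w k) (w k) (actAt M I w k) (rewAt M I w k) h y b ≤
        nextQup I (run M I w k) (w k) (actAt M I w k) (rewAt M I w k) h y b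
    by_cases hv : y = w k h.castSucc ∧ b = actAt M I w k h
    · rw [nextQt, if_pos hv]
      exact ⟨min_le_left _ _, (min_le_right _ _).trans (min_le_right _ _)⟩
    · rw [nextQt, if_neg hv, hc.nextQup_of_not_learned fun h' => hv h'.1]
      simp only [nextRup, if_neg hv]
      exact ih (by omega)

theorem rewAt_add_value (M : MDP S A H) (I : Input S A H) (w : ℕ → Fin (H + 1) → S) (k : ℕ)
    (h : Fin H) :
    rewAt M I w k h + valueAt (fun h => M.Vstar h) (w k) (h + 1) =
      M.Qstar h (w k h.castSucc) (actAt M I w k h) + stepError M I h w k := by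
  rw [valueAt_Vstar M (w k) (Nat.succ_lt_succ h.isLt), stepError]
  exact Qstar_add_tdError M (pol M I w k) (w k) h

theorem Rup_eq (h : Fin H) (y : S) (b : A) {k : ℕ} (hn : 1 ≤ visits M I w h y b k) :
    (run M I w k).Rup h y b = M.Qstar h y b +
      wsum H (visits M I w h y b k) (fun i => stepError M I h w (visitAt M I w h y b i)) +
      wsum H (visits M I w h y b k) (fun i =>
        valueAt (run M I w (visitAt M I w h y b i)).Vt (w (visitAt M I w h y b i)) (h + 1) -
        valueAt (fun h => M.Vstar h) (w (visitAt M I w h y b i)) (h + 1)) +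
      wsum H (visits M I w h y b k) (bonus I) := by
  rw [Rup_run, alphaZero, if_neg (by omega), zero_mul, zero_add, wsum_add]
  congr 1
  rw [add_assoc, ← wsum_add, ← sub_eq_iff_eq_add', ← wsum_const (H := H) hn (M.Qstar h y b),
    ← wsum_sub]
  refine wsum_congr fun i h1 h2 => ?_
  obtain ⟨-, hvis⟩ := visitAt_spec h1 h2
  have := rewAt_add_value M I w (visitAt M I w h y b i) h
  rw [← hvis.1, ← hvis.2] at this
  linarith

variable {ε : ℝ}

/-- The bonus absorbs the noise, so each backward step loses only the ε of the distillation.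
Induction over episodes suffices because the averages use values of earlier episodes. -/
theorem GoodRun.optimism (hg : GoodRun M I w) (hε : 0 ≤ ε) (hpred : ∀ h y b, 0 ≤ I.pred h y b)
    (hdist : IsApproxDistillation M I.pred ε) : ∀ k ≤ I.K,
    (∀ h y b, M.Qstar h y b - (H - ((h : ℕ) + 1)) * ε ≤ (run M I w k).Rup h y b) ∧
    (∀ h y b, M.gap h y b + max (M.Qstar h y b - I.pred h y b) 0 ≤ ε →
      M.Vstar h y - (H - (h : ℕ)) * ε ≤ (run M I w k).Qt h y b) ∧
    (∀ (h : Fin H) y, M.Vstar h y - (H - (h : ℕ)) * ε ≤ (run M I w k).Vt h y) := by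
  intro k
  induction k using Nat.strong_induction_on with
  | _ k ih =>
  intro hk
  have hle : ∀ h : Fin H, 0 ≤ ((H : ℝ) - ((h : ℕ) + 1)) * ε := fun h => by
    have : ((h : ℕ) + 1 : ℝ) ≤ H := by exact_mod_cast h.isLt
    exact mul_nonneg (by linarith) hε
  have h1 : ∀ h y b, M.Qstar h y b - (H - ((h : ℕ) + 1)) * ε ≤ (run M I w k).Rup h y b := by
    intro h y b
    rcases Nat.eq_zero_or_pos (visits M I w h y b k) with h0 | hn
    · rw [Rup_run, h0, alphaZero, if_pos rfl, wsum_zero]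
      have := M.Qstar_le_horizon h y b
      linarith [hle h]
    · rw [Rup_eq h y b hn]
      have e1 := (abs_le.1 (hg.good h y b _ hn (visits_mono h y b hk)).2).1
      have e2 := bonus_le_wsum (I := I) hg.C₀_eq hg.iota_nonneg hn
      have e3 : wsum H (visits M I w h y b k) (fun _ => -((H - ((h : ℕ) + 1)) * ε)) ≤
          wsum H (visits M I w h y b k) (fun i =>
        valueAt (run M I w (visitAt M I w h y b i)).Vt (w (visitAt M I w h y b i)) (h + 1) -
        valueAt (fun h => M.Vstar h) (w (visitAt M I w h y b i)) (h + 1)) := by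
        refine wsum_mono fun i hi1 hi2 => ?_
        obtain ⟨hlt, -⟩ := visitAt_spec hi1 hi2
        rw [valueAt, valueAt]
        split_ifs with hj
        · have := (ih _ hlt (by omega)).2.2 ⟨h + 1, hj⟩
            (w (visitAt M I w h y b i) (Fin.castSucc ⟨h + 1, hj⟩))
          push_cast at this
          linarith
        · linarith [hle h]
      rw [wsum_const hn] at e3
      linarith
  have h2 : ∀ h y b, M.gap h y b + max (M.Qstar h y b - I.pred h y b) 0 ≤ ε →
      M.Vstar h y - (H - (h : ℕ)) * ε ≤ (run M I w k).Qt h y b := by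
    intro h y b hb
    have hmax := le_max_left (M.Qstar h y b - I.pred h y b) 0
    have hmax0 := le_max_right (M.Qstar h y b - I.pred h y b) 0
    have hl := hle h
    have e : M.gap h y b = M.Vstar h y - M.Qstar h y b := rfl
    rcases k with _ | k
    · change _ ≤ I.pred h y b
      linarith
    · change _ ≤ nextQt I (run M I w k) (w k) (actAt M I w k) (rewAt M I w k) h y b
      have hQ := (hg.valid hk).le_Qup h y b
      have hR := h1 h y b
      have hQt := (ih k (by omega) (by omega)).2.1 h y b hb
      rw [nextQt]
      split_ifs
      · refine le_min ?_ (le_min hQt ?_)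
        · refine le_trans ?_ hR
          linarith
        · refine le_trans ?_ hQ
          linarith
      · exact hQt
  refine ⟨h1, h2, fun h y => ?_⟩
  obtain ⟨b, hb⟩ := hdist h y
  have hQt := h2 h y b hb
  rw [Vt_run hg hpred hk]
  by_cases hmem : b ∈ (run M I w k).act h y
  · exact hQt.trans ((le_max_left _ _).trans (le_maxOver hmem
      fun b => max ((run M I w k).Qt h y b) ((run M I w k).Qlo h y b)))
  -- If the distilled action was eliminated, some active action has a lower estimate above its Q*,
  -- and lower estimates enter the refined value.
  · have hc := hg.consistent hk
    obtain ⟨c, hcm, hcl⟩ := hc.exists_Vlo_le h y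
    have e1 := hc.eliminated h y b hmem
    have e2 : (run M I w k).Qlo h y c ≤ _ := (le_max_right _ _).trans (le_maxOver hcm
      fun b => max ((run M I w k).Qt h y b) ((run M I w k).Qlo h y b))
    have hmax0 := le_max_right (M.Qstar h y b - I.pred h y b) 0
    have hl := hle h
    have e : M.gap h y b = M.Vstar h y - M.Qstar h y b := rfl
    linarith

/-! ### Overestimation by the refined predictions -/

/-- The excess, beyond `ε`, of the refined value at step `j` of episode `k` over the optimal
value. -/
def overAt (M : MDP S A H) (I : Input S A H) (w : ℕ → Fin (H + 1) → S) (ε : ℝ) (k j : ℕ) : ℝ :=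
  max (valueAt (run M I w k).Vt (w k) j - valueAt (fun h => M.Vstar h) (w k) j - ε) 0

theorem overAt_nonneg (k j : ℕ) : 0 ≤ overAt M I w ε k j := le_max_right _ _

theorem overAt_fin (k : ℕ) (h : Fin H) : overAt M I w ε k h =
    max ((run M I w k).Vt h (w k h.castSucc) - M.Vstar h (w k h.castSucc) - ε) 0 := by
  rw [overAt, valueAt, valueAt, dif_pos h.isLt, dif_pos h.isLt]

theorem overAt_end (hε : 0 ≤ ε) (k : ℕ) : overAt M I w ε k H = 0 := by
  rw [overAt, valueAt, valueAt, dif_neg (lt_irrefl _), dif_neg (lt_irrefl _),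
    max_eq_right (by linarith)]

/-- The noise and the averaged bonus are each at most half of `beta`; what remains is earlier
overestimation at the next step. -/
theorem Rup_le (hg : GoodRun M I w) (hε : 0 ≤ ε) {k : ℕ} (hk : k ≤ I.K) (h : Fin H) :
    (run M I w k).Rup h (w k h.castSucc) (actAt M I w k h) ≤
      M.Qstar h (w k h.castSucc) (actAt M I w k h) + alphaZero (visitsAt M I w k h) * H +
        beta I (visitsAt M I w k h) + pastAvg M I w k h (fun j => overAt M I w ε j (h + 1)) + ε := by
  rw [pastAvg, visitsAt]
  set y := w k h.castSucc
  set b := actAt M I w k h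
  rcases Nat.eq_zero_or_pos (visits M I w h y b k) with h0 | hn
  · rw [Rup_run, h0, alphaZero, if_pos rfl, wsum_zero, wsum_zero, beta_zero]
    linarith [M.Qstar_nonneg h y b]
  · rw [Rup_eq h y b hn, beta_eq, alphaZero, if_neg (by omega)]
    have e1 := (abs_le.1 (hg.good h y b _ hn (visits_mono h y b hk)).2).2
    have e2 := bonus_le_wsum (I := I) hg.C₀_eq hg.iota_nonneg hn
    have e3 : wsum H (visits M I w h y b k) (fun i =>
        valueAt (run M I w (visitAt M I w h y b i)).Vt (w (visitAt M I w h y b i)) (h + 1) -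
        valueAt (fun h => M.Vstar h) (w (visitAt M I w h y b i)) (h + 1)) ≤
        wsum H (visits M I w h y b k) (fun i =>
          overAt M I w ε (visitAt M I w h y b i) (h + 1) + ε) := by
      refine wsum_mono fun i hi1 hi2 => ?_
      have := le_max_left (valueAt (run M I w (visitAt M I w h y b i)).Vt
        (w (visitAt M I w h y b i)) (h + 1) -
        valueAt (fun h => M.Vstar h) (w (visitAt M I w h y b i)) (h + 1) - ε) 0
      rw [overAt]
      linarith
    rw [wsum_add, wsum_const hn] at e3
    linarith

/-- The contribution of a visit of a fooling triple. -/
def foolTerm (M : MDP S A H) (I : Input S A H) (w : ℕ → Fin (H + 1) → S) (ε : ℝ) (k : ℕ)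
    (h : Fin H) : ℝ :=
  if (w k h.castSucc, actAt M I w k h, h) ∈ foolingSet M I.pred (ε / 2) ε then
    penalty I (M.gap h (w k h.castSucc) (actAt M I w k h) / 2) (visitsAt M I w k h) else 0

theorem foolTerm_nonneg (k : ℕ) (h : Fin H) : 0 ≤ foolTerm M I w ε k h := by
  rw [foolTerm]
  split_ifs
  · exact penalty_nonneg _ _
  · exact le_rfl

/-- The local bounds for the overestimation and for the gap of the action, if the action maximizes
the refined predictions. -/
theorem overAt_le_of_exploit (hg : GoodRun M I w) (hε : 0 ≤ ε) (hpred : ∀ h y b, I.pred h y b ≤ H)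
    {k : ℕ} (hk : k ≤ I.K) {h : Fin H}
    (hopt : M.Vstar h (w k h.castSucc) - ε / 4 ≤ (run M I w k).Vt h (w k h.castSucc))
    (hV : (run M I w k).Vt h (w k h.castSucc) =
      max ((run M I w k).Qt h (w k h.castSucc) (actAt M I w k h))
        ((run M I w k).Qlo h (w k h.castSucc) (actAt M I w k h))) :
    overAt M I w ε k h ≤
      foolTerm M I w ε k h + pastAvg M I w k h (fun j => overAt M I w ε j (h + 1)) ∧
    M.gap h (w k h.castSucc) (actAt M I w k h) ≤ 2 * (foolTerm M I w ε k h +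
      pastAvg M I w k h (fun j => overAt M I w ε j (h + 1))) + 4 * ε := by
  have hU := pastAvg_nonneg (M := M) (I := I) (w := w) (u := fun j => overAt M I w ε j (h + 1))
    (fun j => overAt_nonneg j _) k h
  have hR := Rup_le hg hε hk h
  have hf := foolTerm_nonneg (M := M) (I := I) (w := w) (ε := ε) k h
  rw [overAt_fin]
  rw [foolTerm] at hf ⊢
  set U := pastAvg M I w k h (fun j => overAt M I w ε j (h + 1))
  set y := w k h.castSucc
  set b := actAt M I w k h
  set n := visitsAt M I w k h
  have egap : M.gap h y b = M.Vstar h y - M.Qstar h y b := rfl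
  have hg0 := M.gap_nonneg h y b
  have hlo := (hg.valid hk).Qlo_le h y b
  have hp := Qt_le_pred (M := M) (I := I) (w := w) k h y b
  have hQ := (Qt_le hg hpred hk h y b).1
  rcases le_total ((run M I w k).Qt h y b) ((run M I w k).Qlo h y b) with hc | hc
  · rw [max_eq_right hc] at hV
    refine ⟨max_le ?_ ?_, ?_⟩ <;> linarith
  rw [max_eq_left hc] at hV
  -- For a fooling triple half of the gap is moved to the left side, so the bonus appears clipped at
  -- half the gap.
  by_cases hF : (y, b, h) ∈ foolingSet M I.pred (ε / 2) ε
  · rw [if_pos hF]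
    rw [if_pos hF] at hf
    have hm := le_max_left (beta I n - M.gap h y b / 2) 0
    have hz := penalty_nonneg (I := I) (M.gap h y b / 2) n
    have e : penalty I (M.gap h y b / 2) n =
      alphaZero n * H + max (beta I n - M.gap h y b / 2) 0 := rfl
    refine ⟨max_le ?_ ?_, ?_⟩ <;> linarith
  · rw [if_neg hF]
    simp only [foolingSet, Finset.mem_filter, Finset.mem_univ, true_and, not_or, not_and, not_le,
      not_lt, ge_iff_le, gt_iff_lt] at hF
    obtain ⟨h1, h2⟩ := hF
    -- A larger gap would force the prediction below V* - ε/2, whereas optimism requires it to be at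
    -- least V* - ε/4.
    have h3 : M.gap h y b ≤ ε := by
      by_contra hcon
      push Not at hcon
      have : ¬ (M.gap h y b - ε / 2 ≤ I.pred h y b - M.Qstar h y b) := fun h' => by
        have := h1 h'
        linarith
      linarith
    refine ⟨max_le ?_ ?_, ?_⟩ <;> linarith

/-- The local bounds for the overestimation and for the gap of the action. -/
theorem overAt_le (hg : GoodRun M I w) {δ : ℝ} (hδ : 0 ≤ δ) (hε : ε = 4 * δ * (H + 1))
    (hpred : ∀ h y b, I.pred h y b ∈ Set.Icc (0 : ℝ) H)
    (hdist : IsApproxDistillation M I.pred δ) (hlack : LacksFoolingOptimal M I.pred ε)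
    {k : ℕ} (hk : k ≤ I.K) (h : Fin H) :
    overAt M I w ε k h ≤ cost M I w k h + foolTerm M I w ε k h +
      pastAvg M I w k h (fun j => overAt M I w ε j (h + 1)) ∧
    M.gap h (w k h.castSucc) (actAt M I w k h) ≤ 2 * (cost M I w k h + foolTerm M I w ε k h +
      pastAvg M I w k h (fun j => overAt M I w ε j (h + 1))) + 4 * ε := by
  have hε0 : 0 ≤ ε := by rw [hε]; positivity
  have hU := pastAvg_nonneg (M := M) (I := I) (w := w) (u := fun j => overAt M I w ε j (h + 1))
    (fun j => overAt_nonneg j _) k h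
  have hf := foolTerm_nonneg (M := M) (I := I) (w := w) (ε := ε) k h
  have hcost := cost_nonneg hg hk h
  have hv := hg.valid hk
  have hmem := hg.actAt_mem hk h
  have hne := hv.act_nonempty h (w k h.castSucc)
  have hVt := Vt_run hg (fun h y b => (hpred h y b).1) hk h (w k h.castSucc)
  have hexploit : (run M I w k).Vt h (w k h.castSucc) =
      max ((run M I w k).Qt h (w k h.castSucc) (actAt M I w k h))
        ((run M I w k).Qlo h (w k h.castSucc) (actAt M I w k h)) → _ := fun hV =>
    overAt_le_of_exploit hg hε0 (fun h y b => (hpred h y b).2) hk (h := h) (by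
      have h1 := (hg.optimism hδ (fun h y b => (hpred h y b).1) hdist k hk).2.2 h
        (w k h.castSucc)
      -- This is why ε = 4δ(H+1): the accumulated loss of optimism stays below ε/4.
      have h2 : ((H : ℝ) - (h : ℕ)) * δ ≤ ε / 4 := by
        rw [hε]
        have : (0 : ℝ) ≤ (h : ℕ) := Nat.cast_nonneg _
        nlinarith
      linarith) hV
  by_cases hx : w k h.castSucc ∈ (run M I w k).G h
  · have h1 := hexploit (by
      rw [hVt]
      have hcard := (hv.mem_G h _).1 hx
      obtain ⟨c, hc, he⟩ := exists_maxOver hne fun b => max ((run M I w k).Qt h (w k h.castSucc) b)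
        ((run M I w k).Qlo h (w k h.castSucc) b)
      rw [he, Finset.card_le_one.1 hcard.le c hc _ hmem])
    constructor <;> linarith [h1.1, h1.2]
  by_cases he : Explores M I w k h
  · by_cases hc : Costly M I w k h
    · have hcr : cost M I w k h = (run M I w k).ranV h (w k h.castSucc) := by
        rw [cost, if_pos hc, ranAt]
      have h1 := hg.gap_le hk hx hmem
      refine ⟨?_, by linarith⟩
      rw [overAt_fin]
      refine max_le ?_ (by linarith)
      have h2 : (run M I w k).Vt h (w k h.castSucc) ≤ M.Vstar h (w k h.castSucc) +
          (run M I w k).ranV h (w k h.castSucc) := by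
        rw [hVt]
        refine maxOver_le hne fun b hb => ?_
        have h3 := hg.Qup_le hk hx hb
        exact max_le ((Qt_le hg (fun h y b => (hpred h y b).2) hk h _ b).2.trans h3)
          (((hv.Qlo_le h _ b).trans (hv.le_Qup h _ b)).trans h3)
      linarith
    -- Exploration among optimal actions only, at least two of them. It has no gap and is not
    -- charged as a cost, but the refined value could still be too large; the lack of fooling
    -- optimal actions excludes exactly this.
    · have hzero : ∀ b ∈ (run M I w k).act h (w k h.castSucc),
          M.gap h (w k h.castSucc) b = 0 := fun b hb =>
        le_antisymm (not_lt.1 fun hp => hc ⟨he, b, hb, hp⟩) (M.gap_nonneg _ _ _)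
      have hcard : 1 < (M.optActions h 0 (w k h.castSucc)).card := by
        have h1 : (run M I w k).act h (w k h.castSucc) ⊆ M.optActions h 0 (w k h.castSucc) :=
          fun b hb => (mem_optActions M).2 (hzero b hb)
        have h2 := Finset.card_le_card h1
        have h3 := Finset.card_pos.2 hne
        have h4 : ((run M I w k).act h (w k h.castSucc)).card ≠ 1 := fun hc' =>
          hx ((hv.mem_G _ _).2 hc')
        omega
      rw [hzero _ hmem]
      refine ⟨?_, by linarith⟩
      rw [overAt_fin]
      refine max_le ?_ (by linarith)
      have h2 : (run M I w k).Vt h (w k h.castSucc) ≤ M.Vstar h (w k h.castSucc) + ε := by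
        rw [hVt]
        refine maxOver_le hne fun b hb => ?_
        refine max_le ((Qt_le_pred k h _ b).trans ?_) ?_
        · by_contra hcon
          push Not at hcon
          exact hlack ⟨h, _, hcard, b, (mem_optActions M).2 (hzero b hb), hcon⟩
        · linarith [hv.Qlo_le h (w k h.castSucc) b, M.Qstar_le_Vstar h (w k h.castSucc) b]
      linarith
  · have hran : (run M I w k).ranV h (w k h.castSucc) ≤ scaled I h (run M I w k).Dhat := by
      by_contra hcon
      exact he ⟨hx, hcon⟩
    have ha : actAt M I w k h = I.argmax ((run M I w k).act h (w k h.castSucc)) fun b =>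
        max ((run M I w k).Qt h (w k h.castSucc) b) ((run M I w k).Qlo h (w k h.castSucc) b) := by
      rw [actAt, pol, choosePolicy, if_neg fun hc => hx ((hv.mem_G _ _).2 hc), if_pos hran]
    have h1 := hexploit (by
      rw [hVt]
      have hmax := (hg.argmax _ (fun b => max ((run M I w k).Qt h (w k h.castSucc) b)
        ((run M I w k).Qlo h (w k h.castSucc) b)) hne).2
      rw [← ha] at hmax
      exact le_antisymm (maxOver_le hne hmax) (le_maxOver hmem fun b =>
        max ((run M I w k).Qt h (w k h.castSucc) b) ((run M I w k).Qlo h (w k h.castSucc) b)))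
    constructor <;> linarith [h1.1, h1.2]

/-- The regret with good predictions. -/
theorem GoodRun.sum_episodeGap_le_of_distillation (hg : GoodRun M I w) {δ : ℝ} (hδ : 0 ≤ δ)
    (hε : ε = 4 * δ * (H + 1)) (hpred : ∀ h y b, I.pred h y b ∈ Set.Icc (0 : ℝ) H)
    (hdist : IsApproxDistillation M I.pred δ) (hlack : LacksFoolingOptimal M I.pred ε) :
    ∑ k ∈ Finset.range I.K, episodeGap M I w k ≤
      14 * H * ((∑ h : Fin H, ∑ k ∈ Finset.range I.K, cost M I w k h) +
        ∑ h : Fin H, ∑ k ∈ Finset.range I.K, foolTerm M I w ε k h) + 4 * ε * (I.K * H) := by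
  have hH1 : (1 : ℝ) ≤ H := by exact_mod_cast hg.pos
  have hε0 : 0 ≤ ε := by rw [hε]; positivity
  set B : Fin H → ℝ := fun h => ∑ k ∈ Finset.range I.K, (cost M I w k h + foolTerm M I w ε k h)
    with hB
  have hB0 : ∀ h, 0 ≤ B h := fun h => Finset.sum_nonneg fun k hk =>
    add_nonneg (cost_nonneg hg (Finset.mem_range.1 hk).le h) (foolTerm_nonneg k h)
  have hBs : 0 ≤ ∑ h, B h := Finset.sum_nonneg fun h _ => hB0 h
  set s : ℕ → ℝ := fun j => ∑ k ∈ Finset.range I.K, overAt M I w ε k j with hs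
  have hU : ∀ h : Fin H, ∑ k ∈ Finset.range I.K,
      pastAvg M I w k h (fun j => overAt M I w ε j (h + 1)) ≤ growth H * s (h + 1) := fun h =>
    sum_pastAvg_le (M := M) (I := I) (w := w) hg.pos h
      (u := fun j => overAt M I w ε j (h + 1)) (fun j => overAt_nonneg j _) I.K
  have hrec : ∀ h : Fin H, s h ≤ B h + growth H * s (h + 1) := by
    intro h
    refine (Finset.sum_le_sum fun k hk =>
      (overAt_le hg hδ hε hpred hdist hlack (Finset.mem_range.1 hk).le h).1).trans ?_
    rw [Finset.sum_add_distrib]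
    linarith [hU h]
  -- (1 + 1/H)^H ≤ e < 3.
  have hsj : ∀ j ≤ H, s j ≤ 3 * ∑ h, B h := fun j hj => by
    refine (layer_bound (one_le_growth (H := H)) hB0 hrec
      (Finset.sum_eq_zero fun k _ => overAt_end hε0 k) hj).trans ?_
    refine mul_le_mul_of_nonneg_right ?_ hBs
    have := growth_pow_le hg.pos 1
    rw [one_mul] at this
    linarith
  have h1 : ∀ h : Fin H, ∑ k ∈ Finset.range I.K, M.gap h (w k h.castSucc) (actAt M I w k h) ≤
      2 * B h + 12 * (∑ h, B h) + 4 * ε * I.K := by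
    intro h
    refine (Finset.sum_le_sum fun k hk =>
      (overAt_le hg hδ hε hpred hdist hlack (Finset.mem_range.1 hk).le h).2).trans ?_
    rw [Finset.sum_add_distrib, ← Finset.mul_sum, Finset.sum_add_distrib, Finset.sum_const,
      Finset.card_range, nsmul_eq_mul]
    have h2 := hU h
    have h3 := hsj (h + 1) h.isLt
    have h4 : growth H * s (h + 1) ≤ 2 * (3 * ∑ h, B h) :=
      mul_le_mul (growth_le_two hg.pos) h3 (Finset.sum_nonneg fun k _ => overAt_nonneg k _)
        (by norm_num)
    linarith
  simp only [episodeGap]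
  rw [Finset.sum_comm]
  refine (Finset.sum_le_sum fun h _ => h1 h).trans ?_
  have e : (∑ h : Fin H, ∑ k ∈ Finset.range I.K, cost M I w k h) +
      ∑ h : Fin H, ∑ k ∈ Finset.range I.K, foolTerm M I w ε k h = ∑ h, B h := by
    simp only [hB, Finset.sum_add_distrib]
  rw [e, Finset.sum_add_distrib, Finset.sum_add_distrib, ← Finset.mul_sum, Finset.sum_const,
    Finset.sum_const, Finset.card_univ, Fintype.card_fin, nsmul_eq_mul, nsmul_eq_mul]
  nlinarith

/-! ### Visits of fooling triples -/

theorem sum_foolTerm : ∑ h : Fin H, ∑ k ∈ Finset.range I.K, foolTerm M I w ε k h =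
    ∑ t ∈ foolingSet M I.pred (ε / 2) ε,
      ∑ n ∈ Finset.range (visits M I w t.2.2 t.1 t.2.1 I.K),
        penalty I (M.gap t.2.2 t.1 t.2.1 / 2) n := by
  have h1 : ∀ h : Fin H, ∑ k ∈ Finset.range I.K, foolTerm M I w ε k h = ∑ z : S × A,
      ∑ n ∈ Finset.range (visits M I w h z.1 z.2 I.K),
        if (z.1, z.2, h) ∈ foolingSet M I.pred (ε / 2) ε then
          penalty I (M.gap h z.1 z.2 / 2) n else 0 := fun h =>
    sum_visitsAt h (fun y b n => if (y, b, h) ∈ foolingSet M I.pred (ε / 2) ε then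
          penalty I (M.gap h y b / 2) n else 0) I.K
  rw [Finset.sum_congr rfl fun h _ => h1 h,
    sum_triples (fun h y b => ∑ n ∈ Finset.range (visits M I w h y b I.K),
        if (y, b, h) ∈ foolingSet M I.pred (ε / 2) ε then
          penalty I (M.gap h y b / 2) n else 0),
    ← Finset.sum_subset (Finset.subset_univ (foolingSet M I.pred (ε / 2) ε))]
  · refine Finset.sum_congr rfl fun t ht => Finset.sum_congr rfl fun n _ => if_pos ht
  · exact fun t _ ht => Finset.sum_eq_zero fun n _ => if_neg ht

theorem GoodRun.sum_foolTerm_le_of_gap (hg : GoodRun M I w)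
    (hpos : ∀ t ∈ foolingSet M I.pred (ε / 2) ε, 0 < M.gap t.2.2 t.1 t.2.1) :
    ∑ h : Fin H, ∑ k ∈ Finset.range I.K, foolTerm M I w ε k h ≤
      ∑ t ∈ foolingSet M I.pred (ε / 2) ε,
        (H + 1024 * ((H : ℝ) ^ 3 * iota S A H I.K) / M.gap t.2.2 t.1 t.2.1) := by
  rw [sum_foolTerm]
  refine Finset.sum_le_sum fun t ht => ?_
  have := hpos t ht
  refine (sum_penalty_le hg (half_pos this) _).trans (le_of_eq ?_)
  field_simp
  ring

theorem GoodRun.sum_penalty_le_sqrt (hg : GoodRun M I w) {δ : ℝ} (hδ : 0 ≤ δ) (N : ℕ) :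
    ∑ n ∈ Finset.range N, penalty I δ n ≤
      H + 32 * √((H : ℝ) ^ 3 * iota S A H I.K) * √(N : ℝ) := by
  have hι := hg.iota_nonneg
  have hmono : ∑ n ∈ Finset.range N, penalty I δ n ≤
      ∑ n ∈ Finset.range (N + 1), penalty I δ n := by
    rw [Finset.sum_range_succ]
    linarith [penalty_nonneg (I := I) δ N]
  refine hmono.trans ?_
  rw [Finset.sum_range_succ', add_comm]
  have h0 : penalty I δ 0 = H := by
    rw [penalty, alphaZero, if_pos rfl, beta_zero, max_eq_right (by linarith)]; ring
  rw [h0]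
  refine add_le_add_right ?_ _
  have h1 : ∑ n ∈ Finset.range N, penalty I δ (n + 1) ≤
      ∑ n ∈ Finset.Icc 1 N, 16 * √((H : ℝ) ^ 3 * iota S A H I.K) / √(n : ℝ) := by
    rw [Finset.range_eq_Ico, Finset.sum_Ico_add' (fun n => penalty I δ n) 0 N 1]
    refine Finset.sum_le_sum fun n hn => ?_
    have hn' := Finset.mem_Ico.1 hn
    rw [penalty, alphaZero, if_neg (by omega), zero_mul, zero_add]
    refine max_le ?_ (by positivity)
    have := beta_le (I := I) hg.C₀_eq hι (n := n) (by omega)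
    linarith
  refine h1.trans ((sum_div_sqrt_le (by positivity) N).trans (le_of_eq ?_))
  ring

/-- The clipping is dropped, and Cauchy-Schwarz over the fooling set uses that all visits together
number T. -/
theorem GoodRun.sum_foolTerm_le_sqrt (hg : GoodRun M I w) :
    ∑ h : Fin H, ∑ k ∈ Finset.range I.K, foolTerm M I w ε k h ≤
      (foolingSet M I.pred (ε / 2) ε).card * H + 32 * √((H : ℝ) ^ 3 * iota S A H I.K) *
        √((foolingSet M I.pred (ε / 2) ε).card * (I.K * H)) := by
  rw [sum_foolTerm]
  set F := foolingSet M I.pred (ε / 2) ε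
  refine (Finset.sum_le_sum fun t _ => hg.sum_penalty_le_sqrt
    (div_nonneg (M.gap_nonneg t.2.2 t.1 t.2.1) zero_le_two) _).trans ?_
  rw [Finset.sum_add_distrib, Finset.sum_const, nsmul_eq_mul, ← Finset.mul_sum]
  refine add_le_add_right (mul_le_mul_of_nonneg_left ?_ (by positivity)) _
  refine Real.le_sqrt_of_sq_le (sq_sum_le_card_mul_sum_sq.trans ?_)
  refine mul_le_mul_of_nonneg_left ?_ (Nat.cast_nonneg _)
  simp only [Real.sq_sqrt (Nat.cast_nonneg _)]
  refine (Finset.sum_le_sum_of_subset_of_nonneg (Finset.subset_univ F)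
    fun _ _ _ => Nat.cast_nonneg _).trans (le_of_eq ?_)
  rw [← sum_triples (fun h y b => (visits M I w h y b I.K : ℝ))]
  have : ∀ h : Fin H, ∑ z : S × A, (visits M I w h z.1 z.2 I.K : ℝ) = I.K := fun h => by
    exact_mod_cast sum_visits_eq (M := M) (I := I) (w := w) h I.K
  simp only [this, Finset.sum_const, Finset.card_univ, Fintype.card_fin, nsmul_eq_mul]
  ring

end Refined
end
end QLP

namespace QLP
noncomputable section

/-! ### From good runs to the regret -/

section Regret

variable {S A : Type*} {H : ℕ} [Fintype S] [DecidableEq S] [Nonempty S]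
  [Fintype A] [DecidableEq A] [Nonempty A]
variable (M : MDP S A H) (I : Input S A H) (adv : Adversary S H)

theorem episodeGap_le (w : ℕ → Fin (H + 1) → S) (k : ℕ) : episodeGap M I w k ≤ H * H := by
  rw [episodeGap]
  refine (Finset.sum_le_sum fun h _ => M.gap_le_horizon h _ _).trans (le_of_eq ?_)
  rw [Finset.sum_const, Finset.card_univ, Fintype.card_fin, nsmul_eq_mul]

theorem regret_eq_zero (hzero : ∀ h x a, M.gap h x a = 0) : regret M I adv = 0 := by
  rw [regret_eq, hexp]
  simp only [episodeGap, hzero, Finset.sum_const_zero]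
  exact expect_const _ 0

/-- The failure probability multiplied by the largest possible regret is at most `4`. -/
theorem failure_le (hH : 0 < H) (hK : 0 < I.K) :
    (I.K * (H * H) : ℝ) * (H * (Fintype.card S * (Fintype.card A * (I.K * (4 *
      Real.exp (-(4 * iota S A H I.K))))))) ≤ 4 := by
  have hs : (1 : ℝ) ≤ Fintype.card S := by exact_mod_cast Fintype.card_pos
  have ha : (1 : ℝ) ≤ Fintype.card A := by exact_mod_cast Fintype.card_pos
  have hH1 : (1 : ℝ) ≤ H := by exact_mod_cast hH
  have hK1 : (1 : ℝ) ≤ I.K := by exact_mod_cast hK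
  set s : ℝ := (Fintype.card S : ℝ)
  set a : ℝ := (Fintype.card A : ℝ)
  set K : ℝ := (I.K : ℝ)
  set X : ℝ := s * a * (K * H) with hX
  have hsa : 1 ≤ s * a := one_le_mul_of_one_le_of_one_le hs ha
  have hKX : K * H ≤ X := le_mul_of_one_le_left (by positivity) hsa
  have hHX : (H : ℝ) ≤ X := (le_mul_of_one_le_left (by positivity) hK1).trans hKX
  have hX1 : 1 ≤ X := hH1.trans hHX
  have hexp4 : Real.exp (-(4 * iota S A H I.K)) = 1 / X ^ 4 := by
    rw [Real.exp_neg, iota, mul_comm 4, Real.exp_mul, Real.exp_log (by positivity),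
      show (4 : ℝ) = (4 : ℕ) by norm_num, Real.rpow_natCast, one_div]
  rw [hexp4]
  have e : (K * (H * H) : ℝ) * (H * (s * (a * (K * (4 * (1 / X ^ 4)))))) =
      4 * ((K * H) * H * X) / X ^ 4 := by rw [hX]; field_simp
  rw [e, div_le_iff₀ (by positivity)]
  have h1 : (K * H) * H * X ≤ X * X * X := by gcongr
  have h2 : X * X * X ≤ X ^ 4 := by
    rw [show X * X * X = X ^ 3 by ring]
    exact pow_le_pow_right₀ hX1 (by norm_num)
  linarith

/-- Off the good event the gaps sum to at most KH²; by `failure_le` this contributes at most 4. -/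
theorem regret_le (hH : 0 < H) (hK : 0 < I.K) (hC₀ : I.C₀ = 4) (hC₁ : I.C₁ = 1) (hR : 0 ≤ I.R)
    (hι : 0 ≤ iota S A H I.K) (hA : Fintype.card A ≠ 1) (harg : IsArgmax I.argmax) {D : ℝ}
    (hD : ∀ w, GoodRun M I w → ∑ k ∈ Finset.range I.K, episodeGap M I w k ≤ D) (hD0 : 0 ≤ D) :
    regret M I adv ≤ D + 4 := by
  classical
  have hbad := hexp_not_good_le M I adv hH hC₀ hι
  have h1 : ∀ w, ∑ k ∈ Finset.range I.K, episodeGap M I w k ≤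
      D + (I.K * (H * H)) * (if Good M I w then (0 : ℝ) else 1) := by
    intro w
    split_ifs with hgood
    · have := hD w ⟨hH, hC₀, hC₁, hR, hι, hA, harg, hgood⟩
      linarith
    · have : ∑ k ∈ Finset.range I.K, episodeGap M I w k ≤ I.K * (H * H) := by
        refine (Finset.sum_le_sum fun k _ => episodeGap_le M I w k).trans (le_of_eq ?_)
        rw [Finset.sum_const, Finset.card_range, nsmul_eq_mul]
      linarith
  rw [regret_eq, hexp]
  refine (expect_mono _ fun w => h1 (pad w)).trans ?_
  rw [expect_add, expect_const, expect_const_mul]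
  have h2 := mul_le_mul_of_nonneg_left hbad (show (0 : ℝ) ≤ I.K * (H * H) by positivity)
  have h3 := failure_le (S := S) (A := A) I hH hK
  rw [hexp] at h2
  have h4 := h2.trans h3
  linarith

end Regret

/-! ### Numerical consequences of the range of the target -/

section Numerics

variable {S A : Type*} {H : ℕ} [Fintype S] [DecidableEq S] [Nonempty S]
  [Fintype A] [DecidableEq A] [Nonempty A]

/-- There are many triples which are not the unique optimal action. -/
theorem card_le_two_mul (M : MDP S A H) (hA : 2 ≤ Fintype.card A) :
    (Fintype.card S : ℝ) * Fintype.card A * H ≤ 2 * (M.subopt.card + M.multiOpt.card) := by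
  have hpt : ∀ (h : Fin H) (y : S), (Fintype.card A : ℝ) ≤
      2 * ∑ b : A, ((if ¬ M.gap h y b ≤ 0 then 1 else 0) +
        if M.gap h y b = 0 ∧ 1 < (M.optActions h 0 y).card then 1 else 0) := by
    intro h y
    have hA' : (2 : ℝ) ≤ Fintype.card A := by exact_mod_cast hA
    -- Several optimal actions: every action at the state is counted. Otherwise at most one is
    -- missed, and |A| - 1 ≥ |A|/2.
    by_cases hc : 1 < (M.optActions h 0 y).card
    · have : ∑ b : A, ((if ¬ M.gap h y b ≤ 0 then (1 : ℝ) else 0) +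
          if M.gap h y b = 0 ∧ 1 < (M.optActions h 0 y).card then 1 else 0) =
          ∑ _b : A, (1 : ℝ) := by
        refine Finset.sum_congr rfl fun b _ => ?_
        rcases (M.gap_nonneg h y b).lt_or_eq with hp | hz
        · rw [if_pos (not_le.2 hp), if_neg fun h' => hp.ne' h'.1, add_zero]
        · rw [if_neg (not_not.2 hz.ge), if_pos ⟨hz.symm, hc⟩, zero_add]
      rw [this, Finset.sum_const, Finset.card_univ, nsmul_eq_mul, mul_one]
      linarith
    · have h1 : (∑ b : A, if ¬ M.gap h y b ≤ 0 then (1 : ℝ) else 0) =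
          Fintype.card A - (M.optActions h 0 y).card := by
        have e : ∀ b : A, (if ¬ M.gap h y b ≤ 0 then (1 : ℝ) else 0) =
            1 - if M.gap h y b ≤ 0 then 1 else 0 := fun b => by split_ifs <;> norm_num
        rw [Finset.sum_congr rfl fun b _ => e b, Finset.sum_sub_distrib, Finset.sum_boole]
        simp [MDP.optActions]
      have h2 : ((M.optActions h 0 y).card : ℝ) ≤ 1 := by exact_mod_cast not_lt.1 hc
      have h3 : (0 : ℝ) ≤ ∑ b : A,
          if M.gap h y b = 0 ∧ 1 < (M.optActions h 0 y).card then 1 else 0 :=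
        Finset.sum_nonneg fun b _ => by split_ifs <;> norm_num
      rw [Finset.sum_add_distrib, h1]
      linarith
  have h1 := Finset.sum_le_sum fun (h : Fin H) (_ : h ∈ Finset.univ) =>
    Finset.sum_le_sum fun (y : S) (_ : y ∈ Finset.univ) => hpt h y
  simp only [Finset.sum_const, Finset.card_univ, Fintype.card_fin, nsmul_eq_mul,
    ← Finset.mul_sum] at h1
  have e := sum_triples (fun (h : Fin H) (y : S) (b : A) =>
    ((if ¬ M.gap h y b ≤ 0 then (1 : ℝ) else 0) +
        if M.gap h y b = 0 ∧ 1 < (M.optActions h 0 y).card then 1 else 0))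
  simp only [Fintype.sum_prod_type (α₁ := S) (α₂ := A)] at e
  rw [e, Finset.sum_add_distrib, Finset.sum_boole, Finset.sum_boole] at h1
  refine le_trans (le_of_eq (by ring)) h1

/-- Gaps are at most `H`, so each counted triple contributes at least 1/H. This lets lower-order
terms in SA be absorbed by the gap-dependent cost. -/
theorem le_gapSum (M : MDP S A H) (hH : 0 < H) (hA : 2 ≤ Fintype.card A)
    (hex : ∃ h x a, 0 < M.gap h x a) :
    (Fintype.card S : ℝ) * Fintype.card A ≤ 2 * gapSum M := by
  have hH0 : (0 : ℝ) < H := by exact_mod_cast hH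
  obtain ⟨hmin, hmin'⟩ := minGap_spec M hex
  have h1 : (M.subopt.card : ℝ) * (1 / H) ≤ ∑ z ∈ M.subopt, 1 / M.gap z.2.2 z.1 z.2.1 := by
    rw [← nsmul_eq_mul, ← Finset.sum_const]
    refine Finset.sum_le_sum fun z hz => ?_
    have : 0 < M.gap z.2.2 z.1 z.2.1 := not_le.1 (Finset.mem_filter.1 hz).2
    exact one_div_le_one_div_of_le this (M.gap_le_horizon _ _ _)
  have h2 : (M.multiOpt.card : ℝ) * (1 / H) ≤ M.multiOpt.card / M.minGap := by
    obtain ⟨h, x, b, hp⟩ := hex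
    rw [div_eq_mul_one_div (M.multiOpt.card : ℝ)]
    exact mul_le_mul_of_nonneg_left (one_div_le_one_div_of_le hmin
      ((hmin' h x b hp).trans (M.gap_le_horizon h x b))) (Nat.cast_nonneg _)
  have h3 := mul_le_mul_of_nonneg_right (card_le_two_mul M hA) (one_div_nonneg.2 hH0.le)
  have e : (Fintype.card S : ℝ) * Fintype.card A * H * (1 / H) =
      Fintype.card S * Fintype.card A := by field_simp
  rw [e] at h3
  rw [gapSum]
  linarith

/-- The consequences of `S A H³ ≤ R ≤ T/(SA)`. -/
theorem target_range {K : ℕ} (hH : 0 < H) (hA : 2 ≤ Fintype.card A) {R : ℝ}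
    (hR : R ∈ Set.Icc ((Fintype.card S : ℝ) * Fintype.card A * (H : ℝ) ^ 3)
          (((K : ℝ) * H) / ((Fintype.card S : ℝ) * Fintype.card A))) :
    1 ≤ R ∧ R * (Fintype.card S * Fintype.card A) ≤ K * H ∧ 0 < K ∧ 1 ≤ iota S A H K := by
  have hs : (1 : ℝ) ≤ Fintype.card S := by exact_mod_cast Fintype.card_pos
  have ha : (2 : ℝ) ≤ Fintype.card A := by exact_mod_cast hA
  have hH1 : (1 : ℝ) ≤ H := by exact_mod_cast hH
  obtain ⟨hR1, hR2⟩ := hR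
  rw [iota]
  set P : ℝ := Fintype.card S * Fintype.card A with hP
  have hP2 : 2 ≤ P := by rw [hP]; nlinarith
  have hH3 : (1 : ℝ) ≤ (H : ℝ) ^ 3 := one_le_pow₀ hH1
  have hR3 : 2 ≤ R := by nlinarith
  rw [le_div_iff₀ (by linarith)] at hR2
  have hT : 4 ≤ (K : ℝ) * H := by nlinarith
  have hK : 0 < K := by
    rcases Nat.eq_zero_or_pos K with h0 | h0
    · rw [h0, Nat.cast_zero, zero_mul] at hT; linarith
    · exact h0
  refine ⟨by linarith, hR2, hK, ?_⟩
  rw [Real.le_log_iff_exp_le (by positivity)]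
  have := Real.exp_one_lt_d9
  nlinarith

/-- The total range in the gap-independent regime. -/
theorem target_cost_le {P h T ι R c : ℝ} (hP : 1 ≤ P) (hh : 1 ≤ h) (hι : 1 ≤ ι) (hR : 0 < R)
    (hRP : R * P ≤ T) (hcR : T * P * h ^ 8 * ι ≤ c * R) :
    32 * h ^ 2 * (h * (P * (h + 512 * (h ^ 4 * ι) / (R / T)))) + h ^ 2 ≤ 4194369 * c ∧ 1 ≤ c := by
  have hT : 0 < T := lt_of_lt_of_le (by positivity) hRP
  -- The upper limit on R makes `c` so large that all lower-order terms are below it.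
  have hlow : P ^ 2 * h ^ 8 * ι ≤ c := by
    refine le_of_mul_le_mul_right ((le_of_eq ?_).trans
      ((mul_le_mul_of_nonneg_right hRP (show 0 ≤ P * h ^ 8 * ι by positivity)).trans
        ((le_of_eq ?_).trans hcR))) hR <;> ring
  have h1 : P * h ^ 4 ≤ c := by
    refine le_trans ?_ hlow
    calc P * h ^ 4 = P ^ 1 * h ^ 4 * 1 := by ring
      _ ≤ P ^ 2 * h ^ 8 * ι := by gcongr <;> norm_num
  have h2 : h ^ 2 ≤ c := by
    refine le_trans ?_ h1
    calc h ^ 2 = 1 * h ^ 2 := by ring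
      _ ≤ P * h ^ 4 := by gcongr; norm_num
  have h3 : P * h ^ 7 * ι * T / R ≤ c := by
    rw [div_le_iff₀ hR]
    refine le_trans ?_ hcR
    calc P * h ^ 7 * ι * T ≤ P * h ^ 8 * ι * T := by gcongr; norm_num
      _ = _ := by ring
  have h4 : 1 ≤ c := (one_le_pow₀ hh).trans h2
  refine ⟨?_, h4⟩
  have e : 32 * h ^ 2 * (h * (P * (h + 512 * (h ^ 4 * ι) / (R / T)))) + h ^ 2 =
      32 * (P * h ^ 4) + 16384 * (P * h ^ 7 * ι * T / R) + h ^ 2 := by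
    field_simp
    ring
  rw [e]
  linarith

/-- The total range in the gap-dependent regime. -/
theorem gap_cost_le {P h ι G : ℝ} (hP : 2 ≤ P) (hh : 1 ≤ h) (hι : 1 ≤ ι) (hG : P ≤ 2 * G) :
    32 * h ^ 2 * (h * (P * h) + 512 * (h ^ 4 * ι) * (256 * G)) + h ^ 2 ≤
      4194369 * (h ^ 7 * ι * G) ∧ 1 ≤ h ^ 7 * ι * G := by
  have hG1 : 1 ≤ G := by linarith
  have h1 : P * h ^ 4 ≤ 2 * (h ^ 7 * ι * G) := by
    calc P * h ^ 4 ≤ 2 * G * h ^ 4 := by gcongr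
      _ = 2 * (h ^ 4 * 1 * G) := by ring
      _ ≤ 2 * (h ^ 7 * ι * G) := by gcongr; norm_num
  have h2 : h ^ 2 ≤ h ^ 7 * ι * G := by
    calc h ^ 2 = h ^ 2 * 1 * 1 := by ring
      _ ≤ h ^ 7 * ι * G := by gcongr; norm_num
  have h3 : h ^ 6 * ι * G ≤ h ^ 7 * ι * G := by gcongr; norm_num
  have h4 : 1 ≤ h ^ 7 * ι * G := (one_le_pow₀ hh).trans h2
  refine ⟨?_, h4⟩
  -- 4194304 = 32·512·256, and 4194369 adds 64 + 1 for the lower-order terms.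
  have e : 32 * h ^ 2 * (h * (P * h) + 512 * (h ^ 4 * ι) * (256 * G)) + h ^ 2 =
      32 * (P * h ^ 4) + 4194304 * (h ^ 6 * ι * G) + h ^ 2 := by ring
  rw [e]
  linarith

/-- The number `min (a/R²) (b/R)` is the only one at which `min (√(λ a)) b = λ R`. -/
theorem existsUnique_ratio {a b R : ℝ} (ha : 0 < a) (hb : 0 < b) (hR : min (√a) b < R) :
    ∃! l : ℝ, l ∈ Set.Ioo (0 : ℝ) 1 ∧ min (√(l * a)) b / l = R := by
  have hR0 : 0 < R := (lt_min (Real.sqrt_pos.2 ha) hb).trans hR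
  have hiff : ∀ l : ℝ, 0 < l → (√(l * a) ≤ l * R ↔ a / R ^ 2 ≤ l) ∧
      (l * R ≤ √(l * a) ↔ l ≤ a / R ^ 2) ∧ (b ≤ l * R ↔ b / R ≤ l) ∧
      (l * R ≤ b ↔ l ≤ b / R) := by
    intro l hl
    refine ⟨?_, ?_, (div_le_iff₀ hR0).symm, (le_div_iff₀ hR0).symm⟩
    · rw [Real.sqrt_le_left (by positivity), div_le_iff₀ (by positivity), mul_pow, sq l, mul_assoc,
        mul_le_mul_iff_right₀ hl]
    · rw [Real.le_sqrt (by positivity), le_div_iff₀ (by positivity), mul_pow, sq l, mul_assoc,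
        mul_le_mul_iff_right₀ hl]
      positivity
  -- Comparing `l * R` with either entry of the minimum is a one-sided bound on `l`, so the equation
  -- determines `l`.
  have key : ∀ l : ℝ, 0 < l → (min (√(l * a)) b / l = R ↔ l = min (a / R ^ 2) (b / R)) := by
    intro l hl
    obtain ⟨h1, h2, h3, h4⟩ := hiff l hl
    rw [div_eq_iff hl.ne', mul_comm R l, le_antisymm_iff, le_antisymm_iff (a := l), min_le_iff,
      le_min_iff, le_min_iff, min_le_iff, h1, h2, h3, h4]
    exact and_comm
  have hpos : 0 < min (a / R ^ 2) (b / R) := lt_min (by positivity) (by positivity)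
  refine ⟨min (a / R ^ 2) (b / R), ⟨⟨hpos, ?_⟩, (key _ hpos).2 rfl⟩, fun l hl =>
    (key l hl.1.1).1 hl.2⟩
  rcases min_lt_iff.1 hR with h | h
  · refine min_lt_iff.2 (Or.inl ?_)
    rw [div_lt_one (by positivity)]
    exact (Real.sqrt_lt' hR0).1 h
  · exact min_lt_iff.2 (Or.inr ((div_lt_one hR0).2 h))

end Numerics
/-! ### Comparison with the `λ`-cost and the fooling cost -/

section Comparison

variable {S A : Type*} {H : ℕ} [Fintype S] [DecidableEq S] [Nonempty S]
  [Fintype A] [DecidableEq A] [Nonempty A]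
variable {M : MDP S A H} {I : Input S A H} {w : ℕ → Fin (H + 1) → S}

/-- The two regimes, gap-independent and gap-dependent, for the total cost `c`. -/
def Regime (M : MDP S A H) (K : ℕ) (R c : ℝ) : Prop :=
  (K * H : ℝ) * (Fintype.card S * Fintype.card A) * (H : ℝ) ^ 8 * iota S A H K ≤ c * R ∨
    (H : ℝ) ^ 7 * iota S A H K * gapSum M ≤ c

/-- Squaring the first alternative and cancelling one λ turns it into a bound for the cost of
exploring at threshold R/T. -/
theorem regime_of_lambdaCost_le {K : ℕ} {R lam : ℝ} (hlam : 0 < lam) (hR : 0 < R)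
    (h : lambdaCost M K lam ≤ lam * R) : Regime M K R (lam * R) := by
  rw [lambdaCost, min_le_iff] at h
  refine h.imp (fun h => ?_) id
  rw [Real.sqrt_le_left (by positivity)] at h
  refine le_of_mul_le_mul_left (le_trans (le_of_eq ?_) (h.trans (le_of_eq ?_))) hlam <;> ring

theorem Regime.one_le {K : ℕ} {R c : ℝ} (hr : Regime M K R c) (hH : 0 < H)
    (hA : 2 ≤ Fintype.card A) (hex : ∃ h x a, 0 < M.gap h x a)
    (hR : R ∈ Set.Icc ((Fintype.card S : ℝ) * Fintype.card A * (H : ℝ) ^ 3)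
          (((K : ℝ) * H) / ((Fintype.card S : ℝ) * Fintype.card A))) : 1 ≤ c := by
  obtain ⟨hR1, hRP, -, hι⟩ := target_range hH hA hR
  have hs : (1 : ℝ) ≤ Fintype.card S := by exact_mod_cast Fintype.card_pos
  have ha : (2 : ℝ) ≤ Fintype.card A := by exact_mod_cast hA
  have hH1 : (1 : ℝ) ≤ H := by exact_mod_cast hH
  have hP : (2 : ℝ) ≤ Fintype.card S * Fintype.card A := by nlinarith
  rcases hr with h | h
  · exact (target_cost_le (by linarith) hH1 hι (by linarith) hRP h).2
  · exact (gap_cost_le hP hH1 hι (le_gapSum M hH hA hex)).2.trans h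

theorem GoodRun.sum_cost_le_of_regime (hg : GoodRun M I w) {c : ℝ} (hr : Regime M I.K I.R c)
    (hA : 2 ≤ Fintype.card A) (hex : ∃ h x a, 0 < M.gap h x a)
    (hR : I.R ∈ Set.Icc ((Fintype.card S : ℝ) * Fintype.card A * (H : ℝ) ^ 3)
          (((I.K : ℝ) * H) / ((Fintype.card S : ℝ) * Fintype.card A))) :
    ∑ h : Fin H, ∑ k ∈ Finset.range I.K, cost M I w k h ≤ 4194369 * c := by
  obtain ⟨hR1, hRP, hK, hι⟩ := target_range hg.pos hA hR
  have hs : (1 : ℝ) ≤ Fintype.card S := by exact_mod_cast Fintype.card_pos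
  have ha : (2 : ℝ) ≤ Fintype.card A := by exact_mod_cast hA
  have hH1 : (1 : ℝ) ≤ H := by exact_mod_cast hg.pos
  have hP : (2 : ℝ) ≤ Fintype.card S * Fintype.card A := by nlinarith
  rcases hr with h | h
  · exact (hg.sum_cost_le_of_target (by linarith) hK).trans
      (target_cost_le (by linarith) hH1 hι (by linarith) hRP h).1
  · exact (hg.sum_cost_le_of_gap hex).trans
      ((gap_cost_le hP hH1 hι (le_gapSum M hg.pos hA hex)).1.trans
        (mul_le_mul_of_nonneg_left h (by norm_num)))

theorem GoodRun.sum_foolTerm_le (hg : GoodRun M I w) (hA : 2 ≤ Fintype.card A)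
    (hR : I.R ∈ Set.Icc ((Fintype.card S : ℝ) * Fintype.card A * (H : ℝ) ^ 3)
          (((I.K : ℝ) * H) / ((Fintype.card S : ℝ) * Fintype.card A))) {ε : ℝ} (hε : 0 < ε) :
    H * (∑ h : Fin H, ∑ k ∈ Finset.range I.K, foolTerm M I w ε k h) ≤
      1025 * foolingCost M I.K I.pred ε := by
  obtain ⟨hR1, hRP, hK, hι⟩ := target_range hg.pos hA hR
  have hs : (1 : ℝ) ≤ Fintype.card S := by exact_mod_cast Fintype.card_pos
  have ha : (2 : ℝ) ≤ Fintype.card A := by exact_mod_cast hA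
  have hH1 : (1 : ℝ) ≤ H := by exact_mod_cast hg.pos
  have hP : (2 : ℝ) ≤ Fintype.card S * Fintype.card A := by nlinarith
  have hsqrt := hg.sum_foolTerm_le_sqrt (ε := ε)
  have hgap := hg.sum_foolTerm_le_of_gap (ε := ε)
  -- SAH ≤ SAH³ ≤ R ≤ T; it absorbs the first-visit terms into the square root.
  have hcard : ((foolingSet M I.pred (ε / 2) ε).card : ℝ) ≤ I.K * H := by
    have h1 : ((foolingSet M I.pred (ε / 2) ε).card : ℝ) ≤
        Fintype.card S * Fintype.card A * H := by
      have := Finset.card_le_univ (foolingSet M I.pred (ε / 2) ε)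
      simp only [Fintype.card_prod, Fintype.card_fin] at this
      rw [mul_assoc]
      exact_mod_cast this
    have h2 : (Fintype.card S : ℝ) * Fintype.card A * H ≤
        Fintype.card S * Fintype.card A * (H : ℝ) ^ 3 :=
      mul_le_mul_of_nonneg_left (le_self_pow₀ hH1 (by norm_num)) (by linarith)
    have h3 : I.R * 1 ≤ I.R * (Fintype.card S * Fintype.card A) :=
      mul_le_mul_of_nonneg_left (by linarith) (by linarith)
    linarith [hR.1]
  rw [← div_le_iff₀' (by norm_num : (0 : ℝ) < 1025), foolingCost]
  set ι := iota S A H I.K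
  set F := foolingSet M I.pred (ε / 2) ε
  set Y := ∑ h : Fin H, ∑ k ∈ Finset.range I.K, foolTerm M I w ε k h
  refine (ENNReal.ofReal_le_iff_le_toReal ?_).1 (le_min ?_ ?_)
  · exact ((min_le_left _ _).trans_lt ENNReal.ofReal_lt_top).ne
  · refine ENNReal.ofReal_le_ofReal ((div_le_iff₀' (by norm_num)).2 ?_)
    have e1 : H * (√((H : ℝ) ^ 3 * ι) * √(F.card * (I.K * H))) =
        √((H : ℝ) ^ 5 * (I.K * H) * ι * F.card) := by
      rw [← Real.sqrt_mul (by positivity)]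
      nth_rewrite 1 [← Real.sqrt_sq (zero_le_one.trans hH1)]
      rw [← Real.sqrt_mul (by positivity)]
      congr 1
      ring
    have e2 : (F.card : ℝ) * (H * H) ≤ √((H : ℝ) ^ 5 * (I.K * H) * ι * F.card) := by
      refine Real.le_sqrt_of_sq_le ?_
      calc ((F.card : ℝ) * (H * H)) ^ 2 = H ^ 4 * F.card * 1 * F.card := by ring
        _ ≤ H ^ 5 * (I.K * H) * ι * F.card := by gcongr; norm_num
    have e3 := mul_le_mul_of_nonneg_left hsqrt (zero_le_one.trans hH1)
    have e4 : 0 ≤ √((H : ℝ) ^ 5 * (I.K * H) * ι * F.card) := Real.sqrt_nonneg _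
    calc H * Y ≤ _ := e3
      _ = F.card * (H * H) + 32 * (H * (√((H : ℝ) ^ 3 * ι) * √(F.card * (I.K * H)))) := by ring
      _ ≤ _ := by rw [e1]; linarith
  · by_cases hall : ∀ t ∈ F, 0 < M.gap t.2.2 t.1 t.2.1 - ε / 2
    · rw [Finset.sum_congr rfl fun t ht => (ENNReal.ofReal_div_of_pos (hall t ht)).symm,
        ← ENNReal.ofReal_sum_of_nonneg fun t ht => div_nonneg (by positivity) (hall t ht).le]
      refine ENNReal.ofReal_le_ofReal ((div_le_iff₀' (by norm_num)).2 ?_)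
      have e3 := mul_le_mul_of_nonneg_left (hgap fun t ht => by linarith [hall t ht])
        (zero_le_one.trans hH1)
      refine e3.trans ?_
      rw [Finset.mul_sum, Finset.mul_sum]
      refine Finset.sum_le_sum fun t ht => ?_
      have hpos := hall t ht
      have hle := M.gap_le_horizon t.2.2 t.1 t.2.1
      set g := M.gap t.2.2 t.1 t.2.1
      have hg0 : 0 < g := by linarith
      have e4 : (H : ℝ) * H ≤ H ^ 4 * ι / g := by
        rw [le_div_iff₀ hg0]
        calc (H : ℝ) * H * g ≤ H * H * H := by gcongr
          _ = H ^ 3 * 1 := by ring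
          _ ≤ H ^ 4 * ι := by gcongr; norm_num
      calc H * (H + 1024 * ((H : ℝ) ^ 3 * ι) / g) = H * H + 1024 * (H ^ 4 * ι / g) := by ring
        _ ≤ 1025 * (H ^ 4 * ι / g) := by linarith
        _ ≤ 1025 * (H ^ 4 * ι / (g - ε / 2)) := by gcongr; linarith
    -- A fooling triple of gap at most ε/2 makes the sum infinite, so there is nothing to prove.
    · push Not at hall
      obtain ⟨t, ht, hle⟩ := hall
      refine le_trans (le_top.trans (le_of_eq ?_))
        (Finset.single_le_sum (f := fun z : S × A × Fin H => ENNReal.ofReal ((H : ℝ) ^ 4 * ι) /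
          ENNReal.ofReal (M.gap z.2.2 z.1 z.2.1 - ε / 2)) (fun _ _ => bot_le) ht)
      rw [ENNReal.ofReal_of_nonpos hle, ENNReal.div_zero]
      exact (ENNReal.ofReal_pos.2 (by positivity)).ne'

end Comparison
end
end QLP

/-! ### Assembly of the three claims. -/

theorem theorem3p3 :
    ∃ C₀ C₁ C : ℝ, 1 < C₀ ∧ 0 < C₁ ∧ 0 < C ∧
      ∀ (S : Type*) (A : Type*) [Fintype S] [DecidableEq S] [Nonempty S]
        [Fintype A] [DecidableEq A] [Nonempty A]
        (H K : ℕ) (_ : 0 < H) (M : QLP.MDP S A H)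
        (adv : QLP.Adversary S H)
        (argmax : Finset A → (A → ℝ) → A) (_ : QLP.IsArgmax argmax)
        (pred : Fin H → S → A → ℝ) (R : ℝ)
        (_ : R ∈ Set.Icc ((Fintype.card S : ℝ) * Fintype.card A * (H : ℝ) ^ 3)
          (((K : ℝ) * H) / ((Fintype.card S : ℝ) * Fintype.card A))),
        (QLP.lambdaCost M K 1 ≤ R →
          QLP.regret M ⟨K, R, pred, C₀, C₁, argmax⟩ adv ≤ C * R) ∧
        (0 < QLP.lambdaCost M K 1 → QLP.lambdaCost M K 1 < R →
          ∃! lam : ℝ, lam ∈ Set.Ioo (0 : ℝ) 1 ∧ QLP.lambdaCost M K lam / lam = R) ∧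
        (∀ lam ∈ Set.Ioo (0 : ℝ) 1, QLP.lambdaCost M K lam / lam = R →
          ∀ ε > 0, ∀ ε' : ℝ, ε' = 4 * ε * (H + 1) →
            (∀ h x a, pred h x a ∈ Set.Icc (0 : ℝ) H) →
            QLP.IsApproxDistillation M pred ε →
            QLP.LacksFoolingOptimal M pred ε' →
            QLP.regret M ⟨K, R, pred, C₀, C₁, argmax⟩ adv ≤
              C * (H * QLP.lambdaCost M K lam + ε' * (K * H) * H +
                QLP.foolingCost M K pred ε')) := by
  -- C₀ = 4 gives the deviation probability exp(-4ι). The last constant exceeds 14·4194369 + 4.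
  refine ⟨4, 1, 10 ^ 8, by norm_num, by norm_num, by norm_num, ?_⟩
  intro S A _ _ _ _ _ _ H K hH M adv argmax harg pred R hR
  set I : QLP.Input S A H := ⟨K, R, pred, 4, 1, argmax⟩ with hI
  have hH1 : (1 : ℝ) ≤ H := by exact_mod_cast hH
  have hR0 : 0 < R := lt_of_lt_of_le
    (mul_pos (mul_pos (by exact_mod_cast Fintype.card_pos) (by exact_mod_cast Fintype.card_pos))
      (by positivity)) hR.1
  -- Without a positive gap every policy is optimal; a positive gap forces at least two actions,
  -- which the analysis of good runs needs.
  have hcases : QLP.regret M I adv = 0 ∨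
      (∃ h x a, 0 < M.gap h x a) ∧ 2 ≤ Fintype.card A := by
    by_cases hex : ∃ h x a, 0 < M.gap h x a
    · refine Or.inr ⟨hex, ?_⟩
      by_contra hcon
      obtain ⟨h, x, a, hp⟩ := hex
      obtain ⟨b, hb⟩ := M.exists_gap_eq_zero h x
      have : Fintype.card A ≤ 1 := by omega
      rw [Fintype.card_le_one_iff.1 this a b, hb] at hp
      exact lt_irrefl _ hp
    · push Not at hex
      exact Or.inl (QLP.regret_eq_zero M I adv fun h x a =>
        le_antisymm (hex h x a) (M.gap_nonneg h x a))
  refine ⟨fun hlow => ?_, fun hpos hlt => ?_, ?_⟩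
  · rcases hcases with h0 | ⟨hex, hA⟩
    · rw [h0]; positivity
    · obtain ⟨hR1, -, hK, hι⟩ := QLP.target_range hH hA hR
      have hr : QLP.Regime M K R (1 * R) :=
        QLP.regime_of_lambdaCost_le one_pos hR0 (by rw [one_mul]; exact hlow)
      refine (QLP.regret_le M I adv hH hK rfl rfl hR0.le (by linarith) (by omega) harg
        (D := 2 * (4194369 * (1 * R)) + 128 * R) (fun w hg => ?_) (by positivity)).trans
        (by linarith)
      have h1 := hg.sum_cost_le_of_regime hr hA hex hR
      have h2 := hg.sum_episodeGap_le hK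
      refine h2.trans ?_
      linarith
  · have e : ∀ lam : ℝ, QLP.lambdaCost M K lam = min
        (√(lam * (K * H * Fintype.card S * Fintype.card A * (H : ℝ) ^ 8 * QLP.iota S A H K)))
        ((H : ℝ) ^ 7 * QLP.iota S A H K * QLP.gapSum M) := fun lam => by
      rw [QLP.lambdaCost, QLP.gapSum]
      congr 2
      ring
    simp only [e]
    rw [e, one_mul] at hpos hlt
    exact QLP.existsUnique_ratio (Real.sqrt_pos.1 (lt_min_iff.1 hpos).1) (lt_min_iff.1 hpos).2 hlt
  · intro lam hlam hratio ε hε ε' hε' hpred hdist hlack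
    rw [div_eq_iff hlam.1.ne', mul_comm] at hratio
    have hc0 : 0 < lam * R := mul_pos hlam.1 hR0
    have hε0 : 0 < ε' := by rw [hε']; positivity
    have hfc : 0 ≤ QLP.foolingCost M K pred ε' := ENNReal.toReal_nonneg
    rw [hratio]
    rcases hcases with h0 | ⟨hex, hA⟩
    · rw [h0]; positivity
    · obtain ⟨hR1, -, hK, hι⟩ := QLP.target_range hH hA hR
      have hr := QLP.regime_of_lambdaCost_le hlam.1 hR0 hratio.le
      have hc1 := hr.one_le hH hA hex hR
      set c := lam * R
      -- Absorbs the additive 4 from the failure event.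
      have hHc : 1 ≤ H * c := one_le_mul_of_one_le_of_one_le hH1 hc1
      have hεT : 0 ≤ ε' * (K * H) := by positivity
      have hεTH : ε' * (K * H) ≤ ε' * (K * H) * H := le_mul_of_one_le_right hεT hH1
      refine (QLP.regret_le M I adv hH hK rfl rfl hR0.le (by linarith) (by omega) harg
        (D := 14 * (4194369 * (H * c) + 1025 * QLP.foolingCost M K pred ε') +
          4 * ε' * (K * H)) (fun w hg => ?_) (by positivity)).trans ?_
      · have h1 := mul_le_mul_of_nonneg_left (hg.sum_cost_le_of_regime hr hA hex hR)
          (zero_le_one.trans hH1)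
        have h2 := hg.sum_foolTerm_le hA hR hε0
        have h3 := hg.sum_episodeGap_le_of_distillation hε.le hε' hpred hdist hlack
        refine h3.trans ?_
        change _ ≤ 14 * (4194369 * (H * c) + 1025 * QLP.foolingCost M K pred ε') +
          4 * ε' * (I.K * H)
        linarith
      · linarith
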